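/- Throughout, $\log$ is the logarithm to base $2$, and for $p=\infty$ the expression $(p+1)^{1/p}$ (and its powers $(p+1)^{d/p}$, $(p+1)^{-1/(p\alpha)}$) is read as its limit $1$. **Function spaces.** For $u\subset\{1,\dots,d\}$ and $h\in\mathbb R^d$ with $h_i>0$ for $i\in u$ let $\Delta^{2,u}_h=\prod_{i\in u}\Delta^2_{h_i}$, where $\Delta^2_{h_i}$ is the second difference $g(x+2h_i)-2g(x+h_i)+g(x)$ in the $i$-th variable. Let $\mathring U^\alpha_\infty$ be the set of continuous $f$ on $[0,1]^d$ that vanish on the boundary of the cube and satisfy $$\max_{u\subset\{1,\dots,d\}}\ \sup_h\ \prod_{i\in u}h_i^{-\alpha}\ \sup\{|\Delta^{2,u}_hf(x)|:\ x\in[0,1]^d,\ x_i+2h_i\in[0,1]\ (i\in u)\}\le 1 .$$ Let $\mathring W^1_p$ be the space of $g\in L_p([0,1]^d)$ with weak partial derivatives in $L_p$ and zero trace on the boundary, with norm $\|g\|_{\mathring W^1_p}=\big(\sum_{i=1}^d\int_{[0,1]^d}|\partial_ig|^p\,dx\big)^{1/p}$ for $p<\infty$ and $\max_i\operatorname{ess\,sup}|\partial_ig|$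 for $p=\infty$. **Networks.** A network $\Phi=((W^1,b^1),\dots,(W^L,b^L))$ of depth $L(\Phi)=L\ge2$ with input dimension $d$ consists of real $N_\ell\times N_{\ell-1}$ matrices $W^\ell$ and vectors $b^\ell\in\mathbb R^{N_\ell}$ with $N_0=d$, $N_L=1$, $N_1,\dots,N_{L-1}\ge1$. Its size $W(\Phi)$ is the number of nonzero entries of all $W^\ell$ and $b^\ell$. Its ReLU output is $\mathcal N(\Phi,x)=z^L$, where $z^0=x$, $z^\ell=\sigma(W^\ell z^{\ell-1}+b^\ell)$ for $\ell<L$, $z^L=W^Lz^{L-1}+b^L$ and $\sigma(t)=\max\{t,0\}$ acts componentwise. An architecture is a network with all entries in $\{0,1\}$; $\Phi$ has architecture $\mathbb A$ if both have the same depth and dimensions $(N_\ell)$ and every entry of $\Phi$ is zero wherever the corresponding entry of $\mathbb A$ is. **Theorem.** Let $d\ge2$, $1<\alpha\le2$, $\beta>\alpha$ and $1\le p\le\infty$. Let $K_1=2(p+1)^{1/p}\max\big\{\frac{2\beta}{\beta-1},\frac1{2^{\alpha-1}-1}\big\}$ and $$\varepsilon_0=\min\Big\{1,\ \frac{d}{2^{\alpha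 d}(1-2^{1-\alpha})},\ \frac{K_1d^2}{(p+1)^{d/p}\,2^{(\alpha+1)d}\,\big(1-2^{-\frac{\beta-\alpha}{\beta-1}}\big)^d}\Big\},$$ $$B=B(d,\alpha,\beta,p)=\big(1-2^{-\frac1{\beta-1}}\big)\Big(\frac{(p+1)^{1/p}\,2^{\alpha+1}\big(1-2^{-\frac{\beta-\alpha}{\beta-1}}\big)}{d^{2\alpha/d}}\Big)^{\frac1{\alpha-1}} .$$ There are positive constants $K_2=K_2(\alpha)$ and $K_3=K_3(\alpha,\beta,p)$ such that for every $\varepsilon\in(0,\varepsilon_0)$ there is an architecture $\mathbb A_\varepsilon$ (independent of $f$) with the following property: for every $f\in\mathring U^\alpha_\infty$ there is a network $\Phi_f$ with architecture $\mathbb A_\varepsilon$ such that $f-\mathcal N(\Phi_f,\cdot)\in\mathring W^1_p$ and $$\|f-\mathcal N(\Phi_f,\cdot)\|_{\mathring W^1_p}\le\varepsilon ,$$ and moreover $$L(\mathbb A_\varepsilon)\le K_2\,\log d\,\max\{1,\log(\varepsilon^{-1})\},\qquad W(\mathbb A_\varepsilon)\le K_3\,B^{-d}\,(\varepsilon^{-1})^{\frac1{\alpha-1}}\max\{1,\log(\varepsilon^{-1})\}$$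 (where $\max\{1,\log(\varepsilon^{-1})\}=\log(\varepsilon^{-1})$ for $\varepsilon\le1/2$). Moreover, put $\lambda=\log\big(1-(p+1)^{-\frac1{p\alpha}}2^{-1-\frac1\alpha}\big)$. If $$2^{\frac1\alpha}-\tfrac12(p+1)^{-\frac1{p\alpha}}>1\qquad\text{and}\qquad\frac{\alpha+\lambda}{1+\lambda}<\beta<1-\frac1\lambda ,$$ then there are $d_0=d_0(\alpha,\beta,p)\in\mathbb N$ and $B_0=B_0(\alpha,\beta,p)>1$ such that $B(d,\alpha,\beta,p)\ge B_0$ for all $d\ge d_0$. The first of these two conditions holds for all $\alpha\in(1,2]$ if $1\le p\le2$. -/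

import Mathlib

open MeasureTheory Set
open scoped ENNReal ContDiff

noncomputable section

namespace ReLUApprox

/-! ### Deep neural networks -/

/-- Depth `L ≥ 2` and dimension `(N_0, …, N_L)` of a network with input dimension `d` and scalar
output. Only the values `width ℓ` with `ℓ ≤ depth` are ever used. -/
structure NetShape (d : ℕ) where
  depth : ℕ
  two_le_depth : 2 ≤ depth
  width : ℕ → ℕ
  width_zero : width 0 = d
  width_depth : width depth = 1
  width_pos : ∀ ℓ, 0 < ℓ → ℓ < depth → 0 < width ℓ

/-- A deep neural network of a given depth and dimension: `weight ℓ` and `bias ℓ` are the matrix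
and the vector that lead from layer `ℓ` to layer `ℓ + 1`, `0 ≤ ℓ < L`. -/
structure NeuralNet {d : ℕ} (S : NetShape d) where
  weight : (ℓ : Fin S.depth) → Matrix (Fin (S.width (ℓ + 1))) (Fin (S.width ℓ)) ℝ
  bias : (ℓ : Fin S.depth) → Fin (S.width (ℓ + 1)) → ℝ

namespace NeuralNet

variable {d : ℕ} {S : NetShape d}

/-- The depth (number of layers). -/
def depth (_Φ : NeuralNet S) : ℕ := S.depth

/-- The size: the number of nonzero edge and node weights. -/
def size (Φ : NeuralNet S) : ℕ :=
  (∑ ℓ : Fin S.depth, (Finset.univ.filter fun q : Fin (S.width (ℓ + 1)) × Fin (S.width ℓ) =>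
      Φ.weight ℓ q.1 q.2 ≠ 0).card) +
    ∑ ℓ : Fin S.depth, (Finset.univ.filter fun i : Fin (S.width (ℓ + 1)) => Φ.bias ℓ i ≠ 0).card

/-- The vector `z^ℓ` of the ReLU computation scheme; the activation is applied in every layer
except the last one. -/
def layer (Φ : NeuralNet S) (x : Fin d → ℝ) : (ℓ : ℕ) → ℓ ≤ S.depth → Fin (S.width ℓ) → ℝ
  | 0, _ => fun i => x (Fin.cast S.width_zero i)
  | ℓ + 1, h => fun i =>
      let a := ((Φ.weight ⟨ℓ, h⟩).mulVec (Φ.layer x ℓ (Nat.le_of_succ_le h)) + Φ.bias ⟨ℓ, h⟩) i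
      if ℓ + 1 = S.depth then a else max a 0

/-- The output of the deep ReLU network. -/
def output (Φ : NeuralNet S) (x : Fin d → ℝ) : ℝ :=
  Φ.layer x S.depth le_rfl (Fin.cast S.width_depth.symm 0)

/-- An architecture is a network whose weights all lie in `{0, 1}`. -/
def IsArchitecture (A : NeuralNet S) : Prop :=
  (∀ ℓ i j, A.weight ℓ i j = 0 ∨ A.weight ℓ i j = 1) ∧ ∀ ℓ i, A.bias ℓ i = 0 ∨ A.bias ℓ i = 1

/-- `Φ` has the architecture `A` (equality of the dimensions is part of the typing). -/
def HasArchitecture (Φ A : NeuralNet S) : Prop :=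
  (∀ ℓ i j, A.weight ℓ i j = 0 → Φ.weight ℓ i j = 0) ∧ ∀ ℓ i, A.bias ℓ i = 0 → Φ.bias ℓ i = 0

end NeuralNet

/-! ### Hölder–Zygmund spaces of mixed smoothness -/

/-- The closed unit cube `[0,1]^d`. -/
def unitCube (d : ℕ) : Set (Fin d → ℝ) := Icc 0 1

/-- The open unit cube `(0,1)^d`. -/
def openCube (d : ℕ) : Set (Fin d → ℝ) := {x | ∀ i, 0 < x i ∧ x i < 1}

/-- The second difference with step `h` in the `i`-th variable, as a linear operator. -/
def secondDiff {d : ℕ} (i : Fin d) (h : ℝ) : Module.End ℝ ((Fin d → ℝ) → ℝ) where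
  toFun f x := f (Function.update x i (x i + 2 * h)) - 2 * f (Function.update x i (x i + h)) + f x
  map_add' f g := by
    funext x
    simp only [Pi.add_apply]
    ring
  map_smul' c f := by
    funext x
    simp only [Pi.smul_apply, smul_eq_mul, RingHom.id_apply]
    ring

theorem secondDiff_commute {d : ℕ} {i j : Fin d} (hij : i ≠ j) (s t : ℝ) :
    Commute (secondDiff i s) (secondDiff j t) := by
  refine LinearMap.ext fun f => funext fun x => ?_
  simp only [Module.End.mul_apply, secondDiff, LinearMap.coe_mk, AddHom.coe_mk,
    Function.update_of_ne hij, Function.update_of_ne hij.symm, Function.update_comm hij]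
  ring

/-- The mixed difference operator `∏_{i ∈ u} Δ²_{h_i}`, the `i`-th factor acting on the `i`-th
variable. -/
def mixedDiff {d : ℕ} (u : Finset (Fin d)) (h : Fin d → ℝ) :
    Module.End ℝ ((Fin d → ℝ) → ℝ) :=
  u.noncommProd (fun i => secondDiff i (h i)) fun _ _ _ _ hij => secondDiff_commute hij _ _

/-- The set of `x ∈ [0,1]^d` with `x_i + 2 h_i ∈ [0,1]` for `i ∈ u`. -/
def diffDomain {d : ℕ} (u : Finset (Fin d)) (h : Fin d → ℝ) : Set (Fin d → ℝ) :=
  {x | x ∈ unitCube d ∧ ∀ i ∈ u, x i + 2 * h i ∈ Icc (0 : ℝ) 1}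

/-- The Hölder–Zygmund norm of mixed smoothness `α`, with value `∞` outside of the space. -/
def holderNorm {d : ℕ} (α : ℝ) (f : (Fin d → ℝ) → ℝ) : ℝ≥0∞ :=
  ⨆ (u : Finset (Fin d)) (h : Fin d → ℝ) (_ : ∀ i ∈ u, 0 < h i) (x ∈ diffDomain u h),
    ENNReal.ofReal ((∏ i ∈ u, h i ^ (-α)) * |mixedDiff u h f x|)

/-- The unit ball of the space of functions on `[0,1]^d` of mixed Hölder–Zygmund smoothness `α`
that vanish on the boundary of the cube. -/
def holderBall (d : ℕ) (α : ℝ) : Set ((Fin d → ℝ) → ℝ) :=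
  {f | ContinuousOn f (unitCube d) ∧
    (∀ x ∈ unitCube d, (∃ j, x j = 0 ∨ x j = 1) → f x = 0) ∧ holderNorm α f ≤ 1}

/-! ### The Sobolev space `W̊¹_p` on the unit cube -/

/-- The partial derivative `∂φ/∂x_i` of a smooth function. -/
def partialDeriv {d : ℕ} (i : Fin d) (φ : (Fin d → ℝ) → ℝ) (x : Fin d → ℝ) : ℝ :=
  fderiv ℝ φ x (Pi.single i 1)

/-- `G = (G_1, …, G_d)` is the weak gradient of `g` in `(0,1)^d`. -/
def IsWeakGradient {d : ℕ} (g : (Fin d → ℝ) → ℝ) (G : Fin d → (Fin d → ℝ) → ℝ) : Prop :=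
  LocallyIntegrableOn g (openCube d) ∧
    ∀ i, LocallyIntegrableOn (G i) (openCube d) ∧
      ∀ φ : (Fin d → ℝ) → ℝ, ContDiff ℝ ∞ φ → HasCompactSupport φ → tsupport φ ⊆ openCube d →
        ∫ x in openCube d, g x * partialDeriv i φ x = -∫ x in openCube d, G i x * φ x

/-- Vanishing trace on the boundary of the cube, for an integrable `g` with integrable weak
gradient `G`: in Green's formula
`∫_Ω g ∂_i φ + ∫_Ω G_i φ = ∫_{∂Ω} (tr g) φ ν_i`
the boundary term is zero for all `i` and all `φ` that are smooth up to the boundary. -/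
def HasZeroTrace {d : ℕ} (g : (Fin d → ℝ) → ℝ) (G : Fin d → (Fin d → ℝ) → ℝ) : Prop :=
  ∀ (i : Fin d) (φ : (Fin d → ℝ) → ℝ), ContDiff ℝ ∞ φ → HasCompactSupport φ →
    (∫ x in openCube d, g x * partialDeriv i φ x) + ∫ x in openCube d, G i x * φ x = 0

/-- Membership in `W̊¹_p` on the unit cube. -/
def MemSobolevZero {d : ℕ} (p : ℝ≥0∞) (g : (Fin d → ℝ) → ℝ) : Prop :=
  MemLp g p (volume.restrict (unitCube d)) ∧
    ∃ G : Fin d → (Fin d → ℝ) → ℝ, IsWeakGradient g G ∧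
      (∀ i, MemLp (G i) p (volume.restrict (unitCube d))) ∧ HasZeroTrace g G

/-- `(∑_i ∫ |G_i|^p)^{1/p}` for `p < ∞` and `max_i ess sup |G_i|` for `p = ∞`. -/
def gradNorm {d : ℕ} (p : ℝ≥0∞) (G : Fin d → (Fin d → ℝ) → ℝ) : ℝ≥0∞ :=
  if p = ⊤ then ⨆ i, essSup (fun x => ‖G i x‖ₑ) (volume.restrict (unitCube d))
  else (∑ i, ∫⁻ x in unitCube d, ‖G i x‖ₑ ^ p.toReal) ^ (1 / p.toReal)

/-- The norm of `W̊¹_p`. Weak gradients are unique almost everywhere, so that the infimum is over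
one value if there is a weak gradient, and it is `∞` if there is none. -/
def sobolevNorm {d : ℕ} (p : ℝ≥0∞) (g : (Fin d → ℝ) → ℝ) : ℝ≥0∞ :=
  ⨅ (G : Fin d → (Fin d → ℝ) → ℝ) (_ : IsWeakGradient g G), gradNorm p G

/-! ### The explicit quantities -/

/-- `(p + 1)^{1/p}`, which at `p = ∞` is understood as the limit `1`. -/
def cP (p : ℝ≥0∞) : ℝ := if p = ⊤ then 1 else (p.toReal + 1) ^ (1 / p.toReal)

/-- `1 - 2^{-(β-α)/(β-1)}`. -/
def qAB (α β : ℝ) : ℝ := 1 - 2 ^ (-((β - α) / (β - 1)))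

/-- `K_1 = 2 (p+1)^{1/p} max {2β/(β-1), 1/(2^{α-1}-1)}`. -/
def K1 (α β : ℝ) (p : ℝ≥0∞) : ℝ :=
  2 * cP p * max (2 * β / (β - 1)) (1 / (2 ^ (α - 1) - 1))

/-- The threshold `ε_0`. -/
def eps0 (d : ℕ) (α β : ℝ) (p : ℝ≥0∞) : ℝ :=
  min 1 (min ((d : ℝ) / (2 ^ (α * d) * (1 - 2 ^ (1 - α))))
    (K1 α β p * (d : ℝ) ^ 2 / (cP p ^ d * 2 ^ ((α + 1) * d) * qAB α β ^ d)))

/-- The base `B = B(d, α, β, p)`. -/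
def baseB (d : ℕ) (α β : ℝ) (p : ℝ≥0∞) : ℝ :=
  (1 - 2 ^ (-(1 / (β - 1)))) *
    (cP p * 2 ^ (α + 1) * qAB α β / (d : ℝ) ^ (2 * α / d)) ^ (1 / (α - 1))

/-- The condition `2^{1/α} - (p+1)^{-1/(pα)}/2 > 1`. -/
def CondAlpha (α : ℝ) (p : ℝ≥0∞) : Prop :=
  1 < (2 : ℝ) ^ (1 / α) - cP p ^ (-(1 / α)) / 2

/-- `log₂ (1 - (p+1)^{-1/(pα)} 2^{-1-1/α})`. -/
def ellAP (α : ℝ) (p : ℝ≥0∞) : ℝ :=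
  Real.logb 2 (1 - cP p ^ (-(1 / α)) * 2 ^ (-1 - 1 / α))

/-- The two-sided condition on `β`. -/
def CondBeta (α β : ℝ) (p : ℝ≥0∞) : Prop :=
  (α + ellAP α p) / (1 + ellAP α p) < β ∧ β < 1 - 1 / ellAP α p

end ReLUApprox

end

/-! Every `f` of the class is the sum of its Faber series over the levels `k`. The hats of one level
have essentially disjoint supports, and their coefficients are at most `2^{-(α+1)d} 2^{-α|k|₁}`.
Differentiation in direction `i` costs `2^{k_i}` in that direction only, while each of the other `d
- 1` factors has `L_p` norm `(p+1)^{-1/p}`. So level `k` contributes, up to a constant, `2^{-(α+1)d}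
(p+1)^{-(d-1)/p} 2^{-α|k|₁ + k_i}`.

This anisotropy makes it enough to keep the levels with `β|k|₁ - |k|_∞ ≤ (β-1)m`. The number of
their hats (`sum_two_pow_sparseSet_le`) and the tail (`sum_tail_le`) are geometric sums in which `m`
enters only through `2^m` and `2^{-(α-1)m}`, without powers of `m`, and the dimension mainly through
explicit constants to the power `d`. Solving for `m` gives `ε^{-1/(α-1)}`, and these constants make
up `B^{-d}`.

A univariate hat is a ReLU expression, a product of `d` hats is not. It is replaced by a binary tree
of approximate multiplications, obtained by polarization from the piecewise linear interpolant of
the square. The error of the interpolant has Lipschitz constant `2^{-R}`, which controls gradients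
(`abs_treeApprox_error_sub_le`). Its convexity keeps the products in `[0,1]`, and a zero factor
gives exactly zero. Hence the approximate hats keep their supports, the error is a series of
Lipschitz functions that vanish outside of the open cube, and `sobolev_of_hasSum` puts it into the
space with zero trace. The threshold on `ε` forces `d = O(log ε⁻¹)`, so an `R` of that order beats
all constants to the power `d`.

All products are computed in parallel by weights that do not depend on `f`. The function enters
through the output layer only, so one architecture serves the whole class. -/

noncomputable section

namespace ReLUApprox

/-! ### Piecewise linear approximation of squares and products -/

/-- The tent map, written with the ReLU function. -/
def tent (y : ℝ) : ℝ := 2 * y - 4 * max (y - 1 / 2) 0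

/-- The piecewise linear interpolant of `x ↦ x ^ 2` on the dyadic grid of level `s`. -/
def sqApprox : ℕ → ℝ → ℝ
  | 0, x => x
  | s + 1, x => sqApprox s x - tent^[s + 1] x / 4 ^ (s + 1)

theorem tent_of_le {y : ℝ} (h : y ≤ 1 / 2) : tent y = 2 * y := by
  rw [tent, max_eq_right (by linarith)]; ring

theorem tent_of_ge {y : ℝ} (h : 1 / 2 ≤ y) : tent y = 2 - 2 * y := by
  rw [tent, max_eq_left (by linarith)]; ring

theorem tent_mem {y : ℝ} (h : y ∈ Icc (0 : ℝ) 1) : tent y ∈ Icc (0 : ℝ) 1 := by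
  obtain ⟨h0, h1⟩ := h
  rcases le_total y (1 / 2) with h | h
  · rw [tent_of_le h]; constructor <;> linarith
  · rw [tent_of_ge h]; constructor <;> linarith

theorem tent_iterate_mem {y : ℝ} (h : y ∈ Icc (0 : ℝ) 1) (s : ℕ) :
    tent^[s] y ∈ Icc (0 : ℝ) 1 := by
  induction s with
  | zero => simpa using h
  | succ s ih => rw [Function.iterate_succ_apply']; exact tent_mem ih

theorem abs_tent_sub_le (x y : ℝ) : |tent x - tent y| ≤ 2 * |x - y| := by
  rcases le_total x (1 / 2) with hx | hx <;> rcases le_total y (1 / 2) with hy | hy <;>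
    simp only [tent_of_le, tent_of_ge, hx, hy] <;> rw [abs_le] <;>
    constructor <;> cases abs_cases (x - y) <;> linarith

theorem abs_tent_iterate_sub_le (x y : ℝ) (s : ℕ) :
    |tent^[s] x - tent^[s] y| ≤ 2 ^ s * |x - y| := by
  induction s with
  | zero => simp
  | succ s ih =>
    rw [Function.iterate_succ_apply', Function.iterate_succ_apply']
    calc _ ≤ 2 * |tent^[s] x - tent^[s] y| := abs_tent_sub_le _ _
      _ ≤ 2 * (2 ^ s * |x - y|) := by gcongr
      _ = _ := by ring

/-- The bump `y - y ^ 2` is self-similar under the tent map: each step of the recursion leaves a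
copy of it that is smaller by the factor 4. The estimates below rest on this closed form of the
error. -/
theorem sqApprox_eq (s : ℕ) (x : ℝ) :
    sqApprox s x = x ^ 2 + (tent^[s] x - (tent^[s] x) ^ 2) / 4 ^ s := by
  induction s with
  | zero => simp [sqApprox]
  | succ s ih =>
    rw [sqApprox, ih, Function.iterate_succ_apply']
    generalize tent^[s] x = y
    have key : y - y ^ 2 = tent y / 4 + (tent y - tent y ^ 2) / 4 := by
      rcases le_total y (1 / 2) with h | h
      · rw [tent_of_le h]; ring
      · rw [tent_of_ge h]; ring
    rw [key, pow_succ]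
    field_simp
    ring

theorem sq_le_sqApprox (s : ℕ) {x : ℝ} (hx : x ∈ Icc (0 : ℝ) 1) : x ^ 2 ≤ sqApprox s x := by
  rw [sqApprox_eq]
  obtain ⟨h0, h1⟩ := tent_iterate_mem hx s
  have : 0 ≤ (tent^[s] x - (tent^[s] x) ^ 2) / 4 ^ s := by
    apply div_nonneg _ (by positivity)
    nlinarith
  linarith

theorem sqApprox_nonneg (s : ℕ) {x : ℝ} (hx : x ∈ Icc (0 : ℝ) 1) : 0 ≤ sqApprox s x :=
  (sq_nonneg x).trans (sq_le_sqApprox s hx)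

theorem tent_iterate_zero (s : ℕ) : tent^[s] 0 = 0 := by
  induction s with
  | zero => rfl
  | succ s ih => rw [Function.iterate_succ_apply', ih, tent_of_le (by norm_num)]; ring

theorem sqApprox_zero (s : ℕ) : sqApprox s 0 = 0 := by
  simp [sqApprox_eq, tent_iterate_zero]

theorem sqApprox_one (s : ℕ) : sqApprox s 1 = 1 := by
  have h : tent^[s] 1 - (tent^[s] 1) ^ 2 = 0 := by
    cases s with
    | zero => simp
    | succ s =>
      rw [Function.iterate_succ_apply, tent_of_ge (by norm_num)]
      norm_num [tent_iterate_zero]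
  rw [sqApprox_eq, h]; simp

/-- The bump is 1-Lipschitz on the unit interval, `tent^[s]` is `2 ^ s`-Lipschitz, and the error
carries the factor `4 ^ (-s)`. Gradients need this Lipschitz bound; a sup bound would not do. -/
theorem abs_sqApprox_error_sub_le (s : ℕ) {x y : ℝ} (hx : x ∈ Icc (0 : ℝ) 1)
    (hy : y ∈ Icc (0 : ℝ) 1) :
    |(sqApprox s x - x ^ 2) - (sqApprox s y - y ^ 2)| ≤ (2 ^ s)⁻¹ * |x - y| := by
  have h := abs_tent_iterate_sub_le x y s
  obtain ⟨a0, a1⟩ := tent_iterate_mem hx s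
  obtain ⟨b0, b1⟩ := tent_iterate_mem hy s
  rw [sqApprox_eq, sqApprox_eq]
  generalize tent^[s] x = a at *
  generalize tent^[s] y = b at *
  have e : (x ^ 2 + (a - a ^ 2) / 4 ^ s - x ^ 2) - (y ^ 2 + (b - b ^ 2) / 4 ^ s - y ^ 2) =
      (a - b) * (1 - a - b) / 4 ^ s := by ring
  have h1 : |1 - a - b| ≤ 1 := by rw [abs_le]; constructor <;> linarith
  rw [e, abs_div, abs_mul, abs_of_pos (by positivity : (0 : ℝ) < 4 ^ s), div_le_iff₀ (by positivity)]
  have h4 : (4 : ℝ) ^ s = 2 ^ s * 2 ^ s := by rw [← mul_pow]; norm_num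
  calc |a - b| * |1 - a - b| ≤ |a - b| * 1 := by gcongr
    _ ≤ 2 ^ s * |x - y| := by linarith
    _ = (2 ^ s)⁻¹ * |x - y| * 4 ^ s := by rw [h4]; field_simp

/-- The line through two consecutive points of the parabola, at the dyadic level `s`. -/
def dyadicChord (s : ℕ) (n : ℤ) (x : ℝ) : ℝ :=
  ((2 * n + 1) * (2 ^ s * x) - n * (n + 1)) / 4 ^ s

/-- The iterated tent map is a zigzag of slope `± 2 ^ s`. Only the form of its pieces is recorded;
the bounds 0 and 1 on its values later identify the cell of `x`. -/
theorem exists_tent_iterate_eq (s : ℕ) (x : ℝ) :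
    ∃ n : ℤ, tent^[s] x = 2 ^ s * x - n ∨ tent^[s] x = n + 1 - 2 ^ s * x := by
  induction s with
  | zero => exact ⟨0, Or.inl (by simp)⟩
  | succ s ih =>
    obtain ⟨n, hn⟩ := ih
    rw [Function.iterate_succ_apply']
    rcases le_total (tent^[s] x) (1 / 2) with h | h
    · rw [tent_of_le h]
      rcases hn with hn | hn
      · exact ⟨2 * n, Or.inl (by rw [hn]; push_cast; ring)⟩
      · exact ⟨2 * n + 1, Or.inr (by rw [hn]; push_cast; ring)⟩
    · rw [tent_of_ge h]
      rcases hn with hn | hn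
      · exact ⟨2 * n + 1, Or.inr (by rw [hn]; push_cast; ring)⟩
      · exact ⟨2 * n, Or.inl (by rw [hn]; push_cast; ring)⟩

/-- With `t = 2 ^ s * x`, the chords `n` and `m` differ by `(n - m) * (2 * t - n - m - 1) / 4 ^ s`,
which is nonnegative on cell `n`. So the interpolant is a maximum of affine functions. -/
theorem exists_sqApprox_eq_chord (s : ℕ) {x : ℝ} (hx : x ∈ Icc (0 : ℝ) 1) :
    ∃ n : ℤ, sqApprox s x = dyadicChord s n x ∧ ∀ m : ℤ, dyadicChord s m x ≤ sqApprox s x := by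
  obtain ⟨n, hn⟩ := exists_tent_iterate_eq s x
  obtain ⟨h0, h1⟩ := tent_iterate_mem hx s
  have hn0 : (n : ℝ) ≤ 2 ^ s * x ∧ 2 ^ s * x ≤ n + 1 := by
    rcases hn with hn | hn <;> rw [hn] at h0 h1 <;> constructor <;> linarith
  have h4 : (4 : ℝ) ^ s = 2 ^ s * 2 ^ s := by rw [← mul_pow]; norm_num
  have e : sqApprox s x = dyadicChord s n x := by
    rw [sqApprox_eq, dyadicChord]
    rcases hn with hn | hn <;> rw [hn, h4] <;> field_simp <;> ring
  refine ⟨n, e, fun m => ?_⟩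
  rw [e, dyadicChord, dyadicChord]
  gcongr ?_ / _
  generalize 2 ^ s * x = t at *
  obtain ⟨ha, hb⟩ := hn0
  rcases lt_trichotomy m n with h | h | h
  · have h' : (m : ℝ) + 1 ≤ n := by exact_mod_cast h
    nlinarith
  · rw [h]
  · have h' : (n : ℝ) + 1 ≤ m := by exact_mod_cast h
    nlinarith

/-- Convexity of the interpolant, in the form of increasing increments. -/
theorem sqApprox_add_le (s : ℕ) {a b c d : ℝ} (ha : 0 ≤ a) (hab : a ≤ b) (hac : a ≤ c) (hd : d ≤ 1)
    (h : b + c = a + d) : sqApprox s b + sqApprox s c ≤ sqApprox s a + sqApprox s d := by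
  wlog hbc : b ≤ c generalizing b c
  · rw [add_comm]
    exact this hac hab (by linarith) (by linarith)
  obtain ⟨n, hn, hn'⟩ := exists_sqApprox_eq_chord s (x := b) ⟨by linarith, by linarith⟩
  obtain ⟨m, hm, hm'⟩ := exists_sqApprox_eq_chord s (x := c) ⟨by linarith, by linarith⟩
  obtain ⟨-, -, ka⟩ := exists_sqApprox_eq_chord s (x := a) ⟨by linarith, by linarith⟩
  obtain ⟨-, -, kd⟩ := exists_sqApprox_eq_chord s (x := d) ⟨by linarith, by linarith⟩
  have slope : ∀ (n : ℤ) (x y : ℝ), dyadicChord s n x =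
      dyadicChord s n y + (2 * n + 1) * 2 ^ s / 4 ^ s * (x - y) := by
    intro n x y; simp only [dyadicChord]; ring
  rcases hbc.eq_or_lt with rfl | hlt
  · have h1 := ka n
    have h2 := kd n
    rw [slope n a b] at h1
    rw [slope n d b] at h2
    have : d = 2 * b - a := by linarith
    subst this
    nlinarith
  · have h1 := ka n
    have h2 := kd m
    have h3 := hn' m
    have h4 := hm' n
    rw [slope n a b] at h1
    rw [slope m d c] at h2
    rw [slope m b c] at h3
    rw [slope n c b] at h4
    generalize (2 * (n : ℝ) + 1) * 2 ^ s / 4 ^ s = σ at *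
    generalize (2 * (m : ℝ) + 1) * 2 ^ s / 4 ^ s = τ at *
    -- Each of the two chords touches the graph at `b` or `c` and lies below it at the other point;
    -- adding these facts orders the slopes.
    have h5 : 0 ≤ (τ - σ) * (c - b) := by nlinarith
    have h6 : σ ≤ τ := by
      by_contra hc
      push Not at hc
      nlinarith
    have : d = b + c - a := by linarith
    subst this
    nlinarith

/-- The approximate product. -/
def mulApprox (R : ℕ) (x y : ℝ) : ℝ :=
  2 * (sqApprox R ((x + y) / 2) - sqApprox R (x / 2) - sqApprox R (y / 2))

/-- The product with zero is exact. Hence the approximate hats vanish wherever a univariate hat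
does, in particular outside of the open cube. -/
theorem mulApprox_zero_left (R : ℕ) (y : ℝ) : mulApprox R 0 y = 0 := by
  simp [mulApprox, sqApprox_zero]

theorem mulApprox_zero_right (R : ℕ) (x : ℝ) : mulApprox R x 0 = 0 := by
  simp [mulApprox, sqApprox_zero]

/-- The lower bound is superadditivity of a convex function that vanishes at 0. For the upper bound,
increasing increments move `x` and then `y` up to 1, and the square of `1 / 2` is not
underestimated. Staying in the unit interval lets the multiplications be iterated. -/
theorem mulApprox_mem (R : ℕ) {x y : ℝ} (hx : x ∈ Icc (0 : ℝ) 1) (hy : y ∈ Icc (0 : ℝ) 1) :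
    mulApprox R x y ∈ Icc (0 : ℝ) 1 := by
  obtain ⟨x0, x1⟩ := hx
  obtain ⟨y0, y1⟩ := hy
  have h1 := sqApprox_add_le R (a := 0) (b := x / 2) (c := y / 2) (d := (x + y) / 2)
    le_rfl (by linarith) (by linarith) (by linarith) (by ring)
  have h2 := sqApprox_add_le R (a := x / 2) (b := (x + y) / 2) (c := 1 / 2) (d := 1 / 2 + y / 2)
    (by linarith) (by linarith) (by linarith) (by linarith) (by ring)
  have h3 := sqApprox_add_le R (a := y / 2) (b := 1 / 2 + y / 2) (c := 1 / 2) (d := 1)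
    (by linarith) (by linarith) (by linarith) (by linarith) (by ring)
  have h4 := sq_le_sqApprox R (x := 1 / 2) ⟨by norm_num, by norm_num⟩
  rw [sqApprox_zero] at h1
  rw [sqApprox_one] at h3
  rw [mulApprox]
  constructor <;> linarith

/-- Only `x` varies, so the term with `y / 2` cancels; the arguments of the other two squares move
by half of `|x' - x|`. -/
theorem abs_mulApprox_error_sub_le (R : ℕ) {x x' y : ℝ} (hx : x ∈ Icc (0 : ℝ) 1)
    (hx' : x' ∈ Icc (0 : ℝ) 1) (hy : y ∈ Icc (0 : ℝ) 1) :
    |(mulApprox R x' y - x' * y) - (mulApprox R x y - x * y)| ≤ 2 * (2 ^ R)⁻¹ * |x' - x| := by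
  obtain ⟨x0, x1⟩ := hx
  obtain ⟨x0', x1'⟩ := hx'
  obtain ⟨y0, y1⟩ := hy
  have h1 := abs_sqApprox_error_sub_le R (x := (x' + y) / 2) (y := (x + y) / 2)
    ⟨by linarith, by linarith⟩ ⟨by linarith, by linarith⟩
  have h2 := abs_sqApprox_error_sub_le R (x := x' / 2) (y := x / 2)
    ⟨by linarith, by linarith⟩ ⟨by linarith, by linarith⟩
  have e1 : |(x' + y) / 2 - (x + y) / 2| = |x' - x| / 2 := by
    rw [← abs_two, ← abs_div]; simp only [abs_two]; congr 1; ring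
  have e2 : |x' / 2 - x / 2| = |x' - x| / 2 := by
    rw [← abs_two, ← abs_div]; simp only [abs_two]; congr 1; ring
  rw [e1] at h1
  rw [e2] at h2
  set A := (sqApprox R ((x' + y) / 2) - ((x' + y) / 2) ^ 2) -
    (sqApprox R ((x + y) / 2) - ((x + y) / 2) ^ 2) with hA
  set C := (sqApprox R (x' / 2) - (x' / 2) ^ 2) - (sqApprox R (x / 2) - (x / 2) ^ 2) with hC
  have e : (mulApprox R x' y - x' * y) - (mulApprox R x y - x * y) = 2 * A - 2 * C := by
    simp only [mulApprox, hA, hC]; ring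
  rw [e]
  calc |2 * A - 2 * C| ≤ |2 * A| + |2 * C| := abs_sub _ _
    _ = 2 * |A| + 2 * |C| := by simp [abs_mul]
    _ ≤ 2 * ((2 ^ R)⁻¹ * (|x' - x| / 2)) + 2 * ((2 ^ R)⁻¹ * (|x' - x| / 2)) := by gcongr
    _ = _ := by ring

theorem mulApprox_comm (R : ℕ) (x y : ℝ) : mulApprox R x y = mulApprox R y x := by
  simp only [mulApprox, add_comm x y]; ring

/-! ### Products of many factors -/

/-- The binary tree of approximate products over the block `[a 2^j, (a+1) 2^j)`. -/
def treeApprox (R : ℕ) (v : ℕ → ℝ) : ℕ → ℕ → ℝ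
  | 0, a => v a
  | j + 1, a => mulApprox R (treeApprox R v j (2 * a)) (treeApprox R v j (2 * a + 1))

/-- The exact product over the block `[a 2^j, (a+1) 2^j)`. -/
def blockProd (v : ℕ → ℝ) (j a : ℕ) : ℝ := ∏ b ∈ Finset.Ico (a * 2 ^ j) ((a + 1) * 2 ^ j), v b

theorem blockProd_succ (v : ℕ → ℝ) (j a : ℕ) :
    blockProd v (j + 1) a = blockProd v j (2 * a) * blockProd v j (2 * a + 1) := by
  have e1 : a * 2 ^ (j + 1) = 2 * a * 2 ^ j := by ring
  have e2 : (a + 1) * 2 ^ (j + 1) = (2 * a + 1 + 1) * 2 ^ j := by ring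
  rw [blockProd, blockProd, blockProd, e1, e2, Finset.prod_Ico_consecutive]
  · gcongr; omega
  · gcongr; omega

theorem treeApprox_mem (R : ℕ) {v : ℕ → ℝ} (hv : ∀ b, v b ∈ Icc (0 : ℝ) 1) (j a : ℕ) :
    treeApprox R v j a ∈ Icc (0 : ℝ) 1 := by
  induction j generalizing a with
  | zero => exact hv a
  | succ j ih => exact mulApprox_mem R (ih _) (ih _)

theorem treeApprox_congr (R : ℕ) {v w : ℕ → ℝ} (j a : ℕ)
    (h : ∀ b, a * 2 ^ j ≤ b → b < (a + 1) * 2 ^ j → v b = w b) :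
    treeApprox R v j a = treeApprox R w j a := by
  induction j generalizing a with
  | zero => exact h a (by simp) (by simp)
  | succ j ih =>
    have e1 : a * 2 ^ (j + 1) = 2 * a * 2 ^ j := by ring
    have e2 : (a + 1) * 2 ^ (j + 1) = (2 * a + 1 + 1) * 2 ^ j := by ring
    have e3 : (2 * a + 1) * 2 ^ j = 2 * a * 2 ^ j + 2 ^ j := by ring
    have e4 : (2 * a + 1 + 1) * 2 ^ j = 2 * a * 2 ^ j + 2 ^ j + 2 ^ j := by ring
    rw [treeApprox, treeApprox, ih (2 * a) fun b h1 h2 => h b (by omega) (by omega),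
      ih (2 * a + 1) fun b h1 h2 => h b (by omega) (by omega)]

theorem treeApprox_eq_zero (R : ℕ) {v : ℕ → ℝ} (j a : ℕ) {b : ℕ} (h1 : a * 2 ^ j ≤ b)
    (h2 : b < (a + 1) * 2 ^ j) (hb : v b = 0) : treeApprox R v j a = 0 := by
  induction j generalizing a with
  | zero =>
    have : b = a := by simp at h1 h2; omega
    rw [treeApprox, ← this, hb]
  | succ j ih =>
    have e1 : a * 2 ^ (j + 1) = 2 * a * 2 ^ j := by ring
    have e2 : (a + 1) * 2 ^ (j + 1) = (2 * a + 1 + 1) * 2 ^ j := by ring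
    rw [treeApprox]
    rcases lt_or_ge b ((2 * a + 1) * 2 ^ j) with h | h
    · rw [ih (2 * a) (by omega) h, mulApprox_zero_left]
    · rw [ih (2 * a + 1) h (by omega), mulApprox_zero_right]

theorem abs_blockProd_update_sub_le {v : ℕ → ℝ} (hv : ∀ b, v b ∈ Icc (0 : ℝ) 1) (b : ℕ) (t : ℝ)
    (j a : ℕ) : |blockProd (Function.update v b t) j a - blockProd v j a| ≤ |t - v b| := by
  by_cases hb : b ∈ Finset.Ico (a * 2 ^ j) ((a + 1) * 2 ^ j)
  · rw [blockProd, blockProd, Finset.prod_update_of_mem hb,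
      ← Finset.mul_prod_erase _ v hb, Finset.sdiff_singleton_eq_erase, ← sub_mul, abs_mul]
    apply mul_le_of_le_one_right (abs_nonneg _)
    rw [abs_of_nonneg (Finset.prod_nonneg fun b _ => (hv b).1)]
    exact Finset.prod_le_one (fun b _ => (hv b).1) fun b _ => (hv b).2
  · rw [blockProd, blockProd, Finset.prod_update_of_notMem hb]
    simp

/-- The error of the approximate product is Lipschitz in every factor. -/
theorem abs_treeApprox_error_sub_le (R : ℕ) (hR : 1 ≤ R) {v : ℕ → ℝ} (b : ℕ) (t : ℝ)
    (hv : ∀ b, v b ∈ Icc (0 : ℝ) 1) (ht : t ∈ Icc (0 : ℝ) 1) (j a : ℕ) :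
    |(treeApprox R (Function.update v b t) j a - blockProd (Function.update v b t) j a) -
      (treeApprox R v j a - blockProd v j a)| ≤ 4 ^ j * (2 * (2 ^ R)⁻¹) * |t - v b| := by
  -- A Lipschitz bound yields a sup bound: moving one factor to 0 makes the tree and the product
  -- vanish together.
  have gap : ∀ (j a : ℕ), (∀ (v : ℕ → ℝ) (b : ℕ) (t : ℝ), (∀ b, v b ∈ Icc (0 : ℝ) 1) →
      t ∈ Icc (0 : ℝ) 1 →
      |(treeApprox R (Function.update v b t) j a - blockProd (Function.update v b t) j a) -
      (treeApprox R v j a - blockProd v j a)| ≤ 4 ^ j * (2 * (2 ^ R)⁻¹) * |t - v b|) →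
      ∀ v : ℕ → ℝ, (∀ b, v b ∈ Icc (0 : ℝ) 1) →
      |treeApprox R v j a - blockProd v j a| ≤ 4 ^ j * (2 * (2 ^ R)⁻¹) := by
    intro j a H v hv
    have hb : a * 2 ^ j < (a + 1) * 2 ^ j := by gcongr; omega
    have h := H v (a * 2 ^ j) 0 hv ⟨le_rfl, zero_le_one⟩
    rw [treeApprox_eq_zero R j a le_rfl hb (Function.update_self _ _ _), blockProd,
      Finset.prod_eq_zero (Finset.mem_Ico.2 ⟨le_rfl, hb⟩) (Function.update_self _ _ _),
      sub_zero, zero_sub, abs_neg, zero_sub, abs_neg] at h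
    refine h.trans (mul_le_of_le_one_right (by positivity) ?_)
    rw [abs_of_nonneg (hv _).1]
    exact (hv _).2
  -- One multiplication: the gate contributes at most `δ * |u' - u| ≤ 2 * e * τ`, the errors of the
  -- two children at most `e * τ` each. Hence a factor 4 per level of the tree.
  have main : ∀ (e δ u u' U U' w W τ : ℝ) (z z' : ℝ), 0 ≤ δ → δ ≤ 1 → δ ≤ e → 0 ≤ τ →
      |(u' - U') - (u - U)| ≤ e * τ → |U' - U| ≤ τ → |w - W| ≤ e → w ∈ Icc (0 : ℝ) 1 →
      |(z' - u' * w) - (z - u * w)| ≤ δ * |u' - u| →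
      |(z' - U' * W) - (z - U * W)| ≤ 4 * e * τ := by
    intro e δ u u' U U' w W τ z z' hδ hδ1 he hτ h1 h2 h3 h4 h5
    have e1 : (z' - U' * W) - (z - U * W) = ((z' - u' * w) - (z - u * w)) +
      ((u' - U') - (u - U)) * w + (U' - U) * (w - W) := by ring
    have e2 : u' - u = ((u' - U') - (u - U)) + (U' - U) := by ring
    have hu : |u' - u| ≤ e * τ + τ := by
      rw [e2]; exact (abs_add_le _ _).trans (add_le_add h1 h2)
    have hw : |w| ≤ 1 := by rw [abs_of_nonneg h4.1]; exact h4.2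
    rw [e1]
    refine (abs_add_three _ _ _).trans ?_
    rw [abs_mul, abs_mul]
    have a1 : δ * |u' - u| ≤ e * τ + e * τ := by
      calc δ * |u' - u| ≤ δ * (e * τ + τ) := by gcongr
        _ = δ * (e * τ) + δ * τ := by ring
        _ ≤ 1 * (e * τ) + e * τ := by
          have : 0 ≤ e * τ := mul_nonneg (hδ.trans he) hτ
          gcongr
        _ = _ := by ring
    have a2 : |(u' - U') - (u - U)| * |w| ≤ e * τ := by
      have : 0 ≤ e * τ := mul_nonneg (hδ.trans he) hτ
      calc _ ≤ (e * τ) * 1 := by gcongr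
        _ = _ := by ring
    have a3 : |U' - U| * |w - W| ≤ τ * e := by gcongr
    linarith
  have hδ1 : 2 * ((2 : ℝ) ^ R)⁻¹ ≤ 1 := by
    rw [← div_eq_mul_inv, div_le_one (by positivity)]
    calc (2 : ℝ) = 2 ^ 1 := by norm_num
      _ ≤ 2 ^ R := by gcongr; norm_num
  induction j generalizing a b t v with
  | zero =>
    have : ∀ v : ℕ → ℝ, treeApprox R v 0 a - blockProd v 0 a = 0 := by
      intro v; simp [treeApprox, blockProd]
    rw [this, this]; simp
  | succ j ih =>
    have hv' : ∀ c, Function.update v b t c ∈ Icc (0 : ℝ) 1 := by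
      intro c
      rcases eq_or_ne c b with rfl | h
      · rwa [Function.update_self]
      · rw [Function.update_of_ne h]; exact hv c
    have he : 2 * ((2 : ℝ) ^ R)⁻¹ ≤ 4 ^ j * (2 * ((2 : ℝ) ^ R)⁻¹) := by
      apply le_mul_of_one_le_left (by positivity)
      exact one_le_pow₀ (by norm_num)
    have IH := fun (a : ℕ) => gap j a (fun v b t hv ht => ih b t hv ht a) v hv
    have e3 : (2 * a + 1) * 2 ^ j = 2 * a * 2 ^ j + 2 ^ j := by ring
    have agree : ∀ c, (b < c * 2 ^ j ∨ (c + 1) * 2 ^ j ≤ b) →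
        treeApprox R (Function.update v b t) j c = treeApprox R v j c ∧
        blockProd (Function.update v b t) j c = blockProd v j c := by
      intro c hc
      constructor
      · apply treeApprox_congr
        intro b' h1 h2
        rw [Function.update_of_ne]; omega
      · rw [blockProd, blockProd, Finset.prod_update_of_notMem]
        rw [Finset.mem_Ico]; omega
    have fin : 4 ^ (j + 1) * (2 * ((2 : ℝ) ^ R)⁻¹) * |t - v b| =
        4 * (4 ^ j * (2 * ((2 : ℝ) ^ R)⁻¹)) * |t - v b| := by ring
    rw [fin, blockProd_succ, blockProd_succ, treeApprox, treeApprox]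
    -- Only the half of the block on the side of `b` can change; the other half is the fixed factor
    -- `w` of `main`.
    rcases lt_or_ge b ((2 * a + 1) * 2 ^ j) with hb | hb
    · obtain ⟨q1, q2⟩ := agree (2 * a + 1) (Or.inl hb)
      rw [q1, q2]
      exact main _ _ _ _ _ _ _ _ _ _ _ (by positivity) hδ1 he (abs_nonneg _) (ih b t hv ht (2 * a))
        (abs_blockProd_update_sub_le hv b t j (2 * a)) (IH (2 * a + 1)) (treeApprox_mem R hv _ _)
        (abs_mulApprox_error_sub_le R (treeApprox_mem R hv _ _) (treeApprox_mem R hv' _ _)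
          (treeApprox_mem R hv _ _))
    · obtain ⟨q1, q2⟩ := agree (2 * a) (Or.inr hb)
      rw [q1, q2, mulApprox_comm R (treeApprox R v j (2 * a)), mulApprox_comm R (treeApprox R v j (2 * a)),
        mul_comm (blockProd v j (2 * a)), mul_comm (blockProd v j (2 * a))]
      exact main _ _ _ _ _ _ _ _ _ _ _ (by positivity) hδ1 he (abs_nonneg _)
        (ih b t hv ht (2 * a + 1))
        (abs_blockProd_update_sub_le hv b t j (2 * a + 1)) (IH (2 * a)) (treeApprox_mem R hv _ _)
        (abs_mulApprox_error_sub_le R (treeApprox_mem R hv _ _) (treeApprox_mem R hv' _ _)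
          (treeApprox_mem R hv _ _))

/-! ### Networks with a common index type for all hidden layers -/

/-- The affine maps of a network all of whose hidden layers are indexed by `H`, without the
output layer. -/
structure HiddenNet (d : ℕ) (H : Type) where
  inWeight : H → Fin d → ℝ
  inBias : H → ℝ
  weight : ℕ → H → H → ℝ
  bias : ℕ → H → ℝ

namespace HiddenNet

variable {d : ℕ} {H : Type}

/-- The values of the hidden neurons. -/
def state [Fintype H] (N : HiddenNet d H) (x : Fin d → ℝ) : ℕ → H → ℝ
  | 0, h => max (∑ i, N.inWeight h i * x i + N.inBias h) 0
  | t + 1, h => max (∑ h', N.weight t h h' * N.state x t h' + N.bias t h) 0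

/-- The shape with `T + 1` hidden layers of width `n`. -/
def shape (d T n : ℕ) (hn : 0 < n) : NetShape d where
  depth := T + 2
  two_le_depth := by omega
  width ℓ := if ℓ = 0 then d else if ℓ < T + 2 then n else 1
  width_zero := by simp
  width_depth := by simp
  width_pos ℓ h0 h1 := by rw [if_neg (by omega), if_pos h1]; exact hn

/-- Extension by zero of a function on `H` to the natural numbers, along an enumeration. -/
def extend {n : ℕ} (e : H ≃ Fin n) (g : H → ℝ) (i : ℕ) : ℝ :=
  if h : i < n then g (e.symm ⟨i, h⟩) else 0

/-- The edge weights as functions of natural numbers. -/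
def rawWeight (N : HiddenNet d H) (T : ℕ) {n : ℕ} (e : H ≃ Fin n) (out : H → ℝ) (ℓ i j : ℕ) : ℝ :=
  if ℓ = 0 then (if h : j < d then extend e (fun g => N.inWeight g ⟨j, h⟩) i else 0)
  else if ℓ < T + 1 then extend e (fun g => extend e (fun g' => N.weight (ℓ - 1) g g') j) i
  else extend e out j

/-- The node weights as functions of natural numbers. -/
def rawBias (N : HiddenNet d H) (T : ℕ) {n : ℕ} (e : H ≃ Fin n) (ℓ i : ℕ) : ℝ :=
  if ℓ = 0 then extend e N.inBias i
  else if ℓ < T + 1 then extend e (fun g => N.bias (ℓ - 1) g) i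
  else 0

/-- The network with a given output layer. -/
def toNet (N : HiddenNet d H) (T : ℕ) {n : ℕ} (hn : 0 < n) (e : H ≃ Fin n) (out : H → ℝ) :
    NeuralNet (shape d T n hn) where
  weight ℓ i j := N.rawWeight T e out ℓ i j
  bias ℓ i := N.rawBias T e ℓ i

theorem sum_extend_mul [Fintype H] {n m : ℕ} (e : H ≃ Fin n) (hm : m = n) (f g : H → ℝ) :
    ∑ j : Fin m, extend e f j * extend e g j = ∑ h, f h * g h := by
  subst hm
  rw [← e.symm.sum_comp]
  exact Finset.sum_congr rfl fun j _ => by simp [extend]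

theorem layer_succ {S : NetShape d} (Φ : NeuralNet S) (x : Fin d → ℝ) (ℓ : ℕ) (h : ℓ + 1 ≤ S.depth)
    (i : Fin (S.width (ℓ + 1))) : Φ.layer x (ℓ + 1) h i =
      if ℓ + 1 = S.depth then
        ((Φ.weight ⟨ℓ, h⟩).mulVec (Φ.layer x ℓ (Nat.le_of_succ_le h)) + Φ.bias ⟨ℓ, h⟩) i
      else max (((Φ.weight ⟨ℓ, h⟩).mulVec (Φ.layer x ℓ (Nat.le_of_succ_le h)) +
        Φ.bias ⟨ℓ, h⟩) i) 0 := rfl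

theorem layer_toNet [Fintype H] (N : HiddenNet d H) (T : ℕ) {n : ℕ} (hn : 0 < n) (e : H ≃ Fin n)
    (out : H → ℝ) (x : Fin d → ℝ) (t : ℕ) (ht : t + 1 ≤ (shape d T n hn).depth) (hT : t ≤ T)
    (i : Fin ((shape d T n hn).width (t + 1))) :
    (N.toNet T hn e out).layer x (t + 1) ht i = extend e (N.state x t) i := by
  have hdep : (shape d T n hn).depth = T + 2 := rfl
  have hw : (shape d T n hn).width (t + 1) = n := by
    simp only [shape]; rw [if_neg (by omega), if_pos (by omega)]
  have hi : (i : ℕ) < n := i.2.trans_eq hw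
  induction t with
  | zero =>
    rw [layer_succ, if_neg (by omega)]
    simp only [Pi.add_apply, Matrix.mulVec, dotProduct, toNet, NeuralNet.layer, rawWeight, rawBias,
      if_true, extend, hi, dite_true, state]
    congr 2
    rw [← (finCongr ((shape d T n hn).width_zero)).sum_comp]
    refine Finset.sum_congr rfl fun j _ => ?_
    have hj : (j : ℕ) < d := by have := j.2; simpa [shape] using this
    simp only [hj, dite_true]
    rfl
  | succ t ih =>
    have hw' : (shape d T n hn).width (t + 1) = n := by
      simp only [shape]; rw [if_neg (by omega), if_pos (by omega)]
    rw [layer_succ, if_neg (by omega)]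
    have step : ∀ j, (N.toNet T hn e out).layer x (t + 1) (by omega) j =
        extend e (N.state x t) j := fun j =>
      ih (by omega) (by omega) j hw' (j.2.trans_eq hw')
    simp only [Pi.add_apply, Matrix.mulVec, dotProduct, step]
    simp only [toNet, rawWeight, rawBias, if_neg (Nat.succ_ne_zero t),
      if_pos (show t + 1 < T + 1 by omega), Nat.add_sub_cancel]
    have e1 : ∀ g : ℕ → H → ℝ, extend e (fun h => g t h) (i : ℕ) = g t (e.symm ⟨i, hi⟩) := by
      intro g; simp [extend, hi]
    rw [e1, show extend e (N.state x (t + 1)) i = N.state x (t + 1) (e.symm ⟨i, hi⟩) by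
      simp [extend, hi], state]
    congr 2
    rw [← sum_extend_mul e hw']
    refine Finset.sum_congr rfl fun j _ => ?_
    simp [extend, hi]

theorem output_toNet [Fintype H] (N : HiddenNet d H) (T : ℕ) {n : ℕ} (hn : 0 < n) (e : H ≃ Fin n)
    (out : H → ℝ) (x : Fin d → ℝ) :
    (N.toNet T hn e out).output x = ∑ h, out h * N.state x T h := by
  have hw' : (shape d T n hn).width (T + 1) = n := by
    simp only [shape]; rw [if_neg (by omega), if_pos (by omega)]
  have hd : T + 1 ≤ (shape d T n hn).depth := Nat.le_succ _
  have key : (N.toNet T hn e out).output x =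
      ∑ j : Fin ((shape d T n hn).width (T + 1)), N.rawWeight T e out (T + 1) 0 j *
        (N.toNet T hn e out).layer x (T + 1) hd j + N.rawBias T e (T + 1) 0 :=
    (layer_succ _ x (T + 1) le_rfl _).trans (if_pos rfl)
  rw [key, ← sum_extend_mul e hw']
  simp only [layer_toNet N T hn e out x T hd le_rfl, rawWeight, rawBias,
    if_neg (Nat.succ_ne_zero T), lt_irrefl, if_false, add_zero]

/-! ### Counting nonzero weights and fixing one architecture -/

open Classical in
/-- The number of nonzero weights of the hidden layers, plus the number of all possible weights of
the output layer. -/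
def cost [Fintype H] (N : HiddenNet d H) (T : ℕ) : ℕ :=
  ((Finset.univ.filter fun q : H × Fin d => N.inWeight q.1 q.2 ≠ 0).card +
      (Finset.univ.filter fun h => N.inBias h ≠ 0).card) +
    (∑ t ∈ Finset.range T, ((Finset.univ.filter fun q : H × H => N.weight t q.1 q.2 ≠ 0).card +
      (Finset.univ.filter fun h => N.bias t h ≠ 0).card)) + Fintype.card H

/-- The architecture of a network: all nonzero weights are replaced by `1`. -/
def pattern {S : NetShape d} (Φ : NeuralNet S) : NeuralNet S where
  weight ℓ i j := if Φ.weight ℓ i j = 0 then 0 else 1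
  bias ℓ i := if Φ.bias ℓ i = 0 then 0 else 1

theorem isArchitecture_pattern {S : NetShape d} (Φ : NeuralNet S) :
    (pattern Φ).IsArchitecture := by
  constructor
  · intro ℓ i j; simp only [pattern]; split_ifs <;> simp
  · intro ℓ i; simp only [pattern]; split_ifs <;> simp

theorem size_pattern {S : NetShape d} (Φ : NeuralNet S) : (pattern Φ).size = Φ.size := by
  simp only [NeuralNet.size, pattern]
  congr 1 <;> refine Finset.sum_congr rfl fun ℓ _ => ?_ <;> congr 1 <;> ext q <;> simp

/-- Bounding all finite sets of nonzero entries, instead of one filtered set, keeps `hc` free of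
decidability instances; `v` is left general to match the index types of the layers. -/
theorem card_extend₂_le {n a b : ℕ} (e : H ≃ Fin n) (ha : a = n) (hb : b = n) (w : H → H → ℝ)
    {c : ℕ} (hc : ∀ s : Finset (H × H), (∀ q ∈ s, w q.1 q.2 ≠ 0) → s.card ≤ c)
    {v : Fin a → Fin b → ℝ}
    (hv : ∀ i j, v i j = extend e (fun g => extend e (fun g' => w g g') (j : ℕ)) (i : ℕ)) :
    (Finset.univ.filter fun q : Fin a × Fin b => v q.1 q.2 ≠ 0).card ≤ c := by
  classical
  subst ha
  subst hb
  rw [← Finset.card_map (e.symm.prodCongr e.symm).toEmbedding]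
  apply hc
  intro q hq
  simp only [Finset.mem_map, Finset.mem_filter, Finset.mem_univ, true_and, hv] at hq
  obtain ⟨r, hr, rfl⟩ := hq
  simpa [extend] using hr

theorem card_extend_le {n a : ℕ} (e : H ≃ Fin n) (ha : a = n) (w : H → ℝ)
    {c : ℕ} (hc : ∀ s : Finset H, (∀ q ∈ s, w q ≠ 0) → s.card ≤ c) {v : Fin a → ℝ}
    (hv : ∀ i, v i = extend e w (i : ℕ)) :
    (Finset.univ.filter fun q : Fin a => v q ≠ 0).card ≤ c := by
  classical
  subst ha
  rw [← Finset.card_map e.symm.toEmbedding]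
  apply hc
  intro q hq
  simp only [Finset.mem_map, Finset.mem_filter, Finset.mem_univ, true_and, hv] at hq
  obtain ⟨r, hr, rfl⟩ := hq
  simpa [extend] using hr

theorem card_extend_in_le {n a b : ℕ} (e : H ≃ Fin n) (ha : a = n) (hb : b = d)
    (w : H → Fin d → ℝ)
    {c : ℕ} (hc : ∀ s : Finset (H × Fin d), (∀ q ∈ s, w q.1 q.2 ≠ 0) → s.card ≤ c)
    {v : Fin a → Fin b → ℝ}
    (hv : ∀ i j, v i j =
      if h : (j : ℕ) < d then extend e (fun g => w g ⟨j, h⟩) (i : ℕ) else 0) :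
    (Finset.univ.filter fun q : Fin a × Fin b => v q.1 q.2 ≠ 0).card ≤ c := by
  classical
  subst ha
  subst hb
  rw [← Finset.card_map (e.symm.prodCongr (Equiv.refl _)).toEmbedding]
  apply hc
  intro q hq
  simp only [Finset.mem_map, Finset.mem_filter, Finset.mem_univ, true_and, hv] at hq
  obtain ⟨r, hr, rfl⟩ := hq
  simpa [extend] using hr

theorem size_toNet_le [Fintype H] (N : HiddenNet d H) (T : ℕ) {n : ℕ} (hn : 0 < n) (e : H ≃ Fin n)
    (out : H → ℝ) : (N.toNet T hn e out).size ≤ N.cost T := by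
  classical
  have hw0 : (shape d T n hn).width 0 = d := (shape d T n hn).width_zero
  have hw : ∀ ℓ, 0 < ℓ → ℓ < T + 2 → (shape d T n hn).width ℓ = n := by
    intro ℓ h0 h1
    simp only [shape]; rw [if_neg (by omega), if_pos h1]
  have hwT : (shape d T n hn).width (T + 2) = 1 := (shape d T n hn).width_depth
  have hnH : Fintype.card H = n := by simpa using Fintype.card_congr e
  have card_le : ∀ {β : Type} [Fintype β] (P : β → Prop) [DecidablePred P] (s : Finset β),
      (∀ q ∈ s, P q) → s.card ≤ (Finset.univ.filter P).card := by
    intro β _ P _ s hs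
    exact Finset.card_le_card fun q hq => by simpa using hs q hq
  unfold NeuralNet.size
  have s1 : (∑ ℓ : Fin (shape d T n hn).depth, (Finset.univ.filter
      fun q : Fin ((shape d T n hn).width (ℓ + 1)) × Fin ((shape d T n hn).width ℓ) =>
        (N.toNet T hn e out).weight ℓ q.1 q.2 ≠ 0).card) ≤
      (Finset.univ.filter fun q : H × Fin d => N.inWeight q.1 q.2 ≠ 0).card +
      (∑ t ∈ Finset.range T, (Finset.univ.filter fun q : H × H => N.weight t q.1 q.2 ≠ 0).card) +
      Fintype.card H := by
    change (∑ ℓ : Fin (T + 2), _) ≤ _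
    rw [Fin.sum_univ_succ, Fin.sum_univ_castSucc, ← add_assoc]
    refine add_le_add (add_le_add ?_ ?_) ?_
    · exact card_extend_in_le e (hw 1 (by omega) (by omega)) hw0 N.inWeight
        (fun s hs => card_le (fun q : H × Fin d => N.inWeight q.1 q.2 ≠ 0) s hs) fun i j => rfl
    · rw [Finset.sum_range]
      refine Finset.sum_le_sum fun t _ => ?_
      refine card_extend₂_le e (hw (t + 1 + 1) (by omega) (by omega))
        (hw (t + 1) (by omega) (by omega)) (N.weight t)
        (fun s hs => card_le (fun q : H × H => N.weight t q.1 q.2 ≠ 0) s hs) fun i j => ?_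
      simp only [toNet, rawWeight, Fin.val_succ, Fin.val_castSucc, Nat.succ_ne_zero, if_false,
        if_pos (show (t : ℕ) + 1 < T + 1 by omega), Nat.add_sub_cancel]
    -- The output layer is counted as if all its weights were nonzero.
    · refine (Finset.card_le_univ _).trans ?_
      rw [Fintype.card_prod, Fintype.card_fin, Fintype.card_fin, hnH]
      have a1 : (shape d T n hn).width (((Fin.last T).succ : Fin (T + 2)) + 1) = 1 := by
        simpa using hwT
      have a2 : (shape d T n hn).width ((Fin.last T).succ : Fin (T + 2)) = n := by
        simpa using hw (T + 1) (by omega) (by omega)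
      exact (by rw [a1, a2, one_mul])
  have s2 : (∑ ℓ : Fin (shape d T n hn).depth, (Finset.univ.filter
      fun i : Fin ((shape d T n hn).width (ℓ + 1)) =>
        (N.toNet T hn e out).bias ℓ i ≠ 0).card) ≤
      (Finset.univ.filter fun h => N.inBias h ≠ 0).card +
      (∑ t ∈ Finset.range T, (Finset.univ.filter fun h => N.bias t h ≠ 0).card) := by
    change (∑ ℓ : Fin (T + 2), _) ≤ _
    rw [Fin.sum_univ_succ, Fin.sum_univ_castSucc, ← add_assoc]
    conv_rhs => rw [← add_zero (_ + _)]
    refine add_le_add (add_le_add ?_ ?_) ?_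
    · exact card_extend_le e (hw 1 (by omega) (by omega)) N.inBias
        (fun s hs => card_le (fun q : H => N.inBias q ≠ 0) s hs) fun i => rfl
    · rw [Finset.sum_range]
      refine Finset.sum_le_sum fun t _ => ?_
      refine card_extend_le e (hw (t + 1 + 1) (by omega) (by omega)) (N.bias t)
        (fun s hs => card_le (fun q : H => N.bias t q ≠ 0) s hs) fun i => ?_
      simp only [toNet, rawBias, Fin.val_succ, Fin.val_castSucc, Nat.succ_ne_zero, if_false,
        if_pos (show (t : ℕ) + 1 < T + 1 by omega), Nat.add_sub_cancel]
    · simp [toNet, rawBias]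
  refine (add_le_add s1 s2).trans (le_of_eq ?_)
  rw [cost, Finset.sum_add_distrib]
  ring

/-- One architecture realizes all output layers. -/
theorem exists_architecture [Fintype H] [Nonempty H] (N : HiddenNet d H) (T : ℕ) :
    ∃ (S : NetShape d) (A : NeuralNet S), A.IsArchitecture ∧ A.depth = T + 2 ∧ A.size ≤ N.cost T ∧
      ∀ out : H → ℝ, ∃ Φ : NeuralNet S, Φ.HasArchitecture A ∧
        ∀ x, Φ.output x = ∑ h, out h * N.state x T h := by
  have e := Fintype.equivFin H
  have hn : 0 < Fintype.card H := Fintype.card_pos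
  -- Output weights 1 leave every edge to the output open, and the hidden weights do not depend on
  -- `out`; so this pattern serves all `out`.
  refine ⟨shape d T _ hn, pattern (N.toNet T hn e fun _ => 1), isArchitecture_pattern _, rfl,
    (size_pattern _).trans_le (size_toNet_le N T hn e _),
    fun out => ⟨N.toNet T hn e out, ⟨?_, ?_⟩, output_toNet N T hn e out⟩⟩
  · intro ℓ i j h
    simp only [pattern, ite_eq_left_iff, one_ne_zero, imp_false, not_not] at h
    simp only [toNet, rawWeight] at h ⊢
    split_ifs at h ⊢ with h1 h2 h3
    · exact h
    · rfl
    · exact h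
    · simp only [extend] at h ⊢
      split_ifs at h ⊢ with h4
      · simp at h
      · rfl
  · intro ℓ i h
    simp only [pattern, ite_eq_left_iff, one_ne_zero, imp_false, not_not] at h
    exact h

end HiddenNet

/-! ### The network of approximate tensor products of hat functions -/

/-- The hat function with support `[0, 2]` and peak `1` at `1`. -/
def hat (t : ℝ) : ℝ := max t 0 - 2 * max (t - 1) 0 + max (t - 2) 0

/-- The values of the `d` univariate hats of level `k` and position `s`, padded by ones. -/
def hatVec {d : ℕ} (k s : Fin d → ℕ) (x : Fin d → ℝ) (b : ℕ) : ℝ :=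
  if h : b < d then hat (2 ^ (k ⟨b, h⟩ + 1) * x ⟨b, h⟩ - 2 * s ⟨b, h⟩) else 1

theorem hat_of_le_zero {t : ℝ} (h : t ≤ 0) : hat t = 0 := by
  rw [hat, max_eq_right h, max_eq_right (by linarith), max_eq_right (by linarith)]; ring

theorem hat_of_ge_two {t : ℝ} (h : 2 ≤ t) : hat t = 0 := by
  rw [hat, max_eq_left (by linarith), max_eq_left (by linarith), max_eq_left (by linarith)]; ring

theorem hat_of_mem_left {t : ℝ} (h0 : 0 ≤ t) (h1 : t ≤ 1) : hat t = t := by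
  rw [hat, max_eq_left h0, max_eq_right (by linarith), max_eq_right (by linarith)]; ring

theorem hat_of_mem_right {t : ℝ} (h0 : 1 ≤ t) (h1 : t ≤ 2) : hat t = 2 - t := by
  rw [hat, max_eq_left (by linarith), max_eq_left (by linarith), max_eq_right (by linarith)]; ring

theorem hat_mem (t : ℝ) : hat t ∈ Icc (0 : ℝ) 1 := by
  rcases le_total t 0 with h | h
  · rw [hat_of_le_zero h]; exact ⟨le_rfl, zero_le_one⟩
  rcases le_total t 1 with h1 | h1
  · rw [hat_of_mem_left h h1]; exact ⟨h, h1⟩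
  rcases le_total t 2 with h2 | h2
  · rw [hat_of_mem_right h1 h2]; constructor <;> linarith
  · rw [hat_of_ge_two h2]; exact ⟨le_rfl, zero_le_one⟩

theorem hatVec_mem {d : ℕ} (k s : Fin d → ℕ) (x : Fin d → ℝ) (b : ℕ) :
    hatVec k s x b ∈ Icc (0 : ℝ) 1 := by
  rw [hatVec]
  split_ifs
  · exact hat_mem _
  · exact ⟨zero_le_one, le_rfl⟩

/-- The neurons that belong to one product: `2 ^ J` positions, at each of them three approximate
squares, for each of them two neurons for the iterated tent map and an accumulator. -/
abbrev Gate (J : ℕ) : Type := Fin (2 ^ J) × Fin 3 × Fin 3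

/-- The linear functional that recovers the value carried by a position. -/
def readout (t : ℕ) (c : Fin 3 × Fin 3) : ℝ :=
  if c.2 = 2 then (if t = 0 then ![1, -2, 1] c.1 else ![2, -2, -2] c.1) else 0

/-- The weights of a step of the square approximation. -/
def iterWeight (τ : ℕ) : Matrix (Fin 3) (Fin 3) ℝ :=
  !![2, -4, 0; 2, -4, 0; -2 / 4 ^ τ, 4 / 4 ^ τ, 1]

/-- The weights between the neurons of one product. -/
def gateWeight (J R t : ℕ) (g g' : Gate J) : ℝ :=
  if t % (R + 1) = 0 then
    ((if (g'.1 : ℕ) = 2 * g.1 then ![1 / 2, 1 / 2, 0] g.2.1 else 0) +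
      (if (g'.1 : ℕ) = 2 * g.1 + 1 then ![1 / 2, 0, 1 / 2] g.2.1 else 0)) * readout t g'.2
  else if g'.1 = g.1 ∧ g'.2.1 = g.2.1 then iterWeight (t % (R + 1)) g.2.2 g'.2.2 else 0

/-- The bias of the neurons of one product. -/
def gateBias {J : ℕ} (g : Gate J) : ℝ := if g.2.2 = 1 then -(1 / 2) else 0

open Classical in
/-- The network that computes approximate tensor products of hats in parallel. -/
def productNet {d : ℕ} {K : Type} (J R : ℕ) (k s : K → Fin d → ℕ) : HiddenNet d (K × Gate J) where
  inWeight h i := if h.2.2.2 = 2 ∧ (h.2.1 : ℕ) = i then 2 ^ (k h.1 i + 1) else 0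
  inBias h := if h.2.2.2 = 2 then
      (if hd : (h.2.1 : ℕ) < d then -(2 * s h.1 ⟨h.2.1, hd⟩) - (h.2.2.1 : ℕ)
        else if h.2.2.1 = 0 then 1 else 0)
    else 0
  weight t h h' := if h.1 = h'.1 then gateWeight J R t h.2 h'.2 else 0
  bias _ h := gateBias h.2

/-! ### The values computed by the product network -/

section State

variable {d : ℕ} {K : Type} [Fintype K] (J R : ℕ) (k s : K → Fin d → ℕ) (x : Fin d → ℝ)

theorem state_productNet_succ (t : ℕ) (κ : K) (g : Gate J) :
    (productNet J R k s).state x (t + 1) (κ, g) =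
      max (∑ g', gateWeight J R t g g' * (productNet J R k s).state x t (κ, g') + gateBias g) 0 := by
  classical
  rw [HiddenNet.state, Fintype.sum_prod_type]
  congr 2
  rw [Finset.sum_eq_single κ]
  · simp [productNet]
  · intro κ' _ h
    simp [productNet, h.symm]
  · simp

/-- In layer 0 only the accumulators are active. They hold `max t 0`, `max (t - 1) 0` and `max (t -
2) 0`, which the readout `1, -2, 1` combines to a hat. Positions from `d` on carry the constant 1.
-/
theorem readout_state_zero (κ : K) (a : Fin (2 ^ J)) :
    ∑ c, readout 0 c * (productNet J R k s).state x 0 (κ, a, c) = hatVec (k κ) (s κ) x a := by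
  classical
  have h : ∀ c : Fin 3, (productNet J R k s).state x 0 (κ, a, c, 2) =
      max (if hd : (a : ℕ) < d then 2 ^ (k κ ⟨a, hd⟩ + 1) * x ⟨a, hd⟩ - 2 * s κ ⟨a, hd⟩ - (c : ℕ)
        else if c = 0 then 1 else 0) 0 := by
    intro c
    rw [HiddenNet.state]
    congr 1
    simp only [productNet, true_and, if_true]
    by_cases hd : (a : ℕ) < d
    · rw [Finset.sum_eq_single ⟨a, hd⟩]
      · simp [hd]; ring
      · intro i _ hi
        rw [if_neg, zero_mul]
        intro h; apply hi; ext; exact h.symm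
      · simp
    · rw [Finset.sum_eq_zero]
      · simp [hd]
      · intro i _
        rw [if_neg, zero_mul]
        omega
  rw [Fintype.sum_prod_type]
  simp only [Fin.sum_univ_three, readout]
  simp only [show ((0 : Fin 3) = 2) = False by simp, show ((1 : Fin 3) = 2) = False by simp,
    if_false, if_true, h, hatVec]
  by_cases hd : (a : ℕ) < d
  · simp [hd, hat]; ring
  · simp [hd]

/-- The readout of one stage is merged into the first layer of the next, so it costs no layer. The
three squares receive `(y + z) / 2`, `y / 2` and `z / 2`, as polarization requires. -/
theorem state_step_init (t : ℕ) (ht : t % (R + 1) = 0) (κ : K) (a : Fin (2 ^ J))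
    (h0 : 2 * (a : ℕ) + 1 < 2 ^ J) (q r : Fin 3) {y z : ℝ}
    (hy : ∑ c, readout t c * (productNet J R k s).state x t (κ, ⟨2 * a, by omega⟩, c) = y)
    (hz : ∑ c, readout t c * (productNet J R k s).state x t (κ, ⟨2 * a + 1, h0⟩, c) = z) :
    (productNet J R k s).state x (t + 1) (κ, a, q, r) =
      max (![1 / 2, 1 / 2, 0] q * y + ![1 / 2, 0, 1 / 2] q * z +
        if r = 1 then -(1 / 2) else 0) 0 := by
  rw [state_productNet_succ]
  simp only [gateWeight, if_pos ht, gateBias]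
  congr 2
  rw [Fintype.sum_prod_type]
  have e : ∀ a' : Fin (2 ^ J), ∑ c : Fin 3 × Fin 3,
      ((if (a' : ℕ) = 2 * a then ![1 / 2, 1 / 2, 0] q else 0) +
        (if (a' : ℕ) = 2 * a + 1 then (![1 / 2, 0, 1 / 2] q : ℝ) else 0)) * readout t c *
          (productNet J R k s).state x t (κ, a', c) =
      (if a' = ⟨2 * a, by omega⟩ then ![1 / 2, 1 / 2, 0] q * y else 0) +
      (if a' = ⟨2 * a + 1, h0⟩ then ![1 / 2, 0, 1 / 2] q * z else 0) := by
    intro a'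
    simp only [mul_assoc, ← Finset.mul_sum, add_mul, Finset.sum_add_distrib, Fin.ext_iff]
    split_ifs with h1 h2 h2
    · omega
    · have e : a' = ⟨2 * a, by omega⟩ := Fin.ext h1
      rw [e, hy]; simp
    · have e : a' = ⟨2 * a + 1, h0⟩ := Fin.ext h2
      rw [e, hz]; simp
    · simp
  simp only [e, Finset.sum_add_distrib, Finset.sum_ite_eq', Finset.mem_univ, if_true]

theorem state_step_iter (t : ℕ) (ht : t % (R + 1) ≠ 0) (κ : K) (a : Fin (2 ^ J)) (q r : Fin 3) :
    (productNet J R k s).state x (t + 1) (κ, a, q, r) =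
      max (∑ r', iterWeight (t % (R + 1)) r r' * (productNet J R k s).state x t (κ, a, q, r') +
        if r = 1 then -(1 / 2) else 0) 0 := by
  rw [state_productNet_succ]
  simp only [gateWeight, if_neg ht, gateBias]
  congr 2
  rw [Fintype.sum_prod_type, Finset.sum_eq_single a]
  · rw [Fintype.sum_prod_type, Finset.sum_eq_single q]
    · simp
    · intro q' _ h; simp [h]
    · simp
  · intro a' _ h; simp [h]
  · simp

/-- The values of the three neurons of an approximate square. -/
theorem state_stage (j : ℕ) (κ : K) (a : Fin (2 ^ J)) (q : Fin 3) {u : ℝ} (hu : u ∈ Icc (0 : ℝ) 1)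
    (hinit : ∀ r : Fin 3, (productNet J R k s).state x (j * (R + 1) + 1) (κ, a, q, r) =
      max (u + if r = 1 then -(1 / 2) else 0) 0) (τ : ℕ) (hτ : τ ≤ R) :
    (productNet J R k s).state x (j * (R + 1) + τ + 1) (κ, a, q, 0) = tent^[τ] u ∧
    (productNet J R k s).state x (j * (R + 1) + τ + 1) (κ, a, q, 1) = max (tent^[τ] u - 1 / 2) 0 ∧
    (productNet J R k s).state x (j * (R + 1) + τ + 1) (κ, a, q, 2) = sqApprox τ u := by
  induction τ with
  | zero =>
    simp only [add_zero, hinit, Function.iterate_zero, id, sqApprox]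
    refine ⟨?_, ?_, ?_⟩
    · simpa using hu.1
    · simp [sub_eq_add_neg]
    · simpa using hu.1
  | succ τ ih =>
    obtain ⟨h0, h1, h2⟩ := ih (by omega)
    have hmod : (j * (R + 1) + τ + 1) % (R + 1) = τ + 1 := by
      rw [add_assoc, add_comm, Nat.add_mul_mod_self_right, Nat.mod_eq_of_lt (by omega)]
    have hstep := fun r => state_step_iter J R k s x (j * (R + 1) + τ + 1) (by omega) κ a q r
    -- The new tent value and the new accumulator are nonnegative, so the ReLU passes them on
    -- unchanged.
    have ht := tent_iterate_mem hu (τ + 1)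
    have hs := sqApprox_nonneg (τ + 1) hu
    rw [sqApprox] at hs
    rw [Function.iterate_succ_apply'] at ht hs
    rw [← add_assoc]
    simp only [hstep, hmod, Fin.sum_univ_three, h0, h1, h2, Function.iterate_succ_apply', sqApprox]
    generalize tent^[τ] u = w at *
    have e1 : tent w = 2 * w + -4 * max (w - 1 / 2) 0 := by rw [tent]; ring
    refine ⟨?_, ?_, ?_⟩
    · simp [iterWeight]
      rw [e1] at ht
      simpa [e1] using ht.1
    · simp [iterWeight, e1, sub_eq_add_neg]
    · have e2 : iterWeight (τ + 1) 2 0 * w + iterWeight (τ + 1) 2 1 * max (w - 1 / 2) 0 +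
          iterWeight (τ + 1) 2 2 * sqApprox τ u = sqApprox τ u - tent w / 4 ^ (τ + 1) := by
        simp [iterWeight, e1]; ring
      rw [e2]
      simpa using hs

/-- A stage takes `R + 1` layers and halves the number of positions in use; what the positions from
`2 ^ (J - j)` on carry does not influence the root. -/
theorem readout_state (j : ℕ) (hj : j ≤ J) (κ : K) (a : Fin (2 ^ J)) (ha : (a : ℕ) < 2 ^ (J - j)) :
    ∑ c, readout (j * (R + 1)) c * (productNet J R k s).state x (j * (R + 1)) (κ, a, c) =
      treeApprox R (hatVec (k κ) (s κ) x) j a := by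
  induction j generalizing a with
  | zero => simpa [treeApprox] using readout_state_zero J R k s x κ a
  | succ j ih =>
    have hp : 2 ^ (J - j) = 2 * 2 ^ (J - (j + 1)) := by
      rw [← pow_succ']; congr 1; omega
    have hle : 2 ^ (J - j) ≤ 2 ^ J := Nat.pow_le_pow_right (by norm_num) (by omega)
    have hy := ih (by omega) ⟨2 * a, by omega⟩ (by simp only; omega)
    have hz := ih (by omega) ⟨2 * a + 1, by omega⟩ (by simp only; omega)
    have y01 := treeApprox_mem R (hatVec_mem (k κ) (s κ) x) j (2 * a)
    have z01 := treeApprox_mem R (hatVec_mem (k κ) (s κ) x) j (2 * a + 1)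
    have hs := fun q r => state_step_init J R k s x (j * (R + 1)) (by simp) κ a (by omega) q r hy hz
    rw [treeApprox]
    simp only at hs
    generalize treeApprox R (hatVec (k κ) (s κ) x) j (2 * a) = y at *
    generalize treeApprox R (hatVec (k κ) (s κ) x) j (2 * a + 1) = z at *
    have hu : ∀ q : Fin 3, (![1 / 2, 1 / 2, 0] q * y + ![1 / 2, 0, 1 / 2] q * z : ℝ) ∈
        Icc (0 : ℝ) 1 := by
      obtain ⟨y0, y1⟩ := y01
      obtain ⟨z0, z1⟩ := z01
      intro q
      fin_cases q <;> simp <;> constructor <;> linarith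
    have hq := fun q => (state_stage J R k s x j κ a q (hu q) (hs q) R le_rfl).2.2
    have et : (j + 1) * (R + 1) = j * (R + 1) + R + 1 := by ring
    rw [Fintype.sum_prod_type]
    simp only [Fin.sum_univ_three, readout]
    simp only [show ((0 : Fin 3) = 2) = False by simp, show ((1 : Fin 3) = 2) = False by simp,
      if_false, if_true, zero_mul, zero_add, et, hq, if_neg (Nat.succ_ne_zero _)]
    have v0 : ∀ p q r : ℝ, ![p, q, r] 0 = p := fun _ _ _ => rfl
    have v1 : ∀ p q r : ℝ, ![p, q, r] 1 = q := fun _ _ _ => rfl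
    have v2 : ∀ p q r : ℝ, ![p, q, r] 2 = r := fun _ _ _ => rfl
    simp only [v0, v1, v2, zero_mul, add_zero, zero_add]
    rw [mulApprox, show (1 / 2 * y + 1 / 2 * z : ℝ) = (y + z) / 2 by ring,
      show (1 / 2 * y : ℝ) = y / 2 by ring, show (1 / 2 * z : ℝ) = z / 2 by ring]
    ring

end State

/-! ### The size of the product network -/

theorem card_filter_pair_le {α β : Type} [Fintype α] [Fintype β] (P : α → β → Prop)
    [DecidablePred fun q : α × β => P q.1 q.2] (n : ℕ)
    (h : ∀ a, ∀ s : Finset β, (∀ b ∈ s, P a b) → s.card ≤ n) :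
    (Finset.univ.filter fun q : α × β => P q.1 q.2).card ≤ Fintype.card α * n := by
  classical
  have e : (Finset.univ.filter fun q : α × β => P q.1 q.2) =
      Finset.univ.biUnion fun a : α => (Finset.univ.filter fun b => P a b).image (Prod.mk a) := by
    ext ⟨a, b⟩; simp
  rw [e]
  refine Finset.card_biUnion_le.trans ?_
  refine (Finset.sum_le_card_nsmul _ _ n fun a _ => ?_).trans (by simp)
  exact Finset.card_image_le.trans (h a _ fun b hb => by simpa using hb)

/-- In each later layer a neuron has at most 18 incoming weights, from nine neurons at each of two
child positions, and one bias. The 3 stands for one input weight, one input bias and one output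
weight. -/
theorem cost_productNet_le {d : ℕ} {K : Type} [Fintype K] (J R T : ℕ) (k s : K → Fin d → ℕ) :
    (productNet J R k s).cost T ≤ Fintype.card K * (2 ^ J * 9) * (3 + 19 * T) := by
  classical
  have hH : Fintype.card (K × Gate J) = Fintype.card K * (2 ^ J * 9) := by
    simp [Fintype.card_prod]
  have b1 : ∀ P : K × Gate J → Prop, ∀ [DecidablePred P],
      (Finset.univ.filter P).card ≤ Fintype.card (K × Gate J) := fun P _ =>
    Finset.card_le_univ _
  have b2 : (Finset.univ.filter fun q : (K × Gate J) × Fin d =>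
      (productNet J R k s).inWeight q.1 q.2 ≠ 0).card ≤ Fintype.card (K × Gate J) * 1 := by
    refine card_filter_pair_le (fun h i => (productNet J R k s).inWeight h i ≠ 0) 1 fun h s hs => ?_
    rw [Finset.card_le_one]
    intro i hi j hj
    have hi' := hs i hi
    have hj' := hs j hj
    simp only [productNet, ne_eq, ite_eq_right_iff, Classical.not_imp] at hi' hj'
    ext
    omega
  have b3 : ∀ t, (Finset.univ.filter fun q : (K × Gate J) × (K × Gate J) =>
      (productNet J R k s).weight t q.1 q.2 ≠ 0).card ≤ Fintype.card (K × Gate J) * 18 := by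
    intro t
    refine card_filter_pair_le (fun h h' => (productNet J R k s).weight t h h' ≠ 0) 18
      fun h s hs => ?_
    have c18 : (Finset.univ : Finset (Bool × Fin 3 × Fin 3)).card = 18 := by simp
    rw [← c18]
    -- The Boolean separates the two children in a merging step; in the other steps the position is
    -- determined anyway.
    refine Finset.card_le_card_of_injOn
      (fun h' => (decide ((h'.2.1 : ℕ) = 2 * h.2.1), h'.2.2)) (fun _ _ => by simp) ?_
    intro p hp q hq hpq
    have hp' := hs p hp
    have hq' := hs q hq
    obtain ⟨κ, a, c⟩ := p
    obtain ⟨κ', a', c'⟩ := q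
    simp only [Prod.mk.injEq, decide_eq_decide] at hpq
    simp only [productNet, ne_eq, ite_eq_right_iff, Classical.not_imp, gateWeight] at hp' hq'
    obtain ⟨h1, h2⟩ := hp'
    obtain ⟨h3, h4⟩ := hq'
    have : a = a' := by
      split_ifs at h2 h4 <;> first | (simp at h2; done) | (simp at h4; done) |
        (ext; omega)
    rw [← h1, ← h3, this, hpq.2]
  rw [HiddenNet.cost]
  have b4 : ∑ t ∈ Finset.range T, ((Finset.univ.filter fun q : (K × Gate J) × (K × Gate J) =>
      (productNet J R k s).weight t q.1 q.2 ≠ 0).card + (Finset.univ.filter fun h =>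
        (productNet J R k s).bias t h ≠ 0).card) ≤ T * (Fintype.card (K × Gate J) * 19) := by
    refine (Finset.sum_le_card_nsmul _ _ (Fintype.card (K × Gate J) * 19) fun t _ => ?_).trans
      (by simp)
    have := b3 t
    have := b1 fun h => (productNet J R k s).bias t h ≠ 0
    omega
  have b5 := b1 fun h => (productNet J R k s).inBias h ≠ 0
  rw [← hH]
  calc _ ≤ (Fintype.card (K × Gate J) * 1 + Fintype.card (K × Gate J)) +
        T * (Fintype.card (K × Gate J) * 19) + Fintype.card (K × Gate J) := by gcongr
    _ = _ := by ring

/-- One architecture realizes all linear combinations of approximate tensor products of hats. -/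
theorem exists_architecture_hats {d : ℕ} {K : Type} [Fintype K] (J R : ℕ) (k s : K → Fin d → ℕ) :
    ∃ (S : NetShape d) (A : NeuralNet S), A.IsArchitecture ∧ A.depth = J * (R + 1) + 2 ∧
      A.size ≤ Fintype.card K * (2 ^ J * 9) * (3 + 19 * (J * (R + 1))) ∧
      ∀ c : K → ℝ, ∃ Φ : NeuralNet S, Φ.HasArchitecture A ∧
        ∀ x, Φ.output x = ∑ κ, c κ * treeApprox R (hatVec (k κ) (s κ) x) J 0 := by
  classical
  rcases isEmpty_or_nonempty K with hK | hK
  -- Without hats there are no neurons; the zero network on some shape of the right depth serves.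
  · obtain ⟨S, A, h1, h2, -, h4⟩ := (⟨fun _ _ => 0, fun _ => 0, fun _ _ _ => 0, fun _ _ => 0⟩ :
      HiddenNet d Unit).exists_architecture (J * (R + 1))
    refine ⟨S, ⟨fun _ _ _ => 0, fun _ _ => 0⟩, ⟨fun _ _ _ => Or.inl rfl, fun _ _ => Or.inl rfl⟩,
      h2, by simp [NeuralNet.size], fun c => ⟨⟨fun _ _ _ => 0, fun _ _ => 0⟩,
        ⟨fun _ _ _ _ => rfl, fun _ _ _ => rfl⟩, fun x => ?_⟩⟩
    have : ∀ (Ψ : NeuralNet S) (_ : ∀ ℓ i j, Ψ.weight ℓ i j = 0) (_ : ∀ ℓ i, Ψ.bias ℓ i = 0)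
        (ℓ : ℕ) (h : ℓ + 1 ≤ S.depth) (i), Ψ.layer x (ℓ + 1) h i = 0 := by
      intro Ψ hw hb ℓ h i
      rw [HiddenNet.layer_succ]
      simp [Matrix.mulVec, dotProduct, hw, hb]
    obtain ⟨L, hL⟩ : ∃ L, S.depth = L + 1 := ⟨S.depth - 1, by have := S.two_le_depth; omega⟩
    rw [NeuralNet.output]
    simp only [Finset.univ_eq_empty, Finset.sum_empty]
    have key : ∀ (Ψ : NeuralNet S) (_ : ∀ ℓ i j, Ψ.weight ℓ i j = 0) (_ : ∀ ℓ i, Ψ.bias ℓ i = 0)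
        (m : ℕ) (h : m ≤ S.depth) (_ : m = L + 1) (i), Ψ.layer x m h i = 0 := by
      intro Ψ hw hb m h hm i
      subst hm
      exact this Ψ hw hb L h i
    exact key _ (fun _ _ _ => rfl) (fun _ _ => rfl) _ _ hL _
  · obtain ⟨S, A, h1, h2, h3, h4⟩ := (productNet J R k s).exists_architecture (J * (R + 1))
    refine ⟨S, A, h1, h2, h3.trans (cost_productNet_le J R _ k s), fun c => ?_⟩
    -- The readout at the root is folded into the output weights, the only place where `c` enters.
    obtain ⟨Φ, hΦ, hout⟩ := h4 fun h => if (h.2.1 : ℕ) = 0 then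
      c h.1 * readout (J * (R + 1)) h.2.2 else 0
    refine ⟨Φ, hΦ, fun x => ?_⟩
    rw [hout, Fintype.sum_prod_type]
    refine Finset.sum_congr rfl fun κ _ => ?_
    have h0 : 0 < 2 ^ J := by positivity
    rw [Fintype.sum_prod_type, Finset.sum_eq_single ⟨0, h0⟩]
    · have := readout_state J R k s x J le_rfl κ ⟨0, h0⟩ (by simp)
      simp only [if_true, mul_assoc]
      rw [← Finset.mul_sum, this]
    · intro a _ ha
      have : (a : ℕ) ≠ 0 := fun h => ha (Fin.ext h)
      simp [this]
    · simp

/-! ### Geometric sums over multi-indices -/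

theorem sum_prod_pow_le {d : ℕ} {r : ℝ} (h0 : 0 ≤ r) (h1 : r < 1) (S : Finset (Fin d → ℕ)) :
    ∑ k ∈ S, ∏ i, r ^ k i ≤ ((1 - r)⁻¹) ^ d := by
  classical
  set n := S.sup (fun k => Finset.univ.sup k) + 1
  have hS : S ⊆ Fintype.piFinset fun _ : Fin d => Finset.range n := by
    intro k hk
    rw [Fintype.mem_piFinset]
    intro i
    have a1 : k i ≤ Finset.univ.sup k := Finset.le_sup (Finset.mem_univ i)
    have a2 : Finset.univ.sup k ≤ S.sup (fun k => Finset.univ.sup k) :=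
      Finset.le_sup (f := fun k : Fin d → ℕ => Finset.univ.sup k) hk
    rw [Finset.mem_range]; omega
  calc ∑ k ∈ S, ∏ i, r ^ k i ≤ ∑ k ∈ Fintype.piFinset fun _ : Fin d => Finset.range n,
        ∏ i, r ^ k i :=
        Finset.sum_le_sum_of_subset_of_nonneg hS fun _ _ _ =>
          Finset.prod_nonneg fun _ _ => pow_nonneg h0 _
    _ = ∏ _i : Fin d, ∑ j ∈ Finset.range n, r ^ j := (Finset.prod_univ_sum _ _).symm
    _ ≤ ∏ _i : Fin d, (1 - r)⁻¹ := by
        refine Finset.prod_le_prod (fun _ _ => Finset.sum_nonneg fun _ _ => pow_nonneg h0 _)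
          fun _ _ => ?_
        rw [← tsum_geometric_of_lt_one h0 h1]
        exact (summable_geometric_of_lt_one h0 h1).sum_le_tsum _ fun _ _ => pow_nonneg h0 _
    _ = _ := by simp

theorem summable_prod_pow {d : ℕ} {r : ℝ} (h0 : 0 ≤ r) (h1 : r < 1) :
    Summable fun k : Fin d → ℕ => ∏ i, r ^ k i :=
  summable_of_sum_le (fun _ => Finset.prod_nonneg fun _ _ => pow_nonneg h0 _)
    (sum_prod_pow_le h0 h1)

/-! ### Mixed second differences as finite sums -/

/-- The coefficient of the point evaluation at `y` in a univariate second difference. -/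
def diffWeight (x h y : ℝ) : ℝ :=
  (if y = x + 2 * h then 1 else 0) - 2 * (if y = x + h then 1 else 0) + if y = x then 1 else 0

theorem mixedDiff_empty {d : ℕ} (h : Fin d → ℝ) : mixedDiff ∅ h = 1 :=
  Finset.noncommProd_empty _ _

theorem mixedDiff_insert {d : ℕ} {u : Finset (Fin d)} {a : Fin d} (ha : a ∉ u) (h : Fin d → ℝ) :
    mixedDiff (insert a u) h = secondDiff a (h a) * mixedDiff u h :=
  Finset.noncommProd_insert_of_notMem _ _ _ _ ha

/-- The coefficients on a product grid factorize over the variables, which reduces multivariate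
identities to univariate ones. Any grid `Y` that contains the nodes is allowed, so that all levels
can share one. -/
theorem mixedDiff_eq_sum {d : ℕ} (u : Finset (Fin d)) (h : Fin d → ℝ) (f : (Fin d → ℝ) → ℝ)
    (x : Fin d → ℝ) (Y : Fin d → Finset ℝ) (hY : ∀ i, x i ∈ Y i)
    (hYu : ∀ i ∈ u, x i + h i ∈ Y i ∧ x i + 2 * h i ∈ Y i) :
    mixedDiff u h f x = ∑ y ∈ Fintype.piFinset Y,
      (∏ i, if i ∈ u then diffWeight (x i) (h i) (y i) else if y i = x i then 1 else 0) * f y := by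
  classical
  induction u using Finset.induction_on generalizing x with
  | empty =>
    rw [Finset.sum_eq_single x]
    · simp [mixedDiff_empty]
    · intro y _ hy
      obtain ⟨i, hi⟩ := Function.ne_iff.1 hy
      rw [Finset.prod_eq_zero (Finset.mem_univ i) (by simp [hi]), zero_mul]
    · intro hx
      exact absurd (Fintype.mem_piFinset.2 hY) hx
  | insert a u ha ih =>
    have hstep : mixedDiff (insert a u) h f x =
        mixedDiff u h f (Function.update x a (x a + 2 * h a)) -
          2 * mixedDiff u h f (Function.update x a (x a + h a)) + mixedDiff u h f x := by
      rw [mixedDiff_insert ha]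
      rfl
    have shift : ∀ t, x a + t ∈ Y a → mixedDiff u h f (Function.update x a (x a + t)) =
        ∑ y ∈ Fintype.piFinset Y, ((if y a = x a + t then 1 else 0) *
          ∏ i ∈ Finset.univ.erase a, if i ∈ u then diffWeight (x i) (h i) (y i) else
            if y i = x i then 1 else 0) * f y := by
      intro t ht
      rw [ih]
      · refine Finset.sum_congr rfl fun y _ => ?_
        rw [← Finset.mul_prod_erase _ _ (Finset.mem_univ a), if_neg ha, Function.update_self]
        congr 2
        refine Finset.prod_congr rfl fun i hi => ?_
        rw [Function.update_of_ne (Finset.ne_of_mem_erase hi)]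
      · intro i
        rcases eq_or_ne i a with rfl | hia
        · rwa [Function.update_self]
        · rw [Function.update_of_ne hia]; exact hY i
      · intro i hi
        have hia : i ≠ a := fun e => ha (e ▸ hi)
        rw [Function.update_of_ne hia]
        exact hYu i (Finset.mem_insert_of_mem hi)
    have hm := hYu a (Finset.mem_insert_self a u)
    have h0 := shift 0 (by simpa using hY a)
    rw [add_zero, Function.update_eq_self] at h0
    rw [hstep, shift _ hm.1, shift _ hm.2, h0, Finset.mul_sum, ← Finset.sum_sub_distrib,
      ← Finset.sum_add_distrib]
    refine Finset.sum_congr rfl fun y _ => ?_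
    rw [← Finset.mul_prod_erase Finset.univ
      (fun i => if i ∈ insert a u then _ else _) (Finset.mem_univ a),
      if_pos (Finset.mem_insert_self a u)]
    have e : ∏ i ∈ Finset.univ.erase a, (if i ∈ insert a u then diffWeight (x i) (h i) (y i) else
        if y i = x i then 1 else 0) = ∏ i ∈ Finset.univ.erase a,
        (if i ∈ u then diffWeight (x i) (h i) (y i) else if y i = x i then 1 else 0) := by
      refine Finset.prod_congr rfl fun i hi => ?_
      simp [Finset.mem_insert, Finset.ne_of_mem_erase hi]
    rw [e, diffWeight]
    ring

/-! ### Dyadic interpolation -/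

/-- The coefficient of the point evaluation at `y` in the piecewise linear interpolation on the
dyadic grid of level `n`, evaluated at `x`. -/
def interpWeight (n : ℕ) (x y : ℝ) : ℝ :=
  (1 - Int.fract (2 ^ n * x)) * (if y = ⌊2 ^ n * x⌋ / 2 ^ n then 1 else 0) +
    Int.fract (2 ^ n * x) * if y = (⌊2 ^ n * x⌋ + 1) / 2 ^ n then 1 else 0

/-- Halving the mesh corrects the interpolant on the cell of `x` by the deviation at the midpoint,
`-1/2` times a second difference, times the hat of that cell. This is the univariate Faber
expansion. -/
theorem interpWeight_succ_sub (n : ℕ) (x y : ℝ) :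
    interpWeight (n + 1) x y - interpWeight n x y =
      -1 / 2 * hat (2 * Int.fract (2 ^ n * x)) *
        diffWeight (⌊2 ^ n * x⌋ / 2 ^ n) (2 ^ (n + 1))⁻¹ y := by
  have h2 : (2 : ℝ) ^ (n + 1) * x = 2 * (2 ^ n * x) := by ring
  have e1 : (⌊2 ^ n * x⌋ : ℝ) / 2 ^ n + 2 * (2 ^ (n + 1))⁻¹ = (⌊2 ^ n * x⌋ + 1) / 2 ^ n := by
    rw [pow_succ]; field_simp
  have e2 : (⌊2 ^ n * x⌋ : ℝ) / 2 ^ n + (2 ^ (n + 1))⁻¹ = (2 * ⌊2 ^ n * x⌋ + 1) / 2 ^ (n + 1) := by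
    rw [pow_succ]; field_simp
  rw [interpWeight, interpWeight, diffWeight, e1, e2, h2]
  set t := (2 : ℝ) ^ n * x with ht
  have hf0 := Int.fract_nonneg t
  have hf1 := Int.fract_lt_one t
  have hft : t = ⌊t⌋ + Int.fract t := (Int.floor_add_fract t).symm
  rcases lt_or_ge (Int.fract t) (1 / 2) with h | h
  · have f1 : ⌊2 * t⌋ = 2 * ⌊t⌋ := by
      rw [Int.floor_eq_iff]; push_cast; constructor <;> linarith
    have f2 : Int.fract (2 * t) = 2 * Int.fract t := by
      rw [Int.fract, f1]; push_cast; rw [Int.fract]; ring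
    rw [f1, f2, hat_of_mem_left (by linarith) (by linarith)]
    have e3 : ((2 * ⌊t⌋ : ℤ) : ℝ) / 2 ^ (n + 1) = ⌊t⌋ / 2 ^ n := by
      rw [pow_succ]; push_cast; field_simp
    rw [e3]
    push_cast
    ring
  · have f1 : ⌊2 * t⌋ = 2 * ⌊t⌋ + 1 := by
      rw [Int.floor_eq_iff]; push_cast; constructor <;> linarith
    have f2 : Int.fract (2 * t) = 2 * Int.fract t - 1 := by
      rw [Int.fract, f1]; push_cast; rw [Int.fract]; ring
    rw [f1, f2, hat_of_mem_right (by linarith) (by linarith)]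
    have e3 : (((2 * ⌊t⌋ + 1 : ℤ) : ℝ) + 1) / 2 ^ (n + 1) = (⌊t⌋ + 1) / 2 ^ n := by
      rw [pow_succ]; push_cast; field_simp; ring
    rw [e3]
    push_cast
    ring

theorem interpWeight_nonneg (n : ℕ) (x y : ℝ) : 0 ≤ interpWeight n x y := by
  have hf0 := Int.fract_nonneg (2 ^ n * x)
  have hf1 := Int.fract_lt_one (2 ^ n * x)
  rw [interpWeight]
  have : 0 ≤ 1 - Int.fract (2 ^ n * x) := by linarith
  positivity

theorem abs_sub_le_of_interpWeight_ne_zero {n : ℕ} {x y : ℝ} (h : interpWeight n x y ≠ 0) :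
    |y - x| ≤ (1 / 2) ^ n := by
  have hf0 := Int.fract_nonneg (2 ^ n * x)
  have hf1 := Int.fract_lt_one (2 ^ n * x)
  have hft := Int.floor_add_fract (2 ^ n * x)
  have hp : (0 : ℝ) < 2 ^ n := by positivity
  have key : |2 ^ n * y - 2 ^ n * x| ≤ 1 := by
    rw [interpWeight] at h
    by_cases h1 : y = ⌊2 ^ n * x⌋ / 2 ^ n
    · have : 2 ^ n * y = ⌊2 ^ n * x⌋ := by rw [h1]; field_simp
      rw [this, abs_le]; constructor <;> linarith
    · by_cases h2 : y = (⌊2 ^ n * x⌋ + 1) / 2 ^ n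
      · have : 2 ^ n * y = ⌊2 ^ n * x⌋ + 1 := by rw [h2]; field_simp
        rw [this, abs_le]; constructor <;> linarith
      · simp [h1, h2] at h
  rw [← mul_sub, abs_mul, abs_of_pos hp] at key
  rw [one_div_pow, le_div_iff₀ hp]
  linarith

/-- The dyadic points of level `n` in the unit interval. -/
def dyadicGrid (n : ℕ) : Finset ℝ := (Finset.range (2 ^ n + 1)).image fun j : ℕ => (j : ℝ) / 2 ^ n

theorem div_mem_dyadicGrid {k n : ℕ} (hk : k ≤ n) {j : ℤ} (h0 : 0 ≤ j) (hj : j ≤ 2 ^ k) :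
    (j : ℝ) / 2 ^ k ∈ dyadicGrid n := by
  obtain ⟨m, rfl⟩ := Int.eq_ofNat_of_zero_le h0
  have hj' : m ≤ 2 ^ k := by exact_mod_cast hj
  rw [dyadicGrid, Finset.mem_image]
  refine ⟨m * 2 ^ (n - k), ?_, ?_⟩
  · rw [Finset.mem_range, Nat.lt_succ_iff]
    calc m * 2 ^ (n - k) ≤ 2 ^ k * 2 ^ (n - k) := by gcongr
      _ = 2 ^ n := by rw [← pow_add]; congr 1; omega
  · have : (2 : ℝ) ^ n = 2 ^ k * 2 ^ (n - k) := by rw [← pow_add]; congr 1; omega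
    rw [this]; push_cast; field_simp

theorem mem_Icc_of_mem_dyadicGrid {n : ℕ} {y : ℝ} (h : y ∈ dyadicGrid n) : y ∈ Icc (0 : ℝ) 1 := by
  rw [dyadicGrid, Finset.mem_image] at h
  obtain ⟨j, hj, rfl⟩ := h
  rw [Finset.mem_range, Nat.lt_succ_iff] at hj
  refine ⟨by positivity, ?_⟩
  rw [div_le_one (by positivity)]
  exact_mod_cast hj

theorem floor_bounds {k : ℕ} {x : ℝ} (h0 : 0 < x) (h1 : x < 1) :
    0 ≤ ⌊2 ^ k * x⌋ ∧ ⌊2 ^ k * x⌋ + 1 ≤ 2 ^ k := by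
  refine ⟨Int.floor_nonneg.2 (by positivity), ?_⟩
  have : ⌊2 ^ k * x⌋ < 2 ^ k := by
    rw [Int.floor_lt]
    push_cast
    exact mul_lt_of_lt_one_right (by positivity) h1
  omega

theorem sum_interpWeight (n : ℕ) {x : ℝ} (h0 : 0 < x) (h1 : x < 1) :
    ∑ y ∈ dyadicGrid n, interpWeight n x y = 1 := by
  obtain ⟨a, b⟩ := floor_bounds (k := n) h0 h1
  have m1 : (⌊2 ^ n * x⌋ : ℝ) / 2 ^ n ∈ dyadicGrid n := div_mem_dyadicGrid le_rfl a (by omega)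
  have m2 : (⌊2 ^ n * x⌋ + 1 : ℝ) / 2 ^ n ∈ dyadicGrid n := by
    exact_mod_cast div_mem_dyadicGrid (n := n) le_rfl (j := ⌊2 ^ n * x⌋ + 1) (by omega) b
  simp only [interpWeight, Finset.sum_add_distrib, ← Finset.mul_sum, Finset.sum_ite_eq', m1, m2,
    if_true]
  ring

/-! ### The Faber series -/

/-- The tensor product hat function of level `k` and position `s`. -/
def tensorHat {d : ℕ} (k s : Fin d → ℕ) (x : Fin d → ℝ) : ℝ :=
  ∏ i, hat (2 ^ (k i + 1) * x i - 2 * s i)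

/-- The coefficients of the Faber series. -/
def faberCoeff {d : ℕ} (f : (Fin d → ℝ) → ℝ) (k s : Fin d → ℕ) : ℝ :=
  (-1 / 2) ^ d * mixedDiff Finset.univ (fun i => (2 ^ (k i + 1))⁻¹) f fun i => s i / 2 ^ k i

/-- The positions of the hats of level `k`. -/
def positions {d : ℕ} (k : Fin d → ℕ) : Finset (Fin d → ℕ) :=
  Fintype.piFinset fun i => Finset.range (2 ^ k i)

/-- The part of level `k` of the Faber series. -/
def faberLevel {d : ℕ} (f : (Fin d → ℝ) → ℝ) (k : Fin d → ℕ) (x : Fin d → ℝ) : ℝ :=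
  ∑ s ∈ positions k, faberCoeff f k s * tensorHat k s x

/-- Each hat lives on one dyadic cell, so at every point at most one position of each level is
active. -/
theorem hat_eq_zero_of_ne_floor {k s : ℕ} {x : ℝ} (h : s ≠ ⌊2 ^ k * x⌋₊) :
    hat (2 ^ (k + 1) * x - 2 * s) = 0 := by
  have e : (2 : ℝ) ^ (k + 1) * x - 2 * s = 2 * (2 ^ k * x - s) := by ring
  rw [e]
  rcases lt_or_ge (2 ^ k * x) s with h1 | h1
  · exact hat_of_le_zero (by linarith)
  · apply hat_of_ge_two
    have h2 : s ≤ ⌊2 ^ k * x⌋₊ := Nat.le_floor h1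
    have h3 : s + 1 ≤ ⌊2 ^ k * x⌋₊ := by omega
    have hx : 0 ≤ 2 ^ k * x := (Nat.cast_nonneg s).trans h1
    have h4 := (Nat.cast_le (α := ℝ)).2 h3
    have h5 := Nat.floor_le hx
    push_cast at h4
    linarith

theorem tensorHat_eq_zero {d : ℕ} {k s : Fin d → ℕ} {x : Fin d → ℝ}
    (h : s ≠ fun i => ⌊2 ^ k i * x i⌋₊) : tensorHat k s x = 0 := by
  obtain ⟨i, hi⟩ := Function.ne_iff.1 h
  exact Finset.prod_eq_zero (Finset.mem_univ i) (hat_eq_zero_of_ne_floor hi)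

theorem faberLevel_eq {d : ℕ} (f : (Fin d → ℝ) → ℝ) (k : Fin d → ℕ) {x : Fin d → ℝ}
    (hx : x ∈ openCube d) : faberLevel f k x =
      faberCoeff f k (fun i => ⌊2 ^ k i * x i⌋₊) * tensorHat k (fun i => ⌊2 ^ k i * x i⌋₊) x := by
  rw [faberLevel, Finset.sum_eq_single fun i => ⌊2 ^ k i * x i⌋₊]
  · intro s _ hs
    rw [tensorHat_eq_zero hs, mul_zero]
  · intro h
    refine absurd ?_ h
    rw [positions, Fintype.mem_piFinset]
    intro i
    rw [Finset.mem_range, Nat.floor_lt (by have := (hx i).1; positivity)]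
    push_cast
    exact mul_lt_of_lt_one_right (by positivity) (hx i).2

/-- Level `k` is the tensor product of the univariate interpolation increments from `k i` to `k i +
1`, here written on the common grid of level `n`. -/
theorem faberLevel_eq_sum {d : ℕ} (f : (Fin d → ℝ) → ℝ) (k : Fin d → ℕ) {x : Fin d → ℝ}
    (hx : x ∈ openCube d) (n : ℕ) (hk : ∀ i, k i < n) :
    faberLevel f k x = ∑ y ∈ Fintype.piFinset fun _ : Fin d => dyadicGrid n,
      (∏ i, (interpWeight (k i + 1) (x i) (y i) - interpWeight (k i) (x i) (y i))) * f y := by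
  have hfl : ∀ i, ((⌊2 ^ k i * x i⌋₊ : ℕ) : ℝ) = (⌊2 ^ k i * x i⌋ : ℝ) := by
    intro i
    have : 0 ≤ 2 ^ k i * x i := by have := (hx i).1; positivity
    exact natCast_floor_eq_intCast_floor this
  rw [faberLevel_eq f k hx, faberCoeff, mixedDiff_eq_sum Finset.univ _ f _ (fun _ => dyadicGrid n),
    Finset.mul_sum, Finset.sum_mul]
  · refine Finset.sum_congr rfl fun y _ => ?_
    simp only [interpWeight_succ_sub, Finset.prod_mul_distrib, Finset.mem_univ, if_true, hfl,
      tensorHat, Finset.prod_const, Finset.card_univ, Fintype.card_fin]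
    have e : ∀ i, (2 : ℝ) ^ (k i + 1) * x i - 2 * (⌊2 ^ k i * x i⌋ : ℝ) =
        2 * Int.fract (2 ^ k i * x i) := by
      intro i; rw [Int.fract]; ring
    simp only [e]
    ring
  · intro i
    obtain ⟨a, b⟩ := floor_bounds (k := k i) (hx i).1 (hx i).2
    rw [hfl]
    exact div_mem_dyadicGrid (hk i).le a (by omega)
  · intro i _
    obtain ⟨a, b⟩ := floor_bounds (k := k i) (hx i).1 (hx i).2
    rw [hfl]
    constructor
    · have e2 : (⌊2 ^ k i * x i⌋ : ℝ) / 2 ^ k i + (2 ^ (k i + 1))⁻¹ =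
          ((2 * ⌊2 ^ k i * x i⌋ + 1 : ℤ) : ℝ) / 2 ^ (k i + 1) := by
        rw [pow_succ]; push_cast; field_simp
      rw [e2]
      exact div_mem_dyadicGrid (hk i) (by omega) (by rw [pow_succ]; omega)
    · have e1 : (⌊2 ^ k i * x i⌋ : ℝ) / 2 ^ k i + 2 * (2 ^ (k i + 1))⁻¹ =
          ((⌊2 ^ k i * x i⌋ + 1 : ℤ) : ℝ) / 2 ^ k i := by
        rw [pow_succ]; push_cast; field_simp
      rw [e1]
      exact div_mem_dyadicGrid (hk i).le (by omega) b

/-- The increments telescope in every variable. The interpolant of level 0 uses only end points,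
where `f` vanishes, so subtracting it changes nothing. -/
theorem sum_faberLevel_eq {d : ℕ} {f : (Fin d → ℝ) → ℝ}
    (hf : ∀ x ∈ unitCube d, (∃ j, x j = 0 ∨ x j = 1) → f x = 0) {x : Fin d → ℝ}
    (hx : x ∈ openCube d) (n : ℕ) :
    ∑ k ∈ Fintype.piFinset fun _ : Fin d => Finset.range n, faberLevel f k x =
      ∑ y ∈ Fintype.piFinset fun _ : Fin d => dyadicGrid n,
        (∏ i, interpWeight n (x i) (y i)) * f y := by
  rw [Finset.sum_congr rfl fun k hk => faberLevel_eq_sum f k hx n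
    fun i => Finset.mem_range.1 (Fintype.mem_piFinset.1 hk i), Finset.sum_comm]
  refine Finset.sum_congr rfl fun y hy => ?_
  have hy' := fun i => mem_Icc_of_mem_dyadicGrid (Fintype.mem_piFinset.1 hy i)
  rw [← Finset.sum_mul, ← Finset.prod_univ_sum (fun _ => Finset.range n)
    fun i j => interpWeight (j + 1) (x i) (y i) - interpWeight j (x i) (y i)]
  by_cases hb : ∃ j, y j = 0 ∨ y j = 1
  · rw [hf y ⟨fun i => (hy' i).1, fun i => (hy' i).2⟩ hb, mul_zero, mul_zero]
  · push Not at hb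
    congr 1
    refine Finset.prod_congr rfl fun i _ => ?_
    rw [Finset.sum_range_sub fun j => interpWeight j (x i) (y i)]
    have h0 : ⌊x i⌋ = 0 := by
      rw [Int.floor_eq_zero_iff]; exact ⟨(hx i).1.le, (hx i).2⟩
    simp [interpWeight, h0, (hb i).1, (hb i).2]

/-- The weights form a probability distribution on grid points within `2 ^ (-n)` of `x`, so
continuity at `x` suffices. -/
theorem tendsto_sum_interpWeight {d : ℕ} {f : (Fin d → ℝ) → ℝ} {x : Fin d → ℝ}
    (hx : x ∈ openCube d) (hf : ContinuousAt f x) :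
    Filter.Tendsto (fun n => ∑ y ∈ Fintype.piFinset fun _ : Fin d => dyadicGrid n,
      (∏ i, interpWeight n (x i) (y i)) * f y) Filter.atTop (nhds (f x)) := by
  rw [Metric.tendsto_atTop]
  intro ε hε
  obtain ⟨δ, hδ, hfδ⟩ := Metric.continuousAt_iff.1 hf (ε / 2) (by positivity)
  obtain ⟨N, hN⟩ := exists_pow_lt_of_lt_one hδ (by norm_num : (1 / 2 : ℝ) < 1)
  refine ⟨N, fun n hn => ?_⟩
  have hnN : (1 / 2 : ℝ) ^ n < δ :=
    (pow_le_pow_of_le_one (by norm_num) (by norm_num) hn).trans_lt hN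
  have h1 : ∑ y ∈ Fintype.piFinset fun _ : Fin d => dyadicGrid n,
      ∏ i, interpWeight n (x i) (y i) = 1 := by
    rw [← Finset.prod_univ_sum (fun _ => dyadicGrid n) fun i y => interpWeight n (x i) y]
    exact Finset.prod_eq_one fun i _ => sum_interpWeight n (hx i).1 (hx i).2
  have e : (∑ y ∈ Fintype.piFinset fun _ : Fin d => dyadicGrid n,
      (∏ i, interpWeight n (x i) (y i)) * f y) - f x =
      ∑ y ∈ Fintype.piFinset fun _ : Fin d => dyadicGrid n,
        (∏ i, interpWeight n (x i) (y i)) * (f y - f x) := by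
    simp only [mul_sub, Finset.sum_sub_distrib, ← Finset.sum_mul, h1, one_mul]
  rw [Real.dist_eq, e]
  calc _ ≤ ∑ y ∈ Fintype.piFinset fun _ : Fin d => dyadicGrid n,
        |(∏ i, interpWeight n (x i) (y i)) * (f y - f x)| := Finset.abs_sum_le_sum_abs _ _
    _ ≤ ∑ y ∈ Fintype.piFinset fun _ : Fin d => dyadicGrid n,
        (∏ i, interpWeight n (x i) (y i)) * (ε / 2) := by
        refine Finset.sum_le_sum fun y _ => ?_
        have hnn : 0 ≤ ∏ i, interpWeight n (x i) (y i) :=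
          Finset.prod_nonneg fun i _ => interpWeight_nonneg _ _ _
        rw [abs_mul, abs_of_nonneg hnn]
        by_cases hz : ∏ i, interpWeight n (x i) (y i) = 0
        · rw [hz]; simp
        · refine mul_le_mul_of_nonneg_left ?_ hnn
          have : dist y x < δ := by
            refine lt_of_le_of_lt ?_ hnN
            rw [dist_pi_le_iff (by positivity)]
            intro i
            rw [Real.dist_eq]
            exact abs_sub_le_of_interpWeight_ne_zero
              (Finset.prod_ne_zero_iff.1 hz i (Finset.mem_univ i))
          have := hfδ this
          rw [Real.dist_eq] at this
          exact this.le
    _ = ε / 2 := by rw [← Finset.sum_mul, h1, one_mul]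
    _ < ε := by linarith

/-- Only the term `u = univ` of the norm is used, with steps `2 ^ (-(k i + 1))`. The `1 / 2` per
variable in the coefficient turns `α` into `α + 1` in the factor that is free of `k`. -/
theorem abs_faberCoeff_le {d : ℕ} {α : ℝ} {f : (Fin d → ℝ) → ℝ} (hf : holderNorm α f ≤ 1)
    {k s : Fin d → ℕ} (hs : s ∈ positions k) :
    |faberCoeff f k s| ≤ ((2 : ℝ) ^ (-(α + 1))) ^ d * ∏ i, ((2 : ℝ) ^ (-α)) ^ k i := by
  set h : Fin d → ℝ := fun i => (2 ^ (k i + 1))⁻¹ with hh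
  set x : Fin d → ℝ := fun i => s i / 2 ^ k i with hx
  have hpos : ∀ i, 0 < h i := fun i => by simp only [hh]; positivity
  have hs' : ∀ i, (s i : ℝ) + 1 ≤ 2 ^ k i := by
    intro i
    have := Finset.mem_range.1 (Fintype.mem_piFinset.1 hs i)
    exact_mod_cast this
  have hxd : x ∈ diffDomain Finset.univ h := by
    have hx0 : ∀ i, 0 ≤ x i := fun i => by simp only [hx]; positivity
    have hx1 : ∀ i, x i + 2 * h i ≤ 1 := by
      intro i
      have : x i + 2 * h i = (s i + 1) / 2 ^ k i := by
        simp only [hx, hh, pow_succ]; field_simp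
      rw [this, div_le_one (by positivity)]
      exact hs' i
    refine ⟨⟨hx0, fun i => ?_⟩, fun i _ => ⟨?_, hx1 i⟩⟩
    · have := hx1 i; have := hpos i; simp only [Pi.one_apply]; linarith
    · have := hx0 i; have := hpos i; linarith
  have hle : ENNReal.ofReal ((∏ i, h i ^ (-α)) * |mixedDiff Finset.univ h f x|) ≤ 1 := by
    refine le_trans ?_ hf
    rw [holderNorm]
    refine le_iSup_of_le Finset.univ (le_iSup_of_le h (le_iSup_of_le (fun i _ => hpos i)
      (le_iSup_of_le x (le_iSup_of_le hxd le_rfl))))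
  rw [← ENNReal.ofReal_one, ENNReal.ofReal_le_ofReal_iff zero_le_one] at hle
  have hprod : 0 < ∏ i, h i ^ (-α) := Finset.prod_pos fun i _ => Real.rpow_pos_of_pos (hpos i) _
  have hm : |mixedDiff Finset.univ h f x| ≤ (∏ i, h i ^ (-α))⁻¹ := by
    rw [← one_div, le_div_iff₀ hprod, mul_comm]; exact hle
  have hinv : (∏ i, h i ^ (-α))⁻¹ = ∏ i, ((2 : ℝ) ^ (-α)) ^ (k i + 1) := by
    rw [← Finset.prod_inv_distrib]
    refine Finset.prod_congr rfl fun i _ => ?_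
    rw [← Real.rpow_neg (hpos i).le, neg_neg, hh]
    simp only
    rw [Real.inv_rpow (by positivity), ← Real.rpow_natCast 2, ← Real.rpow_mul (by norm_num),
      ← Real.rpow_neg (by norm_num), ← Real.rpow_natCast, ← Real.rpow_mul (by norm_num)]
    congr 1; ring
  have h2 : (2 : ℝ) ^ (-(α + 1)) = 2 ^ (-α) * (1 / 2) := by
    rw [show -(α + 1) = -α + -1 by ring, Real.rpow_add (by norm_num), Real.rpow_neg_one]; norm_num
  rw [faberCoeff, abs_mul, abs_pow]
  calc |(-1 / 2 : ℝ)| ^ d * |mixedDiff Finset.univ h f x|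
      ≤ (1 / 2) ^ d * ∏ i, ((2 : ℝ) ^ (-α)) ^ (k i + 1) := by
        rw [← hinv]
        have : |(-1 / 2 : ℝ)| = 1 / 2 := by norm_num
        rw [this]
        gcongr
    _ = _ := by
        simp only [pow_succ, Finset.prod_mul_distrib, Finset.prod_const, Finset.card_univ,
          Fintype.card_fin, h2, mul_pow]
        ring

theorem abs_tensorHat_le_one {d : ℕ} (k s : Fin d → ℕ) (x : Fin d → ℝ) : |tensorHat k s x| ≤ 1 := by
  rw [tensorHat, abs_of_nonneg (Finset.prod_nonneg fun i _ => (hat_mem _).1)]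
  exact Finset.prod_le_one (fun i _ => (hat_mem _).1) fun i _ => (hat_mem _).2

/-- Absolute summability gives some sum, and the partial sums over boxes identify it with `f x`.
Unconditional convergence matters because the sparse set is not a box. -/
theorem hasSum_faberLevel {d : ℕ} {α : ℝ} (hα : 0 < α) {f : (Fin d → ℝ) → ℝ}
    (hf : f ∈ holderBall d α) {x : Fin d → ℝ} (hx : x ∈ openCube d) :
    HasSum (fun k => faberLevel f k x) (f x) := by
  obtain ⟨hc, hb, hn⟩ := hf
  have hopen : ContinuousAt f x := by
    refine hc.continuousAt ?_
    have : openCube d = Set.pi Set.univ fun _ => Ioo (0 : ℝ) 1 := by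
      ext y; simp [openCube, Set.mem_pi]
    refine Filter.mem_of_superset (IsOpen.mem_nhds ?_ hx) fun y hy =>
      ⟨fun i => (hy i).1.le, fun i => (hy i).2.le⟩
    rw [this]
    exact isOpen_set_pi Set.finite_univ fun _ _ => isOpen_Ioo
  have hsum : Summable fun k => faberLevel f k x := by
    have hr : (2 : ℝ) ^ (-α) < 1 := Real.rpow_lt_one_of_one_lt_of_neg (by norm_num) (by linarith)
    refine Summable.of_norm_bounded (g := fun k : Fin d → ℕ => ((2 : ℝ) ^ (-(α + 1))) ^ d *
      ∏ i, ((2 : ℝ) ^ (-α)) ^ k i) ((summable_prod_pow (by positivity) hr).mul_left _) fun k => ?_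
    rw [faberLevel_eq f k hx, Real.norm_eq_abs, abs_mul]
    refine (mul_le_of_le_one_right (abs_nonneg _) (abs_tensorHat_le_one _ _ _)).trans
      (abs_faberCoeff_le hn ?_)
    rw [positions, Fintype.mem_piFinset]
    intro i
    rw [Finset.mem_range, Nat.floor_lt (by have := (hx i).1; positivity)]
    push_cast
    exact mul_lt_of_lt_one_right (by positivity) (hx i).2
  have hbox : Filter.Tendsto (fun n => Fintype.piFinset fun _ : Fin d => Finset.range n)
      Filter.atTop Filter.atTop := by
    refine Filter.tendsto_atTop_finset_of_monotone ?_ ?_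
    · intro m n hmn
      exact Fintype.piFinset_subset _ _ fun _ => Finset.range_mono hmn
    · intro k
      refine ⟨Finset.univ.sup k + 1, Fintype.mem_piFinset.2 fun i => ?_⟩
      have : k i ≤ Finset.univ.sup k := Finset.le_sup (Finset.mem_univ i)
      rw [Finset.mem_range]; omega
  have h1 := hsum.hasSum.comp hbox
  have h2 := tendsto_sum_interpWeight hx hopen
  have e : (fun n => ∑ k ∈ Fintype.piFinset fun _ : Fin d => Finset.range n, faberLevel f k x) =
      fun n => ∑ y ∈ Fintype.piFinset fun _ : Fin d => dyadicGrid n,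
        (∏ i, interpWeight n (x i) (y i)) * f y := funext fun n => sum_faberLevel_eq hb hx n
  have h3 := tendsto_nhds_unique h1 (by rw [← e] at h2; exact h2)
  rw [← h3]
  exact hsum.hasSum

/-! ### Series of Lipschitz functions in the Sobolev space -/

theorem openCube_eq_pi (d : ℕ) : openCube d = Set.pi Set.univ fun _ => Ioo (0 : ℝ) 1 := by
  ext y; simp [openCube, Set.mem_pi]

theorem isOpen_openCube (d : ℕ) : IsOpen (openCube d) := by
  rw [openCube_eq_pi]
  exact isOpen_set_pi Set.finite_univ fun _ _ => isOpen_Ioo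

theorem restrict_unitCube (d : ℕ) :
    (volume.restrict (unitCube d) : Measure (Fin d → ℝ)) = volume.restrict (openCube d) := by
  rw [openCube_eq_pi, unitCube]
  exact (Measure.restrict_congr_set (Measure.univ_pi_Ioo_ae_eq_Icc (f := 0) (g := 1))).symm

theorem volume_unitCube (d : ℕ) : volume (unitCube d) = 1 := by
  rw [unitCube, Real.volume_Icc_pi]; simp

/-- Total mass 1 turns a sup bound into the same `L_p` bound for every `p`. -/
instance isProbabilityMeasure_unitCube (d : ℕ) :
    IsProbabilityMeasure (volume.restrict (unitCube d)) :=
  ⟨by rw [Measure.restrict_apply_univ, volume_unitCube]⟩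

theorem isFiniteMeasure_openCube (d : ℕ) : IsFiniteMeasure (volume.restrict (openCube d)) := by
  rw [← restrict_unitCube]; infer_instance

/-- A function that is Lipschitz in every variable is Lipschitz. -/
theorem lipschitzWith_of_coordinatewise {d : ℕ} {c : (Fin d → ℝ) → ℝ} {C : Fin d → ℝ}
    (h0 : ∀ i, 0 ≤ C i)
    (hL : ∀ i x t, |c (Function.update x i t) - c x| ≤ C i * |t - x i|) :
    LipschitzWith (∑ i, C i).toNNReal c := by
  classical
  have key : ∀ (x y : Fin d → ℝ) (u : Finset (Fin d)),
      |c (u.piecewise x y) - c y| ≤ ∑ i ∈ u, C i * |x i - y i| := by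
    intro x y u
    induction u using Finset.induction_on with
    | empty => simp
    | insert a u ha ih =>
      rw [Finset.piecewise_insert, Finset.sum_insert ha]
      have h := hL a (u.piecewise x y) (x a)
      rw [Finset.piecewise_eq_of_notMem _ _ _ ha] at h
      calc _ = |(c (Function.update (u.piecewise x y) a (x a)) - c (u.piecewise x y)) +
            (c (u.piecewise x y) - c y)| := by congr 1; ring
        _ ≤ _ := (abs_add_le _ _).trans (add_le_add h ih)
  refine LipschitzWith.of_dist_le_mul fun x y => ?_
  rw [Real.coe_toNNReal _ (Finset.sum_nonneg fun i _ => h0 i), Real.dist_eq, Finset.sum_mul]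
  have := key x y Finset.univ
  rw [Finset.piecewise_univ] at this
  refine this.trans (Finset.sum_le_sum fun i _ => mul_le_mul_of_nonneg_left ?_ (h0 i))
  rw [← Real.dist_eq]
  exact dist_le_pi_dist x y i

theorem add_smul_single {d : ℕ} (x : Fin d → ℝ) (i : Fin d) (t : ℝ) :
    x + t • (Pi.single i 1 : Fin d → ℝ) = Function.update x i (x i + t) := by
  ext j
  rcases eq_or_ne j i with rfl | h
  · simp
  · simp [h]

theorem abs_lineDeriv_single_le {d : ℕ} {c : (Fin d → ℝ) → ℝ} {i : Fin d} {x : Fin d → ℝ} {C : ℝ}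
    (hC : 0 ≤ C) (hL : ∀ t, |c (Function.update x i t) - c x| ≤ C * |t - x i|) :
    |lineDeriv ℝ c x (Pi.single i 1)| ≤ C := by
  rw [← Real.norm_eq_abs, lineDeriv]
  refine norm_deriv_le_of_lip' hC (Filter.Eventually.of_forall fun t => ?_)
  simp only [add_smul_single, zero_smul, add_zero, sub_zero]
  simpa using hL (x i + t)

/-- From such a point `c` is zero along a half-line or a whole line in direction `i`. This forces
the derivative to vanish if it exists; otherwise `deriv` is 0 by convention. -/
theorem lineDeriv_eq_zero_of_notMem {d : ℕ} {c : (Fin d → ℝ) → ℝ}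
    (hz : ∀ x, x ∉ openCube d → c x = 0) {x : Fin d → ℝ} (hx : x ∉ openCube d) (i : Fin d) :
    lineDeriv ℝ c x (Pi.single i 1) = 0 := by
  rw [lineDeriv]
  have aux : ∀ S : Set ℝ, UniqueDiffWithinAt ℝ S 0 → (0 : ℝ) ∈ S →
      (∀ t ∈ S, c (x + t • (Pi.single i 1 : Fin d → ℝ)) = 0) →
      deriv (fun t : ℝ => c (x + t • (Pi.single i 1 : Fin d → ℝ))) 0 = 0 := by
    intro S hS h0 hc
    by_cases hd : DifferentiableAt ℝ (fun t : ℝ => c (x + t • (Pi.single i 1 : Fin d → ℝ))) 0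
    · rw [← hd.derivWithin hS, derivWithin_congr (f := fun _ => (0 : ℝ)) hc (hc 0 h0)]
      simp
    · exact deriv_zero_of_not_differentiableAt hd
  rcases le_or_gt (x i) 0 with h | h
  · refine aux (Iic 0) (uniqueDiffOn_Iic 0 0 self_mem_Iic) self_mem_Iic fun t ht => hz _ fun hm => ?_
    have := (hm i).1
    rw [add_smul_single, Function.update_self] at this
    have : t ≤ 0 := ht
    linarith
  rcases le_or_gt 1 (x i) with h' | h'
  · refine aux (Ici 0) (uniqueDiffOn_Ici 0 0 self_mem_Ici) self_mem_Ici fun t ht => hz _ fun hm => ?_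
    have := (hm i).2
    rw [add_smul_single, Function.update_self] at this
    have : 0 ≤ t := ht
    linarith
  · refine aux univ uniqueDiffWithinAt_univ (mem_univ _) fun t _ => hz _ fun hm => hx fun j => ?_
    rcases eq_or_ne j i with rfl | hj
    · exact ⟨h, h'⟩
    · have := hm j
      rwa [add_smul_single, Function.update_of_ne hj] at this

theorem partialDeriv_eq_lineDeriv {d : ℕ} {φ : (Fin d → ℝ) → ℝ} (hφ : ContDiff ℝ ∞ φ) (i : Fin d)
    (x : Fin d → ℝ) : lineDeriv ℝ φ x (-Pi.single i 1) = -partialDeriv i φ x := by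
  rw [((hφ.differentiable (by simp)) x).lineDeriv_eq_fderiv, map_neg]
  rfl

/-- Integration by parts for a Lipschitz function that vanishes outside of the open cube. -/
theorem integral_by_parts {d : ℕ} {c : (Fin d → ℝ) → ℝ} {K : NNReal} (hc : LipschitzWith K c)
    (hz : ∀ x, x ∉ openCube d → c x = 0) {φ : (Fin d → ℝ) → ℝ} (hφ : ContDiff ℝ ∞ φ)
    (hcs : HasCompactSupport φ) (i : Fin d) :
    (∫ x in openCube d, c x * partialDeriv i φ x) +
      ∫ x in openCube d, lineDeriv ℝ c x (Pi.single i 1) * φ x = 0 := by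
  obtain ⟨D, hD⟩ := (hφ.of_le (by simp) : ContDiff ℝ 1 φ).lipschitzWith_of_hasCompactSupport hcs
    (by simp)
  have h := hc.integral_lineDeriv_mul_eq hD hcs (Pi.single i 1) (μ := volume)
  -- Both integrands vanish outside of the cube, so the integrals extend to the whole space, where
  -- no boundary term arises.
  rw [setIntegral_eq_integral_of_forall_compl_eq_zero fun x hx => by rw [hz x hx, zero_mul],
    setIntegral_eq_integral_of_forall_compl_eq_zero fun x hx => by
      rw [lineDeriv_eq_zero_of_notMem hz hx, zero_mul], h]
  simp only [partialDeriv_eq_lineDeriv hφ, neg_mul, integral_neg, mul_comm (c _)]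
  ring

/-- The `d` directions cost `d ^ (1 / p)`, which is enlarged to `d` so that one bound serves all
`p`. -/
theorem gradNorm_le {d : ℕ} (hd : 1 ≤ d) {p : ℝ≥0∞} (hp : 1 ≤ p) {G : Fin d → (Fin d → ℝ) → ℝ}
    {E : ℝ≥0∞} (hG : ∀ i, eLpNorm (G i) p (volume.restrict (unitCube d)) ≤ E) :
    gradNorm p G ≤ d * E := by
  have h1 : (1 : ℝ≥0∞) ≤ d := by exact_mod_cast hd
  rw [gradNorm]
  split_ifs with ht
  · subst ht
    refine iSup_le fun i => ?_
    have := hG i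
    rw [eLpNorm_exponent_top, eLpNormEssSup] at this
    exact this.trans (le_mul_of_one_le_left zero_le h1)
  · have hp0 : p ≠ 0 := (zero_lt_one.trans_le hp).ne'
    have hpr : 1 ≤ p.toReal := by
      rw [← ENNReal.toReal_one]; exact ENNReal.toReal_mono ht hp
    have hpos : 0 < p.toReal := by linarith
    have hi : ∀ i, ∫⁻ x in unitCube d, ‖G i x‖ₑ ^ p.toReal ≤ E ^ p.toReal := by
      intro i
      have := hG i
      rw [eLpNorm_eq_lintegral_rpow_enorm_toReal hp0 ht] at this
      calc _ = ((∫⁻ x in unitCube d, ‖G i x‖ₑ ^ p.toReal) ^ (1 / p.toReal)) ^ p.toReal := by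
            rw [← ENNReal.rpow_mul, one_div_mul_cancel hpos.ne', ENNReal.rpow_one]
        _ ≤ _ := by gcongr
    calc _ ≤ ((d : ℝ≥0∞) * E ^ p.toReal) ^ (1 / p.toReal) := by
          gcongr
          refine (Finset.sum_le_sum fun i _ => hi i).trans ?_
          simp
      _ = (d : ℝ≥0∞) ^ (1 / p.toReal) * E := by
          rw [ENNReal.mul_rpow_of_nonneg _ _ (by positivity), ← ENNReal.rpow_mul,
            mul_one_div_cancel hpos.ne', ENNReal.rpow_one]
      _ ≤ (d : ℝ≥0∞) ^ (1 : ℝ) * E := by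
          gcongr
          rw [div_le_one hpos]; exact hpr
      _ = _ := by rw [ENNReal.rpow_one]

section Series

variable {d : ℕ} {ι : Type} [Countable ι] {c : ι → (Fin d → ℝ) → ℝ} {C : ι → Fin d → ℝ}

/-- A series of functions that vanish outside of the open cube and whose Lipschitz constants in
every variable are summable belongs to the Sobolev space. -/
theorem sobolev_of_hasSum (hd : 1 ≤ d) {p : ℝ≥0∞} (hp : 1 ≤ p) (h0 : ∀ k i, 0 ≤ C k i)
    (hL : ∀ k i x t, |c k (Function.update x i t) - c k x| ≤ C k i * |t - x i|)
    (hz : ∀ k x, x ∉ openCube d → c k x = 0) (hC : ∀ i, Summable fun k => C k i)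
    {g : (Fin d → ℝ) → ℝ} (hg : ∀ x ∈ openCube d, HasSum (fun k => c k x) (g x))
    {E : ℝ≥0∞} (hE : ∀ i, ∑' k, eLpNorm (fun x => lineDeriv ℝ (c k) x (Pi.single i 1)) p
      (volume.restrict (unitCube d)) ≤ E) :
    MemSobolevZero p g ∧ sobolevNorm p g ≤ d * E := by
  have hfin := isFiniteMeasure_openCube d
  have hlip := fun k => lipschitzWith_of_coordinatewise (h0 k) (hL k)
  have hcont := fun k => (hlip k).continuous
  set D : ι → Fin d → (Fin d → ℝ) → ℝ := fun k i x => lineDeriv ℝ (c k) x (Pi.single i 1) with hD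
  have hDb : ∀ k i x, |D k i x| ≤ C k i := fun k i x =>
    abs_lineDeriv_single_le (h0 k i) (hL k i x)
  have hDm : ∀ k i, Measurable (D k i) := fun k i => measurable_lineDeriv (hcont k)
  -- Moving coordinate `i` to 0 leaves the open cube, so the Lipschitz constant also bounds the
  -- function itself.
  have hcb : ∀ k i x, |c k x| ≤ C k i := by
    intro k i x
    by_cases hx : x ∈ openCube d
    · have h := hL k i x 0
      rw [hz k (Function.update x i 0) fun hm => by simpa using (hm i).1, zero_sub, abs_neg,
        zero_sub, abs_neg] at h
      refine h.trans (mul_le_of_le_one_right (h0 k i) ?_)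
      rw [abs_of_pos (hx i).1]; exact (hx i).2.le
    · rw [hz k x hx, abs_zero]; exact h0 k i
  set G : Fin d → (Fin d → ℝ) → ℝ := fun i x => ∑' k, D k i x with hG
  have hDs : ∀ i x, Summable fun k => D k i x := fun i x =>
    Summable.of_norm_bounded (hC i) fun k => hDb k i x
  have hGm : ∀ i, Measurable (G i) := fun i =>
    measurable_of_tendsto_metrizable' (f := fun (s : Finset ι) x => ∑ k ∈ s, D k i x)
      Filter.atTop (fun s => Finset.measurable_fun_sum s fun k _ => hDm k i)
      (tendsto_pi_nhds.2 fun x => (hDs i x).hasSum)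
  have hGb : ∀ i x, ‖G i x‖ ≤ ∑' k, C k i := fun i x =>
    tsum_of_norm_bounded (hC i).hasSum fun k => hDb k i x
  let i₀ : Fin d := ⟨0, hd⟩
  have hcs : ∀ x, Summable fun k => c k x := fun x =>
    Summable.of_norm_bounded (hC i₀) fun k => hcb k i₀ x
  have hgm : Measurable fun x => ∑' k, c k x :=
    measurable_of_tendsto_metrizable' (f := fun (s : Finset ι) x => ∑ k ∈ s, c k x)
      Filter.atTop (fun s => Finset.measurable_fun_sum s fun k _ => (hcont k).measurable)
      (tendsto_pi_nhds.2 fun x => (hcs x).hasSum)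
  have hmo : MeasurableSet (openCube d) := (isOpen_openCube d).measurableSet
  have hae : (fun x => ∑' k, c k x) =ᵐ[volume.restrict (openCube d)] g := by
    filter_upwards [ae_restrict_mem hmo] with x hx using (hg x hx).tsum_eq
  have hgM : ∀ q : ℝ≥0∞, MemLp g q (volume.restrict (openCube d)) := by
    intro q
    refine MemLp.ae_eq hae (MemLp.of_bound hgm.aestronglyMeasurable (∑' k, C k i₀)
      (Filter.Eventually.of_forall fun x => ?_))
    exact tsum_of_norm_bounded (hC i₀).hasSum fun k => hcb k i₀ x
  have hGM : ∀ i (q : ℝ≥0∞), MemLp (G i) q (volume.restrict (openCube d)) := fun i q =>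
    MemLp.of_bound (hGm i).aestronglyMeasurable _ (Filter.Eventually.of_forall (hGb i))
  -- The test functions need not vanish near the boundary; so the same identity later yields the
  -- weak gradient.
  have htrace : HasZeroTrace g G := by
    intro i φ hφ hφc
    have hpd : Continuous (partialDeriv i φ) :=
      (hφ.continuous_fderiv (by simp)).clm_apply continuous_const
    have hpc : HasCompactSupport (partialDeriv i φ) :=
      (hφc.fderiv (𝕜 := ℝ)).mono' fun x hx => subset_tsupport _ fun h => hx (by
        simp [partialDeriv, h])
    have hpi : Integrable (partialDeriv i φ) (volume.restrict (openCube d)) :=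
      (hpd.integrable_of_hasCompactSupport hpc).integrableOn
    have hφi : Integrable φ (volume.restrict (openCube d)) :=
      (hφ.continuous.integrable_of_hasCompactSupport hφc).integrableOn
    have gen : ∀ (F : ι → (Fin d → ℝ) → ℝ) (ψ : (Fin d → ℝ) → ℝ),
        (∀ k, Measurable (F k)) → (∀ k x, |F k x| ≤ C k i) →
        Integrable ψ (volume.restrict (openCube d)) →
        HasSum (fun k => ∫ x in openCube d, F k x * ψ x)
          (∫ x in openCube d, ∑' k, F k x * ψ x) := by
      intro F ψ hFm hFb hψ
      have h_integral : ∀ k, Integrable (fun x => F k x * ψ x) (volume.restrict (openCube d)) := fun k =>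
        hψ.bdd_mul (c := C k i) (hFm k).aestronglyMeasurable
          (Filter.Eventually.of_forall (hFb k))
      refine hasSum_integral_of_summable_integral_norm h_integral ?_
      refine Summable.of_nonneg_of_le (fun k => integral_nonneg fun x => norm_nonneg _)
        (fun k => ?_) ((hC i).mul_right (∫ x in openCube d, ‖ψ x‖))
      rw [← integral_const_mul]
      refine integral_mono (h_integral k).norm (hψ.norm.const_mul _) fun x => ?_
      simp only [norm_mul]
      exact mul_le_mul_of_nonneg_right (hFb k x) (norm_nonneg _)
    have s1 := gen c (partialDeriv i φ) (fun k => (hcont k).measurable) (fun k x => hcb k i x) hpi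
    have s2 := gen (fun k => D k i) φ (fun k => hDm k i) (fun k x => hDb k i x) hφi
    have e1 : ∫ x in openCube d, g x * partialDeriv i φ x =
        ∫ x in openCube d, ∑' k, c k x * partialDeriv i φ x := by
      refine setIntegral_congr_fun hmo fun x hx => ?_
      simp only [tsum_mul_right, (hg x hx).tsum_eq]
    have e2 : ∫ x in openCube d, G i x * φ x = ∫ x in openCube d, ∑' k, D k i x * φ x := by
      refine setIntegral_congr_fun hmo fun x _ => ?_
      simp only [tsum_mul_right, hG]
    rw [e1, e2]
    have s3 := s1.add s2
    have : (fun k => (∫ x in openCube d, c k x * partialDeriv i φ x) +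
        ∫ x in openCube d, D k i x * φ x) = fun _ => 0 :=
      funext fun k => integral_by_parts (hlip k) (hz k) hφ hφc i
    rw [this] at s3
    exact s3.unique hasSum_zero
  have hweak : IsWeakGradient g G := by
    refine ⟨IntegrableOn.locallyIntegrableOn (memLp_one_iff_integrable.1 (hgM 1)),
      fun i => ⟨IntegrableOn.locallyIntegrableOn (memLp_one_iff_integrable.1 (hGM i 1)),
        fun φ hφ hφc _ => ?_⟩⟩
    exact eq_neg_of_add_eq_zero_left (htrace i φ hφ hφc)
  refine ⟨⟨by rw [restrict_unitCube]; exact hgM p, G, hweak,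
    fun i => by rw [restrict_unitCube]; exact hGM i p, htrace⟩, ?_⟩
  refine (iInf₂_le G hweak).trans (gradNorm_le hd hp fun i => ?_)
  -- Lower semicontinuity of the norm; the partial sums are bounded by Minkowski's inequality.
  refine Lp.eLpNorm_le_of_ae_tendsto (u := Filter.atTop)
    (f := fun (s : Finset ι) x => ∑ k ∈ s, D k i x)
    (Filter.Eventually.of_forall fun s => ?_)
    (fun s => (Finset.measurable_fun_sum s fun k _ => hDm k i).aestronglyMeasurable)
    (Filter.Eventually.of_forall fun x => (hDs i x).hasSum)
  refine le_trans ?_ ((ENNReal.sum_le_tsum s).trans (hE i))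
  have e : (fun x => ∑ k ∈ s, D k i x) = ∑ k ∈ s, D k i := by
    ext x; simp
  rw [e]
  exact eLpNorm_sum_le (fun k _ => (hDm k i).aestronglyMeasurable) hp

end Series

/-! ### Lipschitz estimates for the levels of the Faber series -/

theorem abs_hat_sub_le (a b : ℝ) : |hat a - hat b| ≤ |a - b| := by
  have h : ∀ t, hat t = max 0 (min t (2 - t)) := by
    intro t
    rcases le_total t 0 with h | h
    · rw [hat_of_le_zero h, max_eq_left ((min_le_left _ _).trans h)]
    rcases le_total t 1 with h1 | h1
    · rw [hat_of_mem_left h h1, min_eq_left (by linarith), max_eq_right h]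
    rcases le_total t 2 with h2 | h2
    · rw [hat_of_mem_right h1 h2, min_eq_right (by linarith), max_eq_right (by linarith)]
    · rw [hat_of_ge_two h2, max_eq_left ((min_le_right _ _).trans (by linarith))]
  rw [h, h]
  calc _ ≤ |min a (2 - a) - min b (2 - b)| := by
        simpa using abs_max_sub_max_le_max (0 : ℝ) (min a (2 - a)) 0 (min b (2 - b))
    _ ≤ max |a - b| |(2 - a) - (2 - b)| := abs_min_sub_min_le_max _ _ _ _
    _ = |a - b| := by
        rw [show (2 - a) - (2 - b) = -(a - b) by ring, abs_neg, max_self]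

theorem abs_hat_scaled_sub_le (k s : ℕ) (t y : ℝ) :
    |hat (2 ^ (k + 1) * t - 2 * s) - hat (2 ^ (k + 1) * y - 2 * s)| ≤ 2 ^ (k + 1) * |t - y| := by
  refine (abs_hat_sub_le _ _).trans (le_of_eq ?_)
  rw [show (2 : ℝ) ^ (k + 1) * t - 2 * s - (2 ^ (k + 1) * y - 2 * s) = 2 ^ (k + 1) * (t - y) by ring,
    abs_mul, abs_of_pos (by positivity)]

/-- `a` and `b` are the positions active at the old and at the new point: at most two terms are
nonzero, whatever the size of `S`. -/
theorem sum_abs_sub_le_two_mul {σ : Type*} (S : Finset σ) {F F' : σ → ℝ} (a b : σ)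
    (hF : ∀ s, s ≠ a → F s = 0) (hF' : ∀ s, s ≠ b → F' s = 0) {B : ℝ} (hB : 0 ≤ B)
    (h : ∀ s ∈ S, |F' s - F s| ≤ B) : ∑ s ∈ S, |F' s - F s| ≤ 2 * B := by
  classical
  have e : ∑ s ∈ S.filter (· ∈ ({a, b} : Finset σ)), |F' s - F s| = ∑ s ∈ S, |F' s - F s| := by
    refine Finset.sum_subset (Finset.filter_subset _ _) fun s hs hn => ?_
    simp only [Finset.mem_filter, hs, true_and, Finset.mem_insert, Finset.mem_singleton,
      not_or] at hn
    rw [hF s hn.1, hF' s hn.2, sub_zero, abs_zero]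
  rw [← e]
  calc _ ≤ (S.filter (· ∈ ({a, b} : Finset σ))).card • B :=
        Finset.sum_le_card_nsmul _ _ _ fun s hs => h s (Finset.mem_filter.1 hs).1
    _ ≤ 2 * B := by
        rw [nsmul_eq_mul]
        have : (S.filter (· ∈ ({a, b} : Finset σ))).card ≤ 2 :=
          (Finset.card_le_card fun s hs => (Finset.mem_filter.1 hs).2).trans Finset.card_le_two
        have : ((S.filter (· ∈ ({a, b} : Finset σ))).card : ℝ) ≤ 2 := by exact_mod_cast this
        gcongr

/-- The sum of the univariate hats of level `k`. -/
def hatSum (k : ℕ) (y : ℝ) : ℝ := ∑ s ∈ Finset.range (2 ^ k), hat (2 ^ (k + 1) * y - 2 * s)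

theorem hatSum_nonneg (k : ℕ) (y : ℝ) : 0 ≤ hatSum k y :=
  Finset.sum_nonneg fun _ _ => (hat_mem _).1

theorem hatSum_eq (k : ℕ) (y : ℝ) : hatSum k y =
    if ⌊2 ^ k * y⌋₊ ∈ Finset.range (2 ^ k) then
      hat (2 ^ (k + 1) * y - 2 * (⌊2 ^ k * y⌋₊ : ℕ)) else 0 := by
  rw [hatSum]
  split_ifs with h
  · exact Finset.sum_eq_single_of_mem _ h fun s _ hs => hat_eq_zero_of_ne_floor hs
  · refine Finset.sum_eq_zero fun s hs => hat_eq_zero_of_ne_floor ?_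
    rintro rfl
    exact h hs

theorem hatSum_le_one (k : ℕ) (y : ℝ) : hatSum k y ≤ 1 := by
  rw [hatSum_eq]
  split_ifs
  · exact (hat_mem _).2
  · exact zero_le_one

theorem continuous_hat : Continuous hat := by
  unfold hat; fun_prop

theorem continuous_hatSum (k : ℕ) : Continuous (hatSum k) := by
  unfold hatSum
  exact continuous_finsetSum _ fun s _ => continuous_hat.comp (by fun_prop)

theorem sum_abs_hat_sub_le (k : ℕ) (t y : ℝ) :
    ∑ s ∈ Finset.range (2 ^ k), |hat (2 ^ (k + 1) * t - 2 * s) - hat (2 ^ (k + 1) * y - 2 * s)| ≤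
      2 * (2 ^ (k + 1) * |t - y|) :=
  sum_abs_sub_le_two_mul _ ⌊2 ^ k * y⌋₊ ⌊2 ^ k * t⌋₊ (fun _ hs => hat_eq_zero_of_ne_floor hs)
    (fun _ hs => hat_eq_zero_of_ne_floor hs) (by positivity)
    fun s _ => abs_hat_scaled_sub_le k s t y

/-- The step changes the `i`-th factor only, so the sum over positions factorizes. The other factors
are kept as `hatSum`, not bounded by 1, because their `L_p` norms supply the powers of `cP p`. -/
theorem abs_faberLevel_update_sub_le {d : ℕ} {f : (Fin d → ℝ) → ℝ} {k : Fin d → ℕ} {Λ : ℝ}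
    (hΛ : ∀ s ∈ positions k, |faberCoeff f k s| ≤ Λ) (hΛ0 : 0 ≤ Λ) (i : Fin d) (x : Fin d → ℝ)
    (t : ℝ) :
    |faberLevel f k (Function.update x i t) - faberLevel f k x| ≤
      Λ * (4 * 2 ^ k i) * (∏ j ∈ Finset.univ.erase i, hatSum (k j) (x j)) * |t - x i| := by
  classical
  have hsplit : ∀ s, |tensorHat k s (Function.update x i t) - tensorHat k s x| =
      ∏ j, if j = i then |hat (2 ^ (k j + 1) * t - 2 * s j) - hat (2 ^ (k j + 1) * x j - 2 * s j)|
        else hat (2 ^ (k j + 1) * x j - 2 * s j) := by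
    intro s
    have e1 : tensorHat k s (Function.update x i t) = hat (2 ^ (k i + 1) * t - 2 * s i) *
        ∏ j ∈ Finset.univ.erase i, hat (2 ^ (k j + 1) * x j - 2 * s j) := by
      rw [tensorHat, ← Finset.mul_prod_erase _ _ (Finset.mem_univ i), Function.update_self]
      congr 1
      exact Finset.prod_congr rfl fun j hj => by
        rw [Function.update_of_ne (Finset.ne_of_mem_erase hj)]
    have e2 : tensorHat k s x = hat (2 ^ (k i + 1) * x i - 2 * s i) *
        ∏ j ∈ Finset.univ.erase i, hat (2 ^ (k j + 1) * x j - 2 * s j) :=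
      (Finset.mul_prod_erase _ _ (Finset.mem_univ i)).symm
    have e3 := Finset.mul_prod_erase Finset.univ (fun j => if j = i then
      |hat (2 ^ (k j + 1) * t - 2 * s j) - hat (2 ^ (k j + 1) * x j - 2 * s j)|
        else hat (2 ^ (k j + 1) * x j - 2 * s j)) (Finset.mem_univ i)
    rw [← e3, if_pos rfl, e1, e2, ← sub_mul, abs_mul,
      abs_of_nonneg (Finset.prod_nonneg fun j _ => (hat_mem _).1)]
    congr 1
    exact Finset.prod_congr rfl fun j hj => (if_neg (Finset.ne_of_mem_erase hj)).symm
  rw [faberLevel, faberLevel, ← Finset.sum_sub_distrib]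
  calc |∑ s ∈ positions k, (faberCoeff f k s * tensorHat k s (Function.update x i t) -
        faberCoeff f k s * tensorHat k s x)|
      ≤ ∑ s ∈ positions k, Λ * |tensorHat k s (Function.update x i t) - tensorHat k s x| := by
        refine (Finset.abs_sum_le_sum_abs _ _).trans (Finset.sum_le_sum fun s hs => ?_)
        rw [← mul_sub, abs_mul]
        exact mul_le_mul_of_nonneg_right (hΛ s hs) (abs_nonneg _)
    _ = Λ * ((∑ s ∈ Finset.range (2 ^ k i),
          |hat (2 ^ (k i + 1) * t - 2 * s) - hat (2 ^ (k i + 1) * x i - 2 * s)|) *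
          ∏ j ∈ Finset.univ.erase i, hatSum (k j) (x j)) := by
        rw [← Finset.mul_sum]
        congr 1
        rw [Finset.sum_congr rfl fun s _ => hsplit s, positions,
          ← Finset.prod_univ_sum (fun j => Finset.range (2 ^ k j)) fun j (n : ℕ) => if j = i then
            |hat (2 ^ (k j + 1) * t - 2 * n) - hat (2 ^ (k j + 1) * x j - 2 * n)|
            else hat (2 ^ (k j + 1) * x j - 2 * n),
          ← Finset.mul_prod_erase _ _ (Finset.mem_univ i)]
        simp only [if_true]
        congr 1
        refine Finset.prod_congr rfl fun j hj => ?_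
        simp only [if_neg (Finset.ne_of_mem_erase hj)]
        rfl
    _ ≤ Λ * ((2 * (2 ^ (k i + 1) * |t - x i|)) *
          ∏ j ∈ Finset.univ.erase i, hatSum (k j) (x j)) := by
        have : 0 ≤ ∏ j ∈ Finset.univ.erase i, hatSum (k j) (x j) :=
          Finset.prod_nonneg fun j _ => hatSum_nonneg _ _
        gcongr
        exact sum_abs_hat_sub_le _ _ _
    _ = _ := by ring

theorem hat_scaled_eq_zero {k s : ℕ} (hs : s < 2 ^ k) {y : ℝ} (hy : ¬ (0 < y ∧ y < 1)) :
    hat (2 ^ (k + 1) * y - 2 * s) = 0 := by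
  rcases le_or_gt y 0 with h | h
  · apply hat_of_le_zero
    have : (2 : ℝ) ^ (k + 1) * y ≤ 0 := mul_nonpos_of_nonneg_of_nonpos (by positivity) h
    have : (0 : ℝ) ≤ s := by positivity
    linarith
  · apply hat_of_ge_two
    have h1 : 1 ≤ y := by by_contra hc; exact hy ⟨h, not_le.1 hc⟩
    have h2 : (s : ℝ) + 1 ≤ 2 ^ k := by exact_mod_cast hs
    have h3 : (2 : ℝ) ^ (k + 1) * 1 ≤ 2 ^ (k + 1) * y := by gcongr
    rw [pow_succ] at h3 ⊢
    linarith

/-! ### The levels of the approximate Faber series -/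

/-- The part of level `k` of the Faber series, with approximate products. -/
def approxLevel {d : ℕ} (J R : ℕ) (f : (Fin d → ℝ) → ℝ) (k : Fin d → ℕ) (x : Fin d → ℝ) : ℝ :=
  ∑ s ∈ positions k, faberCoeff f k s * treeApprox R (hatVec k s x) J 0

theorem blockProd_hatVec {d J : ℕ} (hJ : d ≤ 2 ^ J) (k s : Fin d → ℕ) (x : Fin d → ℝ) :
    blockProd (hatVec k s x) J 0 = tensorHat k s x := by
  rw [blockProd, tensorHat, zero_mul, zero_add, one_mul, Nat.Ico_zero_eq_range]
  rw [← Finset.prod_subset (Finset.range_mono hJ)]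
  · rw [Finset.prod_range]
    refine Finset.prod_congr rfl fun i _ => ?_
    simp [hatVec]
  · intro b _ hb
    rw [Finset.mem_range] at hb
    simp [hatVec, hb]

theorem hatVec_update {d : ℕ} (k s : Fin d → ℕ) (x : Fin d → ℝ) (i : Fin d) (t : ℝ) :
    hatVec k s (Function.update x i t) =
      Function.update (hatVec k s x) i (hat (2 ^ (k i + 1) * t - 2 * s i)) := by
  ext b
  rcases eq_or_ne b (i : ℕ) with rfl | h
  · simp [hatVec]
  · rw [Function.update_of_ne h, hatVec, hatVec]
    split_ifs with hb
    · rw [Function.update_of_ne fun e => h (congrArg Fin.val e)]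
    · rfl

theorem treeApprox_hatVec_eq_zero {d J : ℕ} (hJ : d ≤ 2 ^ J) (R : ℕ) {k s : Fin d → ℕ}
    {x : Fin d → ℝ} {i : Fin d} (h : hat (2 ^ (k i + 1) * x i - 2 * s i) = 0) :
    treeApprox R (hatVec k s x) J 0 = 0 := by
  refine treeApprox_eq_zero R J 0 (b := i) (by simp) ?_ ?_
  · have := i.2; rw [zero_add, one_mul]; omega
  · simpa [hatVec] using h

/-- A bound uniform in `x` is enough here, as `2 ^ (-R)` is at free disposal. The exact zeros of the
approximate products leave at most two active positions, so the number of hats does not enter. -/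
theorem abs_approx_error_update_sub_le {d J R : ℕ} (hJ : d ≤ 2 ^ J) (hR : 1 ≤ R)
    {f : (Fin d → ℝ) → ℝ} {k : Fin d → ℕ} {Λ : ℝ}
    (hΛ : ∀ s ∈ positions k, |faberCoeff f k s| ≤ Λ) (hΛ0 : 0 ≤ Λ) (i : Fin d) (x : Fin d → ℝ)
    (t : ℝ) :
    |(faberLevel f k (Function.update x i t) - approxLevel J R f k (Function.update x i t)) -
      (faberLevel f k x - approxLevel J R f k x)| ≤
      Λ * (4 * 2 ^ k i) * (4 ^ J * (2 * (2 ^ R)⁻¹)) * |t - x i| := by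
  classical
  set F : (Fin d → ℝ) → (Fin d → ℕ) → ℝ := fun x s =>
    tensorHat k s x - treeApprox R (hatVec k s x) J 0 with hF
  have hz : ∀ x s, s ≠ (fun i => ⌊2 ^ k i * x i⌋₊) → F x s = 0 := by
    intro x s hs
    obtain ⟨j, hj⟩ := Function.ne_iff.1 hs
    simp only [hF]
    rw [tensorHat_eq_zero hs, treeApprox_hatVec_eq_zero hJ R (hat_eq_zero_of_ne_floor hj), sub_zero]
  have hB : ∀ s, |F (Function.update x i t) s - F x s| ≤
      4 ^ J * (2 * (2 ^ R)⁻¹) * (2 ^ (k i + 1) * |t - x i|) := by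
    intro s
    have h := abs_treeApprox_error_sub_le R hR (v := hatVec k s x) i
      (hat (2 ^ (k i + 1) * t - 2 * s i)) (hatVec_mem k s x) (hat_mem _) J 0
    rw [← hatVec_update, blockProd_hatVec hJ, blockProd_hatVec hJ] at h
    simp only [hF]
    rw [← abs_neg]
    calc _ = |treeApprox R (hatVec k s (Function.update x i t)) J 0 -
          tensorHat k s (Function.update x i t) -
          (treeApprox R (hatVec k s x) J 0 - tensorHat k s x)| := by congr 1; ring
      _ ≤ _ := h
      _ ≤ _ := by
        gcongr
        have : hatVec k s x i = hat (2 ^ (k i + 1) * x i - 2 * s i) := by simp [hatVec]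
        rw [this]
        exact abs_hat_scaled_sub_le _ _ _ _
  have e : ∀ x, faberLevel f k x - approxLevel J R f k x =
      ∑ s ∈ positions k, faberCoeff f k s * F x s := by
    intro x
    rw [faberLevel, approxLevel, ← Finset.sum_sub_distrib]
    exact Finset.sum_congr rfl fun s _ => by simp only [hF]; ring
  rw [e, e, ← Finset.sum_sub_distrib]
  calc _ ≤ ∑ s ∈ positions k, Λ * |F (Function.update x i t) s - F x s| := by
        refine (Finset.abs_sum_le_sum_abs _ _).trans (Finset.sum_le_sum fun s hs => ?_)
        rw [← mul_sub, abs_mul]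
        exact mul_le_mul_of_nonneg_right (hΛ s hs) (abs_nonneg _)
    _ ≤ Λ * (2 * (4 ^ J * (2 * (2 ^ R)⁻¹) * (2 ^ (k i + 1) * |t - x i|))) := by
        rw [← Finset.mul_sum]
        gcongr
        exact sum_abs_sub_le_two_mul _ _ _ (hz x) (hz _) (by positivity) fun s _ => hB s
    _ = _ := by ring

theorem faberLevel_eq_zero {d : ℕ} (f : (Fin d → ℝ) → ℝ) (k : Fin d → ℕ) {x : Fin d → ℝ}
    (hx : x ∉ openCube d) : faberLevel f k x = 0 := by
  simp only [openCube, mem_ofPred_eq, not_forall] at hx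
  obtain ⟨i, hi⟩ := hx
  refine Finset.sum_eq_zero fun s hs => ?_
  have hs' := Finset.mem_range.1 (Fintype.mem_piFinset.1 hs i)
  rw [tensorHat, Finset.prod_eq_zero (Finset.mem_univ i) (hat_scaled_eq_zero hs' hi), mul_zero]

theorem approxLevel_eq_zero {d J : ℕ} (hJ : d ≤ 2 ^ J) (R : ℕ) (f : (Fin d → ℝ) → ℝ)
    (k : Fin d → ℕ) {x : Fin d → ℝ} (hx : x ∉ openCube d) : approxLevel J R f k x = 0 := by
  simp only [openCube, mem_ofPred_eq, not_forall] at hx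
  obtain ⟨i, hi⟩ := hx
  refine Finset.sum_eq_zero fun s hs => ?_
  have hs' := Finset.mem_range.1 (Fintype.mem_piFinset.1 hs i)
  rw [treeApprox_hatVec_eq_zero hJ R (hat_scaled_eq_zero hs' hi), mul_zero]

/-! ### The `L_p` norm of a tensor product of hats -/

theorem integral_hat_rpow {p : ℝ} (hp : 0 < p) : ∫ t in (0 : ℝ)..2, hat t ^ p = 2 / (p + 1) := by
  have hc : Continuous fun t => hat t ^ p :=
    continuous_hat.rpow_const fun t => Or.inr hp.le
  rw [← intervalIntegral.integral_add_adjacent_intervals (b := 1)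
    (hc.intervalIntegrable _ _) (hc.intervalIntegrable _ _)]
  have h1 : ∫ t in (0 : ℝ)..1, hat t ^ p = 1 / (p + 1) := by
    rw [intervalIntegral.integral_congr (g := fun t => t ^ p), integral_rpow (Or.inl (by linarith))]
    · simp [Real.zero_rpow (by linarith : p + 1 ≠ 0)]
    · intro t ht
      rw [uIcc_of_le zero_le_one] at ht
      simp only [hat_of_mem_left ht.1 ht.2]
  have h2 : ∫ t in (1 : ℝ)..2, hat t ^ p = 1 / (p + 1) := by
    rw [intervalIntegral.integral_congr (g := fun t => (2 - t) ^ p),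
      intervalIntegral.integral_comp_sub_left (fun t => t ^ p), integral_rpow (Or.inl (by linarith))]
    · norm_num [Real.zero_rpow (by linarith : p + 1 ≠ 0)]
    · intro t ht
      rw [uIcc_of_le one_le_two] at ht
      simp only [hat_of_mem_right ht.1 ht.2]
  rw [h1, h2]; ring

/-- At most one hat is active at a point, so the power of the sum is the sum of the powers; `2 ^ k`
hats of width `2 ^ (-k)` give a value independent of `k`. -/
theorem integral_hatSum_rpow (k : ℕ) {p : ℝ} (hp : 0 < p) :
    ∫ y in Icc (0 : ℝ) 1, hatSum k y ^ p = 1 / (p + 1) := by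
  have hpow : ∀ y, hatSum k y ^ p =
      ∑ s ∈ Finset.range (2 ^ k), hat (2 ^ (k + 1) * y - 2 * s) ^ p := by
    intro y
    rw [hatSum_eq]
    split_ifs with h
    · symm
      refine Finset.sum_eq_single_of_mem _ h fun s _ hs => ?_
      rw [hat_eq_zero_of_ne_floor hs, Real.zero_rpow hp.ne']
    · rw [Real.zero_rpow hp.ne']
      symm
      refine Finset.sum_eq_zero fun s hs => ?_
      rw [hat_eq_zero_of_ne_floor, Real.zero_rpow hp.ne']
      rintro rfl
      exact h hs
  have hc : Continuous fun t => hat t ^ p :=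
    continuous_hat.rpow_const fun t => Or.inr hp.le
  have hs : ∀ s ∈ Finset.range (2 ^ k), ∫ y in (0 : ℝ)..1, hat (2 ^ (k + 1) * y - 2 * s) ^ p =
      (2 ^ (k + 1))⁻¹ * (2 / (p + 1)) := by
    intro s hs
    have hs' : (s : ℝ) + 1 ≤ 2 ^ k := by exact_mod_cast Finset.mem_range.1 hs
    have hs0 : (0 : ℝ) ≤ s := by positivity
    rw [intervalIntegral.integral_comp_mul_sub (fun t => hat t ^ p) (by positivity), smul_eq_mul]
    congr 1
    have z1 : ∫ t in (2 ^ (k + 1) * 0 - 2 * s : ℝ)..0, hat t ^ p = 0 := by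
      rw [intervalIntegral.integral_congr (g := fun _ => (0 : ℝ))]
      · simp
      · intro t ht
        rw [uIcc_of_le (by linarith)] at ht
        simp only [hat_of_le_zero ht.2, Real.zero_rpow hp.ne']
    have z2 : ∫ t in (2 : ℝ)..(2 ^ (k + 1) * 1 - 2 * s : ℝ), hat t ^ p = 0 := by
      rw [intervalIntegral.integral_congr (g := fun _ => (0 : ℝ))]
      · simp
      · intro t ht
        rw [uIcc_of_le (by rw [pow_succ]; linarith)] at ht
        simp only [hat_of_ge_two ht.1, Real.zero_rpow hp.ne']
    rw [← intervalIntegral.integral_add_adjacent_intervals (b := 0)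
      (hc.intervalIntegrable _ _) (hc.intervalIntegrable _ _), z1,
      ← intervalIntegral.integral_add_adjacent_intervals (b := 2)
      (hc.intervalIntegrable _ _) (hc.intervalIntegrable _ _), z2, integral_hat_rpow hp]
    ring
  rw [integral_Icc_eq_integral_Ioc, ← intervalIntegral.integral_of_le zero_le_one]
  simp only [hpow]
  have hci : ∀ s ∈ Finset.range (2 ^ k), IntervalIntegrable
      (fun y : ℝ => hat (2 ^ (k + 1) * y - 2 * s) ^ p) volume 0 1 := fun s _ =>
    (hc.comp (by fun_prop : Continuous fun y : ℝ => 2 ^ (k + 1) * y - 2 * s)).intervalIntegrable _ _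
  rw [intervalIntegral.integral_finsetSum hci, Finset.sum_congr rfl hs, Finset.sum_const,
    Finset.card_range, nsmul_eq_mul]
  push_cast
  rw [pow_succ]
  field_simp

theorem cP_pos {p : ℝ≥0∞} : 0 < cP p := by
  rw [cP]
  split_ifs
  · exact zero_lt_one
  · exact Real.rpow_pos_of_pos (by positivity) _

/-- For finite `p` the integral is a product in which the missing factor `i` contributes 1 and each
other one `1 / (p + 1)`. -/
theorem eLpNorm_prod_hatSum_le {d : ℕ} (k : Fin d → ℕ) (i : Fin d) {p : ℝ≥0∞} (hp : 1 ≤ p) :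
    eLpNorm (fun x : Fin d → ℝ => ∏ j ∈ Finset.univ.erase i, hatSum (k j) (x j)) p
      (volume.restrict (unitCube d)) ≤ ENNReal.ofReal ((cP p)⁻¹ ^ (d - 1)) := by
  classical
  have hnn : ∀ x : Fin d → ℝ, 0 ≤ ∏ j ∈ Finset.univ.erase i, hatSum (k j) (x j) := fun x =>
    Finset.prod_nonneg fun j _ => hatSum_nonneg _ _
  have hle : ∀ x : Fin d → ℝ, ∏ j ∈ Finset.univ.erase i, hatSum (k j) (x j) ≤ 1 := fun x =>
    Finset.prod_le_one (fun j _ => hatSum_nonneg _ _) fun j _ => hatSum_le_one _ _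
  have hcont : Continuous fun x : Fin d → ℝ => ∏ j ∈ Finset.univ.erase i, hatSum (k j) (x j) :=
    continuous_finsetProd _ fun j _ => (continuous_hatSum _).comp (continuous_apply j)
  by_cases ht : p = ⊤
  · subst ht
    have := eLpNorm_le_of_ae_bound (p := ⊤) (μ := volume.restrict (unitCube d)) (C := 1)
      (f := fun x : Fin d → ℝ => ∏ j ∈ Finset.univ.erase i, hatSum (k j) (x j))
      (Filter.Eventually.of_forall fun x => by
        rw [Real.norm_eq_abs, abs_of_nonneg (hnn x)]; exact hle x)
    simpa [cP] using this
  · have hp0 : p ≠ 0 := (zero_lt_one.trans_le hp).ne'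
    have hpos : 0 < p.toReal := ENNReal.toReal_pos hp0 ht
    have h_integral : ∫ x in unitCube d, (∏ j ∈ Finset.univ.erase i, hatSum (k j) (x j)) ^ p.toReal =
        (1 / (p.toReal + 1)) ^ (d - 1) := by
      have e : ∀ x : Fin d → ℝ, (∏ j ∈ Finset.univ.erase i, hatSum (k j) (x j)) ^ p.toReal =
          ∏ j, if j = i then (1 : ℝ) else hatSum (k j) (x j) ^ p.toReal := by
        intro x
        have e3 := Finset.mul_prod_erase Finset.univ (fun j => if j = i then (1 : ℝ) else
          hatSum (k j) (x j) ^ p.toReal) (Finset.mem_univ i)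
        rw [← e3, if_pos rfl, one_mul, ← Real.finsetProd_rpow _ _ fun j _ => hatSum_nonneg _ _]
        exact Finset.prod_congr rfl fun j hj => (if_neg (Finset.ne_of_mem_erase hj)).symm
      have hm : (volume.restrict (unitCube d) : Measure (Fin d → ℝ)) =
          Measure.pi fun _ : Fin d => volume.restrict (Icc (0 : ℝ) 1) := by
        rw [unitCube, ← Set.pi_univ_Icc, volume_pi, Measure.restrict_pi_pi]
        rfl
      simp only [e]
      rw [hm, integral_fintype_prod_eq_prod (𝕜 := ℝ)
        (fun j y => if j = i then (1 : ℝ) else hatSum (k j) y ^ p.toReal),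
        ← Finset.mul_prod_erase _ _ (Finset.mem_univ i)]
      have e4 : ∀ j ∈ Finset.univ.erase i, (∫ y in Icc (0 : ℝ) 1,
          if j = i then (1 : ℝ) else hatSum (k j) y ^ p.toReal) = 1 / (p.toReal + 1) := by
        intro j hj
        simp only [if_neg (Finset.ne_of_mem_erase hj)]
        exact integral_hatSum_rpow (k j) hpos
      rw [Finset.prod_congr rfl e4, Finset.prod_const, Finset.card_erase_of_mem (Finset.mem_univ i)]
      simp
    rw [eLpNorm_eq_lintegral_rpow_enorm_toReal hp0 ht]
    have e5 : ∀ x : Fin d → ℝ, ‖∏ j ∈ Finset.univ.erase i, hatSum (k j) (x j)‖ₑ ^ p.toReal =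
        ENNReal.ofReal ((∏ j ∈ Finset.univ.erase i, hatSum (k j) (x j)) ^ p.toReal) := by
      intro x
      rw [Real.enorm_of_nonneg (hnn x), ENNReal.ofReal_rpow_of_nonneg (hnn x) hpos.le]
    have hmem : Integrable (fun x : Fin d → ℝ =>
        (∏ j ∈ Finset.univ.erase i, hatSum (k j) (x j)) ^ p.toReal)
        (volume.restrict (unitCube d)) := by
      refine memLp_one_iff_integrable.1 (MemLp.of_bound
        (hcont.rpow_const fun x => Or.inr hpos.le).aestronglyMeasurable 1
        (Filter.Eventually.of_forall fun x => ?_))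
      rw [Real.norm_eq_abs, abs_of_nonneg (Real.rpow_nonneg (hnn x) _)]
      exact Real.rpow_le_one (hnn x) (hle x) hpos.le
    simp only [e5]
    rw [← ofReal_integral_eq_lintegral_ofReal hmem
      (Filter.Eventually.of_forall fun x => Real.rpow_nonneg (hnn x) _), h_integral,
      ENNReal.ofReal_rpow_of_nonneg (by positivity) (by positivity)]
    refine le_of_eq ?_
    congr 1
    rw [cP, if_neg ht, ← Real.rpow_natCast, ← Real.rpow_mul (by positivity), mul_comm,
      Real.rpow_mul (by positivity), Real.rpow_natCast, one_div, Real.inv_rpow (by positivity)]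

theorem eLpNorm_lineDeriv_faberLevel_le {d : ℕ} {f : (Fin d → ℝ) → ℝ} {k : Fin d → ℕ} {Λ : ℝ}
    (hΛ : ∀ s ∈ positions k, |faberCoeff f k s| ≤ Λ) (hΛ0 : 0 ≤ Λ) (i : Fin d) {p : ℝ≥0∞}
    (hp : 1 ≤ p) :
    eLpNorm (fun x => lineDeriv ℝ (faberLevel f k) x (Pi.single i 1)) p
      (volume.restrict (unitCube d)) ≤
      ENNReal.ofReal (Λ * (4 * 2 ^ k i) * (cP p)⁻¹ ^ (d - 1)) := by
  have hA : 0 ≤ Λ * (4 * 2 ^ k i) := by positivity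
  calc _ ≤ eLpNorm ((Λ * (4 * 2 ^ k i)) • fun x : Fin d → ℝ =>
        ∏ j ∈ Finset.univ.erase i, hatSum (k j) (x j)) p (volume.restrict (unitCube d)) := by
        refine eLpNorm_mono_real fun x => ?_
        simp only [Pi.smul_apply, smul_eq_mul]
        exact abs_lineDeriv_single_le (mul_nonneg hA (Finset.prod_nonneg fun j _ =>
          hatSum_nonneg _ _)) (abs_faberLevel_update_sub_le hΛ hΛ0 i x)
    _ ≤ ENNReal.ofReal (Λ * (4 * 2 ^ k i)) * ENNReal.ofReal ((cP p)⁻¹ ^ (d - 1)) := by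
        rw [eLpNorm_const_smul, Real.enorm_of_nonneg hA]
        gcongr
        exact eLpNorm_prod_hatSum_le k i hp
    _ = _ := by rw [← ENNReal.ofReal_mul hA]

/-! ### The sparse index set -/

/-- The levels of the sparse grid: `β |k|₁ - |k|_∞ ≤ (β - 1) m`. -/
def sparseSet (d : ℕ) (β m : ℝ) : Set (Fin d → ℕ) :=
  {k | ∃ i, β * ∑ j, (k j : ℝ) - k i ≤ (β - 1) * m}

/-- As `k i ≤ |k|₁`, the condition forces `|k|₁ ≤ m`. -/
theorem sparseSet_finite {d : ℕ} {β : ℝ} (hβ : 1 < β) (m : ℝ) : (sparseSet d β m).Finite := by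
  refine (Fintype.piFinset fun _ : Fin d => Finset.range (⌊m⌋₊ + 1)).finite_toSet.subset ?_
  rintro k ⟨i, hi⟩
  rw [Finset.mem_coe, Fintype.mem_piFinset]
  intro j
  have h1 : ∀ j, (k j : ℝ) ≤ ∑ j, (k j : ℝ) := fun j =>
    Finset.single_le_sum (f := fun j => (k j : ℝ)) (fun _ _ => Nat.cast_nonneg _)
      (Finset.mem_univ j)
  have h2 : (β - 1) * ∑ j, (k j : ℝ) ≤ (β - 1) * m := by
    have := h1 i; linarith
  have h3 : (k j : ℝ) ≤ m := (h1 j).trans (le_of_mul_le_mul_left h2 (by linarith))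
  rw [Finset.mem_range, Nat.lt_succ_iff]
  exact Nat.le_floor h3

theorem prod_rpow_pow {n : ℕ} (θ : ℝ) (k : Fin n → ℕ) :
    ∏ j, ((2 : ℝ) ^ θ) ^ k j = 2 ^ (θ * ∑ j, (k j : ℝ)) := by
  rw [Finset.mul_sum, Real.rpow_sum_of_pos (by norm_num)]
  refine Finset.prod_congr rfl fun j _ => ?_
  rw [← Real.rpow_natCast, ← Real.rpow_mul (by norm_num)]

/-- Summation over coordinate `i` first, with the others frozen at `k'`. The set `A` of values of
that coordinate is known only through its members, which is all that the geometric bounds need. -/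
theorem sum_le_sum_removeNth {n : ℕ} (i : Fin (n + 1)) (S : Finset (Fin (n + 1) → ℕ))
    (F : ℕ → (Fin n → ℕ) → ℝ) (P : (Fin n → ℕ) → ℝ)
    (h : ∀ (k' : Fin n → ℕ) (A : Finset ℕ),
      (∀ a ∈ A, ∃ k ∈ S, k i = a ∧ i.removeNth k = k') → ∑ a ∈ A, F a k' ≤ P k') :
    ∑ k ∈ S, F (k i) (i.removeNth k) ≤ ∑ k' ∈ S.image i.removeNth, P k' := by
  classical
  rw [← Finset.sum_fiberwise_of_maps_to (g := i.removeNth) (t := S.image i.removeNth)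
    fun k hk => Finset.mem_image_of_mem _ hk]
  refine Finset.sum_le_sum fun k' _ => ?_
  have hinj : Set.InjOn (fun k : Fin (n + 1) → ℕ => k i)
      (S.filter fun k => i.removeNth k = k') := by
    intro k hk l hl hkl
    simp only [Finset.coe_filter, mem_ofPred_eq] at hk hl
    rw [← Fin.insertNth_self_removeNth i k, ← Fin.insertNth_self_removeNth i l, hk.2, hl.2]
    simp only at hkl
    rw [hkl]
  have e : ∑ k ∈ S.filter fun k => i.removeNth k = k', F (k i) (i.removeNth k) =
      ∑ a ∈ (S.filter fun k => i.removeNth k = k').image fun k => k i, F a k' := by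
    rw [Finset.sum_image hinj]
    exact Finset.sum_congr rfl fun k hk => by rw [(Finset.mem_filter.1 hk).2]
  rw [e]
  refine h k' _ fun a ha => ?_
  obtain ⟨k, hk, rfl⟩ := Finset.mem_image.1 ha
  exact ⟨k, (Finset.mem_filter.1 hk).1, rfl, (Finset.mem_filter.1 hk).2⟩

/-- The threshold `x` is real and of any sign, so later thresholds need no rounding. -/
theorem sum_pow_le_of_lt {r : ℝ} (h0 : 0 < r) (h1 : r < 1) {x : ℝ} (A : Finset ℕ)
    (hA : ∀ a ∈ A, x < a) : ∑ a ∈ A, r ^ a ≤ r ^ x / (1 - r) := by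
  have h1' : 0 < 1 - r := by linarith
  rcases A.eq_empty_or_nonempty with rfl | hne
  · rw [Finset.sum_empty]; positivity
  set a₀ := A.min' hne
  have hx : x < a₀ := hA _ (A.min'_mem hne)
  have hinj : Set.InjOn (fun a => a - a₀) (A : Set ℕ) := by
    intro a ha b hb hab
    have := A.min'_le a ha
    have := A.min'_le b hb
    simp only at hab
    omega
  calc ∑ a ∈ A, r ^ a = r ^ a₀ * ∑ a ∈ A, r ^ (a - a₀) := by
        rw [Finset.mul_sum]
        refine Finset.sum_congr rfl fun a ha => ?_
        rw [← pow_add]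
        congr 1
        have := A.min'_le a ha
        omega
    _ = r ^ a₀ * ∑ b ∈ A.image fun a => a - a₀, r ^ b := by rw [Finset.sum_image hinj]
    _ ≤ r ^ a₀ * (1 - r)⁻¹ := by
        gcongr
        rw [← tsum_geometric_of_lt_one h0.le h1]
        exact (summable_geometric_of_lt_one h0.le h1).sum_le_tsum _ fun _ _ => by positivity
    _ ≤ r ^ x * (1 - r)⁻¹ := by
        gcongr
        rw [← Real.rpow_natCast]
        exact Real.rpow_le_rpow_of_exponent_ge h0 h1.le hx.le
    _ = _ := by rw [div_eq_mul_inv]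

theorem sum_two_pow_le {x : ℝ} (A : Finset ℕ) (hA : ∀ a ∈ A, (a : ℝ) ≤ x) :
    ∑ a ∈ A, (2 : ℝ) ^ a ≤ 2 * 2 ^ x := by
  rcases A.eq_empty_or_nonempty with rfl | hne
  · rw [Finset.sum_empty]; positivity
  set a₀ := A.max' hne
  have hx : (a₀ : ℝ) ≤ x := hA _ (A.max'_mem hne)
  have hsub : A ⊆ Finset.range (a₀ + 1) := fun a ha => by
    rw [Finset.mem_range, Nat.lt_succ_iff]; exact A.le_max' a ha
  calc ∑ a ∈ A, (2 : ℝ) ^ a ≤ ∑ a ∈ Finset.range (a₀ + 1), (2 : ℝ) ^ a :=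
        Finset.sum_le_sum_of_subset_of_nonneg hsub fun _ _ _ => by positivity
    _ = 2 ^ (a₀ + 1) - 1 := by rw [geom_sum_eq (by norm_num)]; norm_num
    _ ≤ 2 * 2 ^ (a₀ : ℝ) := by rw [Real.rpow_natCast, pow_succ]; linarith
    _ ≤ _ := by gcongr; norm_num

/-- Off the sparse set the inequality fails for every coordinate, hence for the differentiated one:
`k i > m - β / (β - 1) * |k'|₁`. The geometric tail in `k i` leaves the ratio `2 ^ (-(β - α) / (β -
1))` per unit of `k'`, which is below 1 because `α < β`. -/
theorem sum_tail_le {n : ℕ} {α β : ℝ} (hα : 1 < α) (hβ : α < β) (m : ℝ) (i : Fin (n + 1))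
    (S : Finset (Fin (n + 1) → ℕ)) (hS : ∀ k ∈ S, k ∉ sparseSet (n + 1) β m) :
    ∑ k ∈ S, (∏ j, ((2 : ℝ) ^ (-α)) ^ k j) * 2 ^ k i ≤
      2 ^ (-((α - 1) * m)) / (1 - 2 ^ (1 - α)) * (qAB α β)⁻¹ ^ n := by
  classical
  have hβ1 : 0 < β - 1 := by linarith
  have hr1 : (2 : ℝ) ^ (1 - α) < 1 := Real.rpow_lt_one_of_one_lt_of_neg (by norm_num) (by linarith)
  have hθ : 0 < (β - α) / (β - 1) := div_pos (by linarith) hβ1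
  have hq1 : (2 : ℝ) ^ (-((β - α) / (β - 1))) < 1 :=
    Real.rpow_lt_one_of_one_lt_of_neg (by norm_num) (by linarith)
  have hγ : (0 : ℝ) < 1 - 2 ^ (1 - α) := by linarith
  set F : ℕ → (Fin n → ℕ) → ℝ := fun a k' =>
    ((2 : ℝ) ^ (1 - α)) ^ a * 2 ^ (-α * ∑ j, (k' j : ℝ)) with hF
  have e1 : ∀ k : Fin (n + 1) → ℕ, (∏ j, ((2 : ℝ) ^ (-α)) ^ k j) * 2 ^ k i =
      F (k i) (i.removeNth k) := by
    intro k
    rw [hF]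
    simp only
    rw [prod_rpow_pow, Fin.sum_univ_succAbove _ i, ← Real.rpow_natCast, ← Real.rpow_natCast,
      ← Real.rpow_mul (by norm_num), ← Real.rpow_add (by norm_num), ← Real.rpow_add (by norm_num)]
    congr 1
    simp only [Fin.removeNth]
    ring
  rw [Finset.sum_congr rfl fun k _ => e1 k]
  refine (sum_le_sum_removeNth i S F (fun k' => 2 ^ (-((α - 1) * m)) / (1 - 2 ^ (1 - α)) *
    ∏ j, ((2 : ℝ) ^ (-((β - α) / (β - 1)))) ^ k' j) ?_).trans ?_
  · intro k' A hA
    set x := m - β / (β - 1) * ∑ j, (k' j : ℝ) with hx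
    have hAx : ∀ a ∈ A, x < a := by
      intro a ha
      obtain ⟨k, hk, rfl, rfl⟩ := hA a ha
      have h := hS k hk
      simp only [sparseSet, mem_ofPred_eq, not_exists, not_le] at h
      have h := h i
      rw [Fin.sum_univ_succAbove _ i] at h
      rw [hx, sub_lt_iff_lt_add, ← sub_lt_iff_lt_add', div_mul_eq_mul_div, lt_div_iff₀ hβ1]
      simp only [Fin.removeNth]
      nlinarith
    simp only [hF]
    rw [← Finset.sum_mul, prod_rpow_pow]
    calc _ ≤ ((2 : ℝ) ^ (1 - α)) ^ x / (1 - 2 ^ (1 - α)) * 2 ^ (-α * ∑ j, (k' j : ℝ)) := by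
          gcongr
          exact sum_pow_le_of_lt (by positivity) hr1 A hAx
      _ = (2 : ℝ) ^ ((1 - α) * x + -α * ∑ j, (k' j : ℝ)) / (1 - 2 ^ (1 - α)) := by
          rw [← Real.rpow_mul (by norm_num), Real.rpow_add (by norm_num)]; ring
      _ = (2 : ℝ) ^ (-((α - 1) * m) + -((β - α) / (β - 1)) * ∑ j, (k' j : ℝ)) /
          (1 - 2 ^ (1 - α)) := by
          congr 2
          rw [hx]
          field_simp
          ring
      _ = _ := by rw [Real.rpow_add (by norm_num)]; ring
      _ ≤ _ := le_rfl
  · rw [← Finset.mul_sum, qAB]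
    gcongr
    exact sum_prod_pow_le (by positivity) hq1 _

/-- The set is a union of `n + 1` pieces, one per coordinate. In piece `i` the sum over `k i` is
dominated by its largest term, and what remains decays like `2 ^ (-|k'|₁ / (β - 1))`. So no power of
`m` appears. -/
theorem sum_two_pow_sparseSet_le {n : ℕ} {β : ℝ} (hβ : 1 < β) (m : ℝ)
    (S : Finset (Fin (n + 1) → ℕ)) (hS : ∀ k ∈ S, k ∈ sparseSet (n + 1) β m) :
    ∑ k ∈ S, ∏ j, (2 : ℝ) ^ k j ≤
      (n + 1) * (2 * 2 ^ m * ((1 - (2 : ℝ) ^ (-(1 / (β - 1))))⁻¹) ^ n) := by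
  classical
  have hβ1 : 0 < β - 1 := by linarith
  have hθ : 0 < 1 / (β - 1) := by positivity
  have hb1 : (2 : ℝ) ^ (-(1 / (β - 1))) < 1 :=
    Real.rpow_lt_one_of_one_lt_of_neg (by norm_num) (by linarith)
  set T : Fin (n + 1) → Finset (Fin (n + 1) → ℕ) := fun i =>
    S.filter fun k => β * ∑ j, (k j : ℝ) - k i ≤ (β - 1) * m with hT
  have h1 : ∀ i, ∑ k ∈ T i, ∏ j, (2 : ℝ) ^ k j ≤
      2 * 2 ^ m * ((1 - (2 : ℝ) ^ (-(1 / (β - 1))))⁻¹) ^ n := by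
    intro i
    set F : ℕ → (Fin n → ℕ) → ℝ := fun a k' => 2 ^ a * 2 ^ (∑ j, (k' j : ℝ)) with hF
    have e1 : ∀ k : Fin (n + 1) → ℕ, ∏ j, (2 : ℝ) ^ k j = F (k i) (i.removeNth k) := by
      intro k
      simp only [hF]
      rw [Fin.prod_univ_succAbove _ i]
      congr 1
      have := prod_rpow_pow 1 (i.removeNth k)
      rw [Real.rpow_one, one_mul] at this
      rw [← this]
      rfl
    rw [Finset.sum_congr rfl fun k _ => e1 k]
    refine (sum_le_sum_removeNth i (T i) F (fun k' => 2 * 2 ^ m *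
      ∏ j, ((2 : ℝ) ^ (-(1 / (β - 1)))) ^ k' j) ?_).trans ?_
    · intro k' A hA
      set x := m - β / (β - 1) * ∑ j, (k' j : ℝ) with hx
      have hAx : ∀ a ∈ A, (a : ℝ) ≤ x := by
        intro a ha
        obtain ⟨k, hk, rfl, rfl⟩ := hA a ha
        have h := (Finset.mem_filter.1 hk).2
        rw [Fin.sum_univ_succAbove _ i] at h
        rw [hx, le_sub_iff_add_le, ← le_sub_iff_add_le', div_mul_eq_mul_div, div_le_iff₀ hβ1]
        simp only [Fin.removeNth]
        nlinarith
      simp only [hF]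
      rw [← Finset.sum_mul, prod_rpow_pow]
      calc _ ≤ 2 * 2 ^ x * (2 : ℝ) ^ (∑ j, (k' j : ℝ)) := by
            gcongr
            exact sum_two_pow_le A hAx
        _ = 2 * (2 : ℝ) ^ (x + ∑ j, (k' j : ℝ)) := by rw [Real.rpow_add (by norm_num)]; ring
        _ = 2 * (2 : ℝ) ^ (m + -(1 / (β - 1)) * ∑ j, (k' j : ℝ)) := by
            congr 2
            rw [hx]
            field_simp
            ring
        _ = _ := by rw [Real.rpow_add (by norm_num)]; ring
        _ ≤ _ := le_rfl
    · rw [← Finset.mul_sum]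
      gcongr
      exact sum_prod_pow_le (by positivity) hb1 _
  calc _ ≤ ∑ k ∈ S, ∑ i, if β * ∑ j, (k j : ℝ) - k i ≤ (β - 1) * m then ∏ j, (2 : ℝ) ^ k j else 0 := by
        refine Finset.sum_le_sum fun k hk => ?_
        obtain ⟨i, hi⟩ := hS k hk
        refine le_of_eq_of_le (if_pos hi).symm (Finset.single_le_sum (f := fun i =>
          if β * ∑ j, (k j : ℝ) - k i ≤ (β - 1) * m then ∏ j, (2 : ℝ) ^ k j else 0)
          (fun i _ => ?_) (Finset.mem_univ i))
        positivity
    _ = ∑ i, ∑ k ∈ T i, ∏ j, (2 : ℝ) ^ k j := by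
        rw [Finset.sum_comm]
        exact Finset.sum_congr rfl fun i _ => (Finset.sum_filter _ _).symm
    _ ≤ ∑ _i : Fin (n + 1), 2 * 2 ^ m * ((1 - (2 : ℝ) ^ (-(1 / (β - 1))))⁻¹) ^ n :=
        Finset.sum_le_sum fun i _ => h1 i
    _ = _ := by simp

/-! ### Approximation by networks, with free parameters -/

theorem card_positions {d : ℕ} (k : Fin d → ℕ) : (positions k).card = ∏ j, 2 ^ k j := by
  simp [positions, Fintype.card_piFinset]

/-- A cruder weight without distinguished direction. It suffices for summability and for the product
error, where `R` compensates the constant `(1 - 2 ^ (1 - α)) ^ (-d)`. -/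
theorem prod_rpow_mul_pow_le {d : ℕ} (α : ℝ) (k : Fin d → ℕ) (i : Fin d) :
    (∏ j, ((2 : ℝ) ^ (-α)) ^ k j) * 2 ^ k i ≤ ∏ j, ((2 : ℝ) ^ (1 - α)) ^ k j := by
  have e : ∀ j, ((2 : ℝ) ^ (1 - α)) ^ k j = ((2 : ℝ) ^ (-α)) ^ k j * 2 ^ k j := by
    intro j
    rw [show 1 - α = -α + 1 by ring, Real.rpow_add (by norm_num), Real.rpow_one, mul_pow]
  simp only [e, Finset.prod_mul_distrib]
  gcongr
  have h1 : ∀ j, (1 : ℝ) ≤ 2 ^ k j := fun j => one_le_pow₀ (by norm_num)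
  rw [← Finset.mul_prod_erase _ _ (Finset.mem_univ i)]
  refine le_mul_of_one_le_right (by positivity) ?_
  calc (1 : ℝ) = ∏ j ∈ Finset.univ.erase i, 1 := by simp
    _ ≤ _ := Finset.prod_le_prod (fun _ _ => zero_le_one) fun j _ => h1 j

/-- The error is a series with terms `faberLevel - approxLevel` on the sparse set and `faberLevel`
off it. The second group, governed by `m`, is measured in `L_p` and gains the factors `cP p`; the
first, governed by `R`, is measured in the sup norm. -/
theorem exists_architecture_approx {n : ℕ} {α β : ℝ} (hα : 1 < α) (hβ : α < β) {p : ℝ≥0∞}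
    (hp : 1 ≤ p) {J R : ℕ} (hJ : n + 1 ≤ 2 ^ J) (hR : 1 ≤ R) (m : ℝ) :
    ∃ (S : NetShape (n + 1)) (A : NeuralNet S), A.IsArchitecture ∧ A.depth = J * (R + 1) + 2 ∧
      (A.size : ℝ) ≤ ((n + 1) * (2 * 2 ^ m * ((1 - (2 : ℝ) ^ (-(1 / (β - 1))))⁻¹) ^ n)) *
        (2 ^ J * 9) * (3 + 19 * (J * (R + 1))) ∧
      ∀ f ∈ holderBall (n + 1) α, ∃ Φ : NeuralNet S, Φ.HasArchitecture A ∧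
        MemSobolevZero p (fun x => f x - Φ.output x) ∧
        sobolevNorm p (fun x => f x - Φ.output x) ≤ ENNReal.ofReal ((n + 1) *
          (4 * ((2 : ℝ) ^ (-(α + 1))) ^ (n + 1) * ((cP p)⁻¹ ^ n *
            (2 ^ (-((α - 1) * m)) / (1 - 2 ^ (1 - α)) * (qAB α β)⁻¹ ^ n) +
            4 ^ J * (2 * (2 ^ R)⁻¹) * ((1 - (2 : ℝ) ^ (1 - α))⁻¹) ^ (n + 1)))) := by
  classical
  set L : ℝ := ((2 : ℝ) ^ (-(α + 1))) ^ (n + 1) with hL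
  set e : ℝ := 4 ^ J * (2 * (2 ^ R)⁻¹) with he
  have hL0 : 0 ≤ L := by positivity
  have he0 : 0 ≤ e := by positivity
  have hcP : 0 < cP p := cP_pos
  have hr1 : (2 : ℝ) ^ (1 - α) < 1 := Real.rpow_lt_one_of_one_lt_of_neg (by norm_num) (by linarith)
  have hβ1 : 1 < β := by linarith
  set Δ : Finset (Fin (n + 1) → ℕ) := (sparseSet_finite (d := n + 1) hβ1 m).toFinset with hΔ
  set w : (Fin (n + 1) → ℕ) → Fin (n + 1) → ℝ := fun k i =>
    (∏ j, ((2 : ℝ) ^ (-α)) ^ k j) * 2 ^ k i with hw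
  have hw0 : ∀ k i, 0 ≤ w k i := fun k i => by simp only [hw]; positivity
  set K := {κ // κ ∈ Δ.sigma fun k => positions k}
  obtain ⟨S, A, h1, h2, h3, h4⟩ := exists_architecture_hats (K := K) J R
    (fun κ => κ.1.1) (fun κ => κ.1.2)
  refine ⟨S, A, h1, h2, ?_, fun f hf => ?_⟩
  · have hK : (Fintype.card K : ℝ) ≤
        (n + 1) * (2 * 2 ^ m * ((1 - (2 : ℝ) ^ (-(1 / (β - 1))))⁻¹) ^ n) := by
      refine le_trans (le_of_eq ?_) (sum_two_pow_sparseSet_le hβ1 m Δ fun k hk => by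
        simpa [hΔ] using hk)
      rw [Fintype.card_coe, Finset.card_sigma]
      push_cast [card_positions]
      rfl
    calc (A.size : ℝ) ≤ ((Fintype.card K * (2 ^ J * 9) * (3 + 19 * (J * (R + 1))) : ℕ) : ℝ) := by
          exact_mod_cast h3
      _ = Fintype.card K * (2 ^ J * 9) * (3 + 19 * (J * (R + 1))) := by push_cast; ring
      _ ≤ _ := by gcongr
  · obtain ⟨Φ, hΦ, hout⟩ := h4 fun κ => faberCoeff f κ.1.1 κ.1.2
    have hout' : ∀ x, Φ.output x = ∑ k ∈ Δ, approxLevel J R f k x := by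
      intro x
      rw [hout, Finset.sum_coe_sort (Δ.sigma fun k => positions k)
        (fun κ => faberCoeff f κ.1 κ.2 * treeApprox R (hatVec κ.1 κ.2 x) J 0), Finset.sum_sigma]
      rfl
    have hcoef : ∀ k : Fin (n + 1) → ℕ, ∀ s ∈ positions k,
        |faberCoeff f k s| ≤ L * ∏ j, ((2 : ℝ) ^ (-α)) ^ k j := fun k s hs =>
      abs_faberCoeff_le hf.2.2 hs
    have hΛ0 : ∀ k : Fin (n + 1) → ℕ, 0 ≤ L * ∏ j, ((2 : ℝ) ^ (-α)) ^ k j := fun k => by positivity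
    set c : (Fin (n + 1) → ℕ) → (Fin (n + 1) → ℝ) → ℝ := fun k =>
      if k ∈ Δ then fun x => faberLevel f k x - approxLevel J R f k x else faberLevel f k with hc
    have cin : ∀ {k}, k ∈ Δ → c k = fun x => faberLevel f k x - approxLevel J R f k x :=
      fun hk => if_pos hk
    have cout : ∀ {k}, k ∉ Δ → c k = faberLevel f k := fun hk => if_neg hk
    have lipIn : ∀ {k}, k ∈ Δ → ∀ i x t, |c k (Function.update x i t) - c k x| ≤
        4 * L * e * w k i * |t - x i| := by
      intro k hk i x t
      rw [cin hk]
      refine (abs_approx_error_update_sub_le hJ hR (hcoef k) (hΛ0 k) i x t).trans (le_of_eq ?_)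
      simp only [hw, he]; ring
    have lipOut : ∀ {k}, k ∉ Δ → ∀ i x t, |c k (Function.update x i t) - c k x| ≤
        4 * L * w k i * |t - x i| := by
      intro k hk i x t
      rw [cout hk]
      refine (abs_faberLevel_update_sub_le (hcoef k) (hΛ0 k) i x t).trans ?_
      have hle : ∏ j ∈ Finset.univ.erase i, hatSum (k j) (x j) ≤ 1 :=
        Finset.prod_le_one (fun j _ => hatSum_nonneg _ _) fun j _ => hatSum_le_one _ _
      calc _ ≤ (L * ∏ j, ((2 : ℝ) ^ (-α)) ^ k j) * (4 * 2 ^ k i) * 1 * |t - x i| := by gcongr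
        _ = _ := by simp only [hw]; ring
    have hsum : ∀ i, Summable fun k : Fin (n + 1) → ℕ => w k i := fun i =>
      Summable.of_nonneg_of_le (fun k => hw0 k i) (fun k => prod_rpow_mul_pow_le α k i)
        (summable_prod_pow (by positivity) hr1)
    -- `C` is common to both kinds of levels and serves only for summability; the sharp bounds enter
    -- through `E`.
    have main := sobolev_of_hasSum (d := n + 1) (c := c)
      (C := fun k i => 4 * L * (1 + e) * w k i) (by omega) hp
      (fun k i => mul_nonneg (by positivity) (hw0 k i))
      (fun k i x t => ?_) (fun k x hx => ?_) (fun i => (hsum i).mul_left _)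
      (g := fun x => f x - Φ.output x) (fun x hx => ?_)
      (E := ENNReal.ofReal (4 * L * ((cP p)⁻¹ ^ n *
            (2 ^ (-((α - 1) * m)) / (1 - 2 ^ (1 - α)) * (qAB α β)⁻¹ ^ n) +
            e * ((1 - (2 : ℝ) ^ (1 - α))⁻¹) ^ (n + 1)))) (fun i => ?_)
    · refine ⟨Φ, hΦ, main.1, main.2.trans (le_of_eq ?_)⟩
      rw [← ENNReal.ofReal_natCast, ← ENNReal.ofReal_mul (Nat.cast_nonneg _)]
      push_cast
      rfl
    · by_cases hk : k ∈ Δ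
      · refine (lipIn hk i x t).trans ?_
        have := hw0 k i
        gcongr
        linarith
      · refine (lipOut hk i x t).trans ?_
        have := mul_nonneg (mul_nonneg hL0 he0) (hw0 k i)
        gcongr ?_ * _
        nlinarith
    · by_cases hk : k ∈ Δ
      · rw [cin hk]
        simp only [faberLevel_eq_zero f k hx, approxLevel_eq_zero hJ R f k hx, sub_zero]
      · rw [cout hk, faberLevel_eq_zero f k hx]
    · have s1 := hasSum_faberLevel (by linarith) hf hx
      have s2 : HasSum (fun k => if k ∈ Δ then approxLevel J R f k x else 0) (Φ.output x) := by
        rw [hout' x]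
        have := hasSum_sum_of_ne_finset_zero (s := Δ) (L := .unconditional _)
          (f := fun k => if k ∈ Δ then approxLevel J R f k x else 0) fun k hk => if_neg hk
        rwa [Finset.sum_congr rfl fun k hk => if_pos hk] at this
      have s3 := s1.sub s2
      have ec : (fun k => faberLevel f k x - if k ∈ Δ then approxLevel J R f k x else 0) =
          fun k => c k x := by
        funext k
        by_cases hk : k ∈ Δ
        · rw [cin hk, if_pos hk]
        · rw [cout hk, if_neg hk, sub_zero]
      rwa [ec] at s3
    · rw [ENNReal.tsum_eq_iSup_sum]
      refine iSup_le fun T => ?_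
      rw [← Finset.sum_filter_add_sum_filter_not T (· ∈ Δ), mul_add, add_comm,
        ENNReal.ofReal_add]
      · refine add_le_add ?_ ?_
        · calc _ ≤ ∑ k ∈ T.filter (· ∉ Δ), ENNReal.ofReal (4 * L * (cP p)⁻¹ ^ n * w k i) := by
                refine Finset.sum_le_sum fun k hk => ?_
                rw [cout (Finset.mem_filter.1 hk).2]
                refine (eLpNorm_lineDeriv_faberLevel_le (hcoef k) (hΛ0 k) i hp).trans
                  (ENNReal.ofReal_le_ofReal (le_of_eq ?_))
                simp only [hw, Nat.add_sub_cancel]; ring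
            _ = ENNReal.ofReal (4 * L * (cP p)⁻¹ ^ n * ∑ k ∈ T.filter (· ∉ Δ), w k i) := by
                rw [← ENNReal.ofReal_sum_of_nonneg, Finset.mul_sum]
                intro k _
                exact mul_nonneg (by positivity) (hw0 k i)
            _ ≤ _ := by
                refine ENNReal.ofReal_le_ofReal ?_
                rw [← mul_assoc]
                refine mul_le_mul_of_nonneg_left ?_ (by positivity)
                exact sum_tail_le hα hβ m i _ fun k hk => by
                  simpa [hΔ] using (Finset.mem_filter.1 hk).2
        · calc _ ≤ ∑ k ∈ T.filter (· ∈ Δ), ENNReal.ofReal (4 * L * e * w k i) := by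
                refine Finset.sum_le_sum fun k hk => ?_
                have hb := eLpNorm_le_of_ae_bound (p := p)
                  (μ := volume.restrict (unitCube (n + 1))) (C := 4 * L * e * w k i)
                  (f := fun x => lineDeriv ℝ (c k) x (Pi.single i 1))
                  (Filter.Eventually.of_forall fun x =>
                    abs_lineDeriv_single_le (mul_nonneg (by positivity) (hw0 k i))
                      (lipIn (Finset.mem_filter.1 hk).2 i x))
                simpa using hb
            _ = ENNReal.ofReal (4 * L * e * ∑ k ∈ T.filter (· ∈ Δ), w k i) := by
                rw [← ENNReal.ofReal_sum_of_nonneg, Finset.mul_sum]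
                intro k _
                exact mul_nonneg (by positivity) (hw0 k i)
            _ ≤ _ := by
                refine ENNReal.ofReal_le_ofReal ?_
                rw [← mul_assoc (4 * L) e]
                refine mul_le_mul_of_nonneg_left ?_ (by positivity)
                exact (Finset.sum_le_sum fun k _ => prod_rpow_mul_pow_le α k i).trans
                  (sum_prod_pow_le (by positivity : (0 : ℝ) ≤ 2 ^ (1 - α)) hr1 _)
      · have hθ : 0 < (β - α) / (β - 1) := div_pos (by linarith) (by linarith)
        have hq : 0 < qAB α β := by
          rw [qAB, sub_pos]
          exact Real.rpow_lt_one_of_one_lt_of_neg (by norm_num) (by linarith)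
        have : (0 : ℝ) < 1 - 2 ^ (1 - α) := by linarith
        positivity
      · have : (0 : ℝ) < 1 - 2 ^ (1 - α) := by linarith
        positivity

/-! ### Choice of the parameters -/

theorem qAB_pos {α β : ℝ} (hα : 1 < α) (hβ : α < β) : 0 < qAB α β := by
  have hθ : 0 < (β - α) / (β - 1) := div_pos (by linarith) (by linarith)
  rw [qAB, sub_pos]
  exact Real.rpow_lt_one_of_one_lt_of_neg (by norm_num) (by linarith)

theorem logb_two_natCast_le (d : ℕ) (hd : 1 ≤ d) : Real.logb 2 d ≤ d := by
  have h : (d : ℝ) ≤ 2 ^ (d : ℝ) := by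
    rw [Real.rpow_natCast]
    exact_mod_cast (Nat.lt_two_pow_self (n := d)).le
  exact (Real.logb_le_iff_le_rpow (by norm_num) (by exact_mod_cast hd)).2 h

/-- Since `d ≤ 2 ^ d`, the threshold gives `2 ^ ((α - 1) * d) * γ * ε < 1`. The dimension is then of
order `log ε⁻¹` at most, which lets `R` absorb factors exponential in `d`. -/
theorem mul_dim_le_logb {α γ ε : ℝ} {d : ℕ} (hγ : 0 < γ) (hε : 0 < ε)
    (h : ε < d / (2 ^ (α * d) * γ)) :
    (α - 1) * d ≤ Real.logb 2 ε⁻¹ + Real.logb 2 γ⁻¹ := by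
  have hd : (d : ℝ) ≤ 2 ^ (d : ℝ) := by
    rw [Real.rpow_natCast]
    exact_mod_cast (Nat.lt_two_pow_self (n := d)).le
  rw [← Real.logb_mul (by positivity) (by positivity),
    Real.le_logb_iff_rpow_le (by norm_num) (by positivity), sub_mul, one_mul,
    Real.rpow_sub (by norm_num), ← mul_inv, div_le_iff₀ (by positivity), inv_mul_eq_div,
    le_div_iff₀ (by positivity)]
  rw [lt_div_iff₀ (by positivity)] at h
  nlinarith

theorem exists_two_pow_between {d : ℕ} (hd : 2 ≤ d) :
    ∃ J : ℕ, d ≤ 2 ^ J ∧ (2 : ℝ) ^ J ≤ 2 * d ∧ (J : ℝ) ≤ 2 * Real.logb 2 d := by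
  refine ⟨Nat.clog 2 d, Nat.le_pow_clog (by norm_num) d, ?_, ?_⟩
  all_goals
    have h := Nat.pow_pred_clog_lt_self (b := 2) (by norm_num) (x := d) (by omega)
    have hpos : 0 < Nat.clog 2 d := Nat.clog_pos (by norm_num) hd
    obtain ⟨j, hj⟩ : ∃ j, Nat.clog 2 d = j + 1 := ⟨Nat.clog 2 d - 1, by omega⟩
    rw [hj, Nat.pred_succ] at h
    rw [hj]
    have h' : (2 : ℝ) ^ j ≤ d := by exact_mod_cast h.le
  · rw [pow_succ]; linarith
  · have h1 : (j : ℝ) ≤ Real.logb 2 d := by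
      rw [Real.le_logb_iff_rpow_le (by norm_num) (by positivity), Real.rpow_natCast]
      exact h'
    have h2 : 1 ≤ Real.logb 2 d := by
      rw [Real.le_logb_iff_rpow_le (by norm_num) (by positivity), Real.rpow_one]
      exact_mod_cast hd
    push_cast
    linarith

/-- The `d`-th power cancels the `1 / d` in the exponent: the denominator inside `baseB` becomes a
polynomial factor in `d`. -/
theorem baseB_zpow_neg {α β : ℝ} {p : ℝ≥0∞} (hα : 1 < α) (hβ : α < β) {d : ℕ} (hd : 1 ≤ d) :
    baseB d α β p ^ (-(d : ℤ)) = ((1 - (2 : ℝ) ^ (-(1 / (β - 1)))) ^ d)⁻¹ *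
      (((cP p * 2 ^ (α + 1) * qAB α β) ^ d)⁻¹) ^ (1 / (α - 1)) *
        (d : ℝ) ^ (2 * α * (1 / (α - 1))) := by
  have hq := qAB_pos hα hβ
  have hc : 0 < cP p := cP_pos
  have hd0 : (0 : ℝ) < d := by exact_mod_cast hd
  have hG : 0 < cP p * 2 ^ (α + 1) * qAB α β := by positivity
  have e1 : (((d : ℝ) ^ (2 * α / d)) ^ d) = (d : ℝ) ^ (2 * α) := by
    rw [← Real.rpow_mul_natCast hd0.le, div_mul_cancel₀ _ hd0.ne']
  have e2 : ((cP p * 2 ^ (α + 1) * qAB α β / (d : ℝ) ^ (2 * α / d)) ^ (1 / (α - 1))) ^ d =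
      ((cP p * 2 ^ (α + 1) * qAB α β) ^ d) ^ (1 / (α - 1)) / (d : ℝ) ^ (2 * α * (1 / (α - 1))) := by
    rw [Real.rpow_mul hd0.le, ← e1, ← Real.div_rpow (by positivity) (by positivity), ← div_pow,
      Real.rpow_pow_comm (by positivity)]
  rw [zpow_neg, zpow_natCast, baseB, mul_pow, e2, Real.inv_rpow (by positivity)]
  rw [mul_inv, inv_div, div_eq_mul_inv]
  ring

/-- The truncation parameter `X = 2^{(α-1) m}` is chosen such that the truncation error is
`ε / 2`; this is its contribution to the size. -/
theorem pow_three_mul_rpow_le {α β ε : ℝ} {p : ℝ≥0∞} (hα : 1 < α) (hα₂ : α ≤ 2) (hβ : α < β)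
    (hε : 0 < ε) (n : ℕ) :
    ((n : ℝ) + 1) ^ 3 * (8 * (n + 1) * ((2 : ℝ) ^ (-(α + 1))) ^ (n + 1) * ((cP p)⁻¹ ^ n *
        (qAB α β)⁻¹ ^ n) / ((1 - 2 ^ (1 - α)) * ε)) ^ (1 / (α - 1)) *
        ((1 - (2 : ℝ) ^ (-(1 / (β - 1))))⁻¹) ^ n ≤
      (8 * cP p * qAB α β / (1 - 2 ^ (1 - α))) ^ (1 / (α - 1)) *
        baseB (n + 1) α β p ^ (-((n + 1 : ℕ) : ℤ)) * ε⁻¹ ^ (1 / (α - 1)) := by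
  have hq := qAB_pos hα hβ
  have hc : 0 < cP p := cP_pos
  have hγ : (0 : ℝ) < 1 - 2 ^ (1 - α) :=
    sub_pos.2 (Real.rpow_lt_one_of_one_lt_of_neg (by norm_num) (by linarith))
  have hβ' : 0 < 1 / (β - 1) := one_div_pos.2 (by linarith)
  have hb : (0 : ℝ) < 1 - 2 ^ (-(1 / (β - 1))) :=
    sub_pos.2 (Real.rpow_lt_one_of_one_lt_of_neg (by norm_num) (by linarith))
  have hb1 : 1 - (2 : ℝ) ^ (-(1 / (β - 1))) ≤ 1 := by
    have : (0 : ℝ) < 2 ^ (-(1 / (β - 1))) := by positivity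
    linarith
  set u := 1 / (α - 1) with hu
  set γ := 1 - (2 : ℝ) ^ (1 - α)
  set b := 1 - (2 : ℝ) ^ (-(1 / (β - 1)))
  have hu0 : 0 < u := one_div_pos.2 (by linarith)
  have hun : u * (α - 1) = 1 := one_div_mul_cancel (by linarith)
  have hX : 8 * ((n : ℝ) + 1) * ((2 : ℝ) ^ (-(α + 1))) ^ (n + 1) * ((cP p)⁻¹ ^ n *
      (qAB α β)⁻¹ ^ n) / (γ * ε) = (8 * cP p * qAB α β / γ) * (n + 1) *
        (((cP p * 2 ^ (α + 1) * qAB α β) ^ (n + 1))⁻¹) * ε⁻¹ := by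
    rw [Real.rpow_neg (by norm_num), mul_pow, mul_pow, pow_succ (cP p), pow_succ (qAB α β)]
    simp only [inv_pow]
    field_simp
  have hd : (0 : ℝ) < n + 1 := by positivity
  rw [hX, baseB_zpow_neg hα hβ (by omega), Real.mul_rpow (by positivity) (by positivity),
    Real.mul_rpow (by positivity) (by positivity), Real.mul_rpow (by positivity) (by positivity)]
  push_cast
  -- The exponents satisfy `3 + u ≤ 2 * α * u`: as `α * u = 1 + u`, this says `1 ≤ u`, that is `α ≤
  -- 2`. So `baseB` absorbs all powers of `d`.
  have h3 : ((n : ℝ) + 1) ^ 3 * (n + 1) ^ u ≤ (n + 1) ^ (2 * α * u) := by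
    rw [← Real.rpow_natCast, ← Real.rpow_add hd]
    refine Real.rpow_le_rpow_of_exponent_le (by linarith [n.cast_nonneg (α := ℝ)]) ?_
    push_cast
    nlinarith
  have h4 : b⁻¹ ^ n ≤ (b ^ (n + 1))⁻¹ := by
    rw [← inv_pow]
    exact pow_le_pow_right₀ ((one_le_inv₀ hb).2 hb1) (by omega)
  set Y := ((cP p * 2 ^ (α + 1) * qAB α β) ^ (n + 1))⁻¹ ^ u
  have hY : 0 ≤ Y := by positivity
  calc _ = ((8 * cP p * qAB α β / γ) ^ u * Y * ε⁻¹ ^ u) *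
        ((((n : ℝ) + 1) ^ 3 * (n + 1) ^ u) * b⁻¹ ^ n) := by ring
    _ ≤ ((8 * cP p * qAB α β / γ) ^ u * Y * ε⁻¹ ^ u) *
        ((n + 1) ^ (2 * α * u) * (b ^ (n + 1))⁻¹) := by gcongr
    _ = _ := by ring

/-- `R` is a rounded logarithm. Its terms `3 * log d` and `d * η` are of order `d ≤ c₁ * M`. The 9
consists of 6 for `log 64`, 2 for rounding and the added 1, and 1 for `log ε⁻¹`. -/
theorem exists_accuracy {η c₁ M ε γ : ℝ} {d : ℕ} (hd : 1 ≤ d) (hγ : 0 < γ) (hγ1 : γ ≤ 1)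
    (hη : η = Real.logb 2 γ⁻¹) (hM : 1 ≤ M) (hMε : Real.logb 2 ε⁻¹ ≤ M) (hε : 0 < ε) (hε1 : ε < 1)
    (hdM : d ≤ c₁ * M) :
    ∃ R : ℕ, 1 ≤ R ∧ (R : ℝ) + 1 ≤ (9 + (3 + η) * c₁) * M ∧
      64 * (d : ℝ) ^ 3 * γ⁻¹ ^ d * (2 ^ R)⁻¹ ≤ ε := by
  have hd1 : (1 : ℝ) ≤ d := by exact_mod_cast hd
  have hγi : 1 ≤ γ⁻¹ := (one_le_inv₀ hγ).2 hγ1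
  have hη0 : 0 ≤ η := hη ▸ Real.logb_nonneg (by norm_num) hγi
  have hX : 0 < 64 * (d : ℝ) ^ 3 * γ⁻¹ ^ d * ε⁻¹ := by positivity
  have hlog : Real.logb 2 (64 * (d : ℝ) ^ 3 * γ⁻¹ ^ d * ε⁻¹) =
      6 + 3 * Real.logb 2 d + d * η + Real.logb 2 ε⁻¹ := by
    rw [Real.logb_mul (by positivity) (by positivity), Real.logb_mul (by positivity)
      (by positivity), Real.logb_mul (by positivity) (by positivity), Real.logb_pow,
      Real.logb_pow, hη, show (64 : ℝ) = 2 ^ (6 : ℝ) by norm_num, Real.logb_rpow (by norm_num)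
      (by norm_num)]
    push_cast
    ring
  have hl0 : 0 ≤ Real.logb 2 (d : ℝ) := Real.logb_nonneg (by norm_num) hd1
  have hε0 : 0 ≤ Real.logb 2 ε⁻¹ := Real.logb_nonneg (by norm_num) ((one_le_inv₀ hε).2 hε1.le)
  have hld := logb_two_natCast_le d hd
  have hdη : 0 ≤ d * η := by positivity
  set ρ := Real.logb 2 (64 * (d : ℝ) ^ 3 * γ⁻¹ ^ d * ε⁻¹) with hρ
  refine ⟨⌈ρ⌉₊, ?_, ?_, ?_⟩
  · exact Nat.one_le_ceil_iff.2 (by linarith)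
  · have := Nat.ceil_lt_add_one (a := ρ) (by linarith)
    nlinarith
  · have h1 : 64 * (d : ℝ) ^ 3 * γ⁻¹ ^ d * ε⁻¹ ≤ 2 ^ ⌈ρ⌉₊ := by
      rw [← Real.rpow_natCast 2, ← Real.logb_le_iff_le_rpow (by norm_num) hX]
      exact Nat.le_ceil _
    rw [← div_eq_mul_inv, div_le_iff₀ hε] at h1
    rw [← div_eq_mul_inv, div_le_iff₀ (by positivity), mul_comm ε]
    exact h1

theorem exists_approximating_architecture {α : ℝ} (hα : 1 < α) (hα₂ : α ≤ 2) :
    ∃ K₂ : ℝ, 0 < K₂ ∧ ∀ (β : ℝ) (p : ℝ≥0∞), α < β → 1 ≤ p →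
      ∃ K₃ : ℝ, 0 < K₃ ∧ ∀ d : ℕ, 2 ≤ d → ∀ ε : ℝ, 0 < ε → ε < eps0 d α β p →
        ∃ (S : NetShape d) (A : NeuralNet S), A.IsArchitecture ∧
          (∀ f ∈ holderBall d α, ∃ Φ : NeuralNet S, Φ.HasArchitecture A ∧
            MemSobolevZero p (fun x => f x - Φ.output x) ∧
            sobolevNorm p (fun x => f x - Φ.output x) ≤ ENNReal.ofReal ε) ∧
          (A.depth : ℝ) ≤ K₂ * Real.logb 2 d * max 1 (Real.logb 2 ε⁻¹) ∧
          (A.size : ℝ) ≤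
            K₃ * baseB d α β p ^ (-(d : ℤ)) * ε⁻¹ ^ (1 / (α - 1)) *
              max 1 (Real.logb 2 ε⁻¹) := by
  have hγ : (0 : ℝ) < 1 - 2 ^ (1 - α) :=
    sub_pos.2 (Real.rpow_lt_one_of_one_lt_of_neg (by norm_num) (by linarith))
  set γ := 1 - (2 : ℝ) ^ (1 - α) with hγdef
  have hγ1 : γ ≤ 1 := by
    have : (0 : ℝ) < 2 ^ (1 - α) := by positivity
    linarith
  set η := Real.logb 2 γ⁻¹ with hη
  have hη0 : 0 ≤ η := Real.logb_nonneg (by norm_num) ((one_le_inv₀ hγ).2 hγ1)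
  set c₁ := (1 + η) / (α - 1) with hc₁
  have hα' : 0 < α - 1 := by linarith
  have hc₁0 : 0 ≤ c₁ := by positivity
  set c₂ := 9 + (3 + η) * c₁ with hc₂
  have hc₂0 : 0 < c₂ := by positivity
  -- `c₂` bounds `(R + 1) / M` and depends on `α` only; the depth is `J * (R + 1) + 2` with `J ≤ 2 *
  -- log d`.
  refine ⟨2 * c₂ + 2, by positivity, fun β p hβ hp => ?_⟩
  have hq := qAB_pos hα hβ
  have hc : 0 < cP p := cP_pos
  -- `36 = 2 * 2 * 9`: the 2 in the count of hats, the 2 in `2 ^ J ≤ 2 * d`, nine neurons per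
  -- position. 38 is 19 times the 2 of `hJR`.
  refine ⟨36 * (3 + 38 * c₂) * (8 * cP p * qAB α β / γ) ^ (1 / (α - 1)), by positivity,
    fun d hd ε hε hε' => ?_⟩
  obtain ⟨n, rfl⟩ : ∃ n, d = n + 1 := ⟨d - 1, by omega⟩
  have hβ' : 0 < 1 / (β - 1) := one_div_pos.2 (by linarith)
  have hb : (0 : ℝ) < 1 - 2 ^ (-(1 / (β - 1))) :=
    sub_pos.2 (Real.rpow_lt_one_of_one_lt_of_neg (by norm_num) (by linarith))
  have hε1 : ε < 1 := hε'.trans_le (min_le_left _ _)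
  have hε2 : ε < ((n + 1 : ℕ) : ℝ) / (2 ^ (α * (n + 1 : ℕ)) * γ) :=
    hε'.trans_le ((min_le_right _ _).trans (min_le_left _ _))
  set M := max 1 (Real.logb 2 ε⁻¹) with hM
  have hM1 : 1 ≤ M := le_max_left _ _
  have hMε : Real.logb 2 ε⁻¹ ≤ M := le_max_right _ _
  have hdM : ((n + 1 : ℕ) : ℝ) ≤ c₁ * M := by
    have h := mul_dim_le_logb hγ hε hε2
    rw [hc₁, div_mul_eq_mul_div, le_div_iff₀ hα']
    nlinarith
  obtain ⟨R, hR, hRM, hRε⟩ := exists_accuracy (by omega) hγ hγ1 hη hM1 hMε hε hε1 hdM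
  obtain ⟨J, hJ, hJ2, hJlog⟩ := exists_two_pow_between hd
  have hlog1 : 1 ≤ Real.logb 2 ((n + 1 : ℕ) : ℝ) := by
    rw [Real.le_logb_iff_rpow_le (by norm_num) (by positivity), Real.rpow_one]
    exact_mod_cast hd
  have hlogd := logb_two_natCast_le (n + 1) (by omega)
  have hJR : (J : ℝ) * (R + 1) ≤ 2 * c₂ * (Real.logb 2 ((n + 1 : ℕ) : ℝ) * M) := by
    calc (J : ℝ) * (R + 1) ≤ (2 * Real.logb 2 ((n + 1 : ℕ) : ℝ)) * (c₂ * M) := by gcongr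
      _ = _ := by ring
  -- `m` is a real number, possibly negative, with `2 ^ ((α - 1) * m) = X`; this makes the bound for
  -- the truncation error exactly `ε / 2`.
  set X := 8 * ((n : ℝ) + 1) * ((2 : ℝ) ^ (-(α + 1))) ^ (n + 1) * ((cP p)⁻¹ ^ n *
      (qAB α β)⁻¹ ^ n) / (γ * ε) with hX
  have hX0 : 0 < X := by positivity
  set m := Real.logb 2 X * (1 / (α - 1)) with hm
  have h2m : (2 : ℝ) ^ m = X ^ (1 / (α - 1)) := by
    rw [hm, Real.rpow_mul (by norm_num), Real.rpow_logb (by norm_num) (by norm_num) hX0]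
  have h2m' : (2 : ℝ) ^ (-((α - 1) * m)) = X⁻¹ := by
    rw [Real.rpow_neg (by norm_num), hm, show (α - 1) * (Real.logb 2 X * (1 / (α - 1))) =
      Real.logb 2 X by field_simp, Real.rpow_logb (by norm_num) (by norm_num) hX0]
  obtain ⟨S, A, hA, hdepth, hsize, happrox⟩ :=
    exists_architecture_approx hα hβ hp hJ hR m
  refine ⟨S, A, hA, fun f hf => ?_, ?_, ?_⟩
  · obtain ⟨Φ, hΦ, hmem, hnorm⟩ := happrox f hf
    refine ⟨Φ, hΦ, hmem, hnorm.trans (ENNReal.ofReal_le_ofReal ?_)⟩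
    rw [h2m']
    set L := ((2 : ℝ) ^ (-(α + 1))) ^ (n + 1) with hL
    have hL0 : 0 < L := by positivity
    have hL1 : L ≤ 1 := pow_le_one₀ (by positivity)
      (Real.rpow_le_one_of_one_le_of_nonpos (by norm_num) (by linarith))
    have e1 : ((n : ℝ) + 1) * (4 * L * ((cP p)⁻¹ ^ n * (X⁻¹ / γ * (qAB α β)⁻¹ ^ n))) = ε / 2 := by
      rw [hX]
      field_simp
      norm_num
    have e2 : ((n : ℝ) + 1) * (4 * L * (4 ^ J * (2 * (2 ^ R)⁻¹) * γ⁻¹ ^ (n + 1))) ≤ ε / 2 := by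
      have h4 : (4 : ℝ) ^ J ≤ 4 * ((n + 1 : ℕ) : ℝ) ^ 2 := by
        rw [show (4 : ℝ) = 2 ^ 2 by norm_num, ← pow_mul, mul_comm, pow_mul]
        calc ((2 : ℝ) ^ J) ^ 2 ≤ (2 * ((n + 1 : ℕ) : ℝ)) ^ 2 := by gcongr
          _ = _ := by ring
      calc ((n : ℝ) + 1) * (4 * L * (4 ^ J * (2 * (2 ^ R)⁻¹) * γ⁻¹ ^ (n + 1)))
          ≤ ((n : ℝ) + 1) * (4 * 1 * ((4 * ((n + 1 : ℕ) : ℝ) ^ 2) * (2 * (2 ^ R)⁻¹) *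
              γ⁻¹ ^ (n + 1))) := by gcongr
        _ = (64 * ((n + 1 : ℕ) : ℝ) ^ 3 * γ⁻¹ ^ (n + 1) * (2 ^ R)⁻¹) / 2 := by
            push_cast; ring
        _ ≤ ε / 2 := by linarith
    calc _ = ((n : ℝ) + 1) * (4 * L * ((cP p)⁻¹ ^ n * (X⁻¹ / γ * (qAB α β)⁻¹ ^ n))) +
        ((n : ℝ) + 1) * (4 * L * (4 ^ J * (2 * (2 ^ R)⁻¹) * γ⁻¹ ^ (n + 1))) := by ring
      _ ≤ ε := by linarith
  · rw [hdepth]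
    push_cast at hJR hlog1 ⊢
    nlinarith [mul_nonneg (sub_nonneg.2 hlog1) (sub_nonneg.2 hM1)]
  · have h19 : 3 + 19 * ((J : ℝ) * (R + 1)) ≤ (3 + 38 * c₂) * ((n + 1 : ℕ) : ℝ) * M := by
      have hdM1 : 1 ≤ ((n + 1 : ℕ) : ℝ) * M := one_le_mul_of_one_le_of_one_le (by simp) hM1
      have : Real.logb 2 ((n + 1 : ℕ) : ℝ) * M ≤ ((n + 1 : ℕ) : ℝ) * M := by gcongr
      have := mul_le_mul_of_nonneg_left this hc₂0.le
      linarith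
    -- The three powers of `d` come from the pieces of the sparse set, from `2 ^ J ≤ 2 * d` and from
    -- `log d ≤ d`.
    calc (A.size : ℝ) ≤ ((n + 1) * (2 * 2 ^ m * ((1 - (2 : ℝ) ^ (-(1 / (β - 1))))⁻¹) ^ n)) *
        (2 ^ J * 9) * (3 + 19 * (J * (R + 1))) := hsize
      _ ≤ ((n + 1) * (2 * 2 ^ m * ((1 - (2 : ℝ) ^ (-(1 / (β - 1))))⁻¹) ^ n)) *
        ((2 * ((n + 1 : ℕ) : ℝ)) * 9) * ((3 + 38 * c₂) * ((n + 1 : ℕ) : ℝ) * M) := by gcongr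
      _ = 36 * (3 + 38 * c₂) * (((n : ℝ) + 1) ^ 3 * X ^ (1 / (α - 1)) *
          ((1 - (2 : ℝ) ^ (-(1 / (β - 1))))⁻¹) ^ n) * M := by
            rw [h2m]; push_cast; ring
      _ ≤ 36 * (3 + 38 * c₂) * ((8 * cP p * qAB α β / γ) ^ (1 / (α - 1)) *
        baseB (n + 1) α β p ^ (-((n + 1 : ℕ) : ℤ)) * ε⁻¹ ^ (1 / (α - 1))) * M := by
            gcongr ?_ * _
            exact mul_le_mul_of_nonneg_left (pow_three_mul_rpow_le hα hα₂ hβ hε n) (by positivity)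
      _ = _ := by ring

/-! ### The base `B` in high dimension -/

theorem one_le_cP {p : ℝ≥0∞} : 1 ≤ cP p := by
  rw [cP]
  split_ifs
  · exact le_rfl
  · exact Real.one_le_rpow (by linarith [p.toReal_nonneg]) (by positivity)

/-- Bernoulli's inequality with exponent `p / 2 ≤ 1` gives `3 ^ (p / 2) ≤ 1 + p`. -/
theorem sqrt_three_le_cP {p : ℝ≥0∞} (hp : 1 ≤ p) (hp2 : p ≤ 2) : (3 : ℝ) ^ (1 / 2 : ℝ) ≤ cP p := by
  have hpt : p ≠ ⊤ := ne_top_of_le_ne_top (by simp) hp2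
  have h1 : 1 ≤ p.toReal := by simpa using ENNReal.toReal_mono hpt hp
  have h2 : p.toReal ≤ 2 := by simpa using ENNReal.toReal_mono (by simp) hp2
  rw [cP, if_neg hpt]
  have hb := rpow_one_add_le_one_add_mul_self (s := (2 : ℝ)) (by norm_num)
    (p := p.toReal / 2) (by linarith) (by linarith)
  calc (3 : ℝ) ^ (1 / 2 : ℝ) = (3 ^ (p.toReal / 2)) ^ (1 / p.toReal) := by
        rw [← Real.rpow_mul (by norm_num)]
        congr 1
        field_simp
    _ ≤ _ := by
        refine Real.rpow_le_rpow (by positivity) ?_ (by positivity)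
        norm_num at hb
        linarith

/-- The worst case is `α = p = 2`, where `√2 - 3 ^ (-1/4) / 2` exceeds 1; the decimal bounds leave
`1.41 - 0.4`. -/
theorem condAlpha_of_le_two {α : ℝ} (hα : 1 < α) (hα₂ : α ≤ 2) {p : ℝ≥0∞} (hp : 1 ≤ p)
    (hp2 : p ≤ 2) : CondAlpha α p := by
  have hs : 1 / 2 ≤ 1 / α := one_div_le_one_div_of_le (by linarith) hα₂
  have h1 : (1.41 : ℝ) ≤ 2 ^ (1 / α) :=
    calc (1.41 : ℝ) ≤ 2 ^ (1 / 2 : ℝ) := by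
          rw [← Real.sqrt_eq_rpow]
          exact Real.le_sqrt_of_sq_le (by norm_num)
      _ ≤ _ := Real.rpow_le_rpow_of_exponent_le (by norm_num) hs
  have h2 : cP p ^ (-(1 / α)) ≤ 0.8 := by
    have h3 : (1.73 : ℝ) ≤ cP p := by
      refine le_trans ?_ (sqrt_three_le_cP hp hp2)
      rw [← Real.sqrt_eq_rpow]
      exact Real.le_sqrt_of_sq_le (by norm_num)
    have h4 : (1.25 : ℝ) ≤ cP p ^ (1 / α) :=
      calc (1.25 : ℝ) ≤ 1.73 ^ (1 / 2 : ℝ) := by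
            rw [← Real.sqrt_eq_rpow]
            exact Real.le_sqrt_of_sq_le (by norm_num)
        _ ≤ cP p ^ (1 / 2 : ℝ) := Real.rpow_le_rpow (by norm_num) h3 (by norm_num)
        _ ≤ _ := Real.rpow_le_rpow_of_exponent_le one_le_cP hs
    rw [Real.rpow_neg (by linarith), inv_le_comm₀ (by linarith) (by norm_num)]
    exact le_trans (by norm_num) h4
  rw [CondAlpha]
  linarith

/-- `t` satisfies `t ^ α * cP p * 2 ^ (α + 1) = 1` and `2 ^ ellAP α p = 1 - t`. The two halves of
`CondBeta` say that `qAB α β` and `b` exceed `t`; replacing `t ^ α` by the larger `b ^ (α - 1) * qAB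
α β` makes the product exceed 1. -/
theorem one_lt_limit_baseB {α β : ℝ} (hα : 1 < α) (hβ : α < β) {p : ℝ≥0∞}
    (h : CondBeta α β p) :
    1 < (1 - (2 : ℝ) ^ (-(1 / (β - 1)))) *
      (cP p * 2 ^ (α + 1) * qAB α β) ^ (1 / (α - 1)) := by
  have hc : 0 < cP p := cP_pos
  have hq := qAB_pos hα hβ
  set t := cP p ^ (-(1 / α)) * (2 : ℝ) ^ (-1 - 1 / α) with ht
  have hα0 : 0 < 1 / α := by positivity
  have ht0 : 0 < t := by positivity
  -- This makes `1 + l` positive, so that the lower bound on `β` can be cleared of its denominator.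
  have ht2 : t < 1 / 2 := by
    have h1 : cP p ^ (-(1 / α)) ≤ 1 :=
      Real.rpow_le_one_of_one_le_of_nonpos one_le_cP (by linarith)
    have h2 : (2 : ℝ) ^ (-1 - 1 / α) < 2 ^ (-1 : ℝ) :=
      Real.rpow_lt_rpow_of_exponent_lt (by norm_num) (by linarith)
    rw [Real.rpow_neg_one] at h2
    calc t ≤ 1 * (2 : ℝ) ^ (-1 - 1 / α) := by rw [ht]; gcongr
      _ < 1 / 2 := by linarith
  have hell : ellAP α p = Real.logb 2 (1 - t) := rfl
  set l := ellAP α p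
  have h2l : (2 : ℝ) ^ l = 1 - t := by
    rw [hell, Real.rpow_logb (by norm_num) (by norm_num) (by linarith)]
  have hl0 : l < 0 := by rw [hell]; exact Real.logb_neg (by norm_num) (by linarith) (by linarith)
  have hl1 : -1 < l := by
    rw [hell, Real.lt_logb_iff_rpow_lt (by norm_num) (by linarith), Real.rpow_neg_one]
    linarith
  obtain ⟨hA, hB⟩ := h
  have hβ1 : 0 < β - 1 := by linarith
  have hb : t < 1 - (2 : ℝ) ^ (-(1 / (β - 1))) := by
    have : -(1 / (β - 1)) < l := by
      have h1 : (β - 1) * l > -1 := by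
        have : (β - 1) * l > -(1 / l) * l := mul_lt_mul_of_neg_right (by linarith) hl0
        rwa [neg_mul, one_div_mul_cancel hl0.ne] at this
      rw [← neg_div, div_lt_iff₀ hβ1]
      linarith
    have := Real.rpow_lt_rpow_of_exponent_lt (by norm_num : (1 : ℝ) < 2) this
    linarith
  have hqt : t < qAB α β := by
    have : -((β - α) / (β - 1)) < l := by
      rw [div_lt_iff₀ (by linarith)] at hA
      rw [← neg_div, div_lt_iff₀ hβ1]
      linarith
    have := Real.rpow_lt_rpow_of_exponent_lt (by norm_num : (1 : ℝ) < 2) this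
    rw [qAB]
    linarith
  set b := 1 - (2 : ℝ) ^ (-(1 / (β - 1)))
  have hα' : 0 < α - 1 := by linarith
  have htα : t ^ α * (cP p * 2 ^ (α + 1)) = 1 := by
    rw [ht, Real.mul_rpow (by positivity) (by positivity), ← Real.rpow_mul hc.le,
      ← Real.rpow_mul (by norm_num), show -(1 / α) * α = -1 by field_simp,
      show (-1 - 1 / α) * α = -(α + 1) by field_simp; ring, Real.rpow_neg hc.le, Real.rpow_one,
      Real.rpow_neg (by norm_num)]
    field_simp
  have hbt : t ^ (α - 1) < b ^ (α - 1) := Real.rpow_lt_rpow ht0.le hb hα'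
  have key : 1 < b ^ (α - 1) * (cP p * 2 ^ (α + 1) * qAB α β) := by
    have hts : t ^ α = t ^ (α - 1) * t := by rw [← Real.rpow_add_one ht0.ne', sub_add_cancel]
    calc (1 : ℝ) = t ^ (α - 1) * (cP p * 2 ^ (α + 1) * t) := by
          rw [hts] at htα
          linarith
      _ < b ^ (α - 1) * (cP p * 2 ^ (α + 1) * qAB α β) := by gcongr
  have hb0 : 0 < b := ht0.trans hb
  have := Real.one_lt_rpow key (one_div_pos.2 hα')
  rwa [Real.mul_rpow (by positivity) (by positivity), ← Real.rpow_mul hb0.le,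
    mul_one_div_cancel hα'.ne', Real.rpow_one] at this

/-- `d ^ (2 * α / d)` tends to 1, so the polynomial correction disappears in the limit. -/
theorem tendsto_baseB {α β : ℝ} (hα : 1 < α) (p : ℝ≥0∞) :
    Filter.Tendsto (fun d : ℕ => baseB d α β p) Filter.atTop
      (nhds ((1 - (2 : ℝ) ^ (-(1 / (β - 1)))) *
        (cP p * 2 ^ (α + 1) * qAB α β) ^ (1 / (α - 1)))) := by
  have h1 : Filter.Tendsto (fun d : ℕ => (d : ℝ) ^ (2 * α / d)) Filter.atTop (nhds 1) := by
    have := (tendsto_rpow_div_mul_add (2 * α) 1 0 (by norm_num)).comp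
      tendsto_natCast_atTop_atTop
    simpa [Function.comp_def] using this
  have h2 := (tendsto_const_nhds (x := cP p * 2 ^ (α + 1) * qAB α β)).div h1 one_ne_zero
  rw [div_one] at h2
  exact (h2.rpow_const (Or.inr (one_div_nonneg.2 (by linarith)))).const_mul _

theorem exists_one_lt_le_baseB {α β : ℝ} (hα : 1 < α) (hβ : α < β) {p : ℝ≥0∞}
    (h : CondBeta α β p) :
    ∃ (d₀ : ℕ) (B₀ : ℝ), 1 < B₀ ∧ ∀ d : ℕ, d₀ ≤ d → B₀ ≤ baseB d α β p := by
  obtain ⟨B₀, h1, h2⟩ := exists_between (one_lt_limit_baseB hα hβ h)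
  obtain ⟨d₀, hd₀⟩ := Filter.eventually_atTop.1
    ((tendsto_baseB hα p).eventually (lt_mem_nhds h2))
  exact ⟨d₀, B₀, h1, fun d hd => (hd₀ d hd).le⟩

end ReLUApprox

end

open ReLUApprox in
theorem theorem4p3 (α : ℝ) (hα₁ : 1 < α) (hα₂ : α ≤ 2) :
    ∃ K₂ : ℝ, 0 < K₂ ∧ ∀ (β : ℝ) (p : ENNReal), α < β → 1 ≤ p →
      (∃ K₃ : ℝ, 0 < K₃ ∧ ∀ d : ℕ, 2 ≤ d → ∀ ε : ℝ, 0 < ε → ε < eps0 d α β p →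
        ∃ (S : NetShape d) (A : NeuralNet S), A.IsArchitecture ∧
          (∀ f ∈ holderBall d α, ∃ Φ : NeuralNet S, Φ.HasArchitecture A ∧
            MemSobolevZero p (fun x => f x - Φ.output x) ∧
            sobolevNorm p (fun x => f x - Φ.output x) ≤ ENNReal.ofReal ε) ∧
          (A.depth : ℝ) ≤ K₂ * Real.logb 2 d * max 1 (Real.logb 2 ε⁻¹) ∧
          (A.size : ℝ) ≤
            K₃ * baseB d α β p ^ (-(d : ℤ)) * ε⁻¹ ^ (1 / (α - 1)) * max 1 (Real.logb 2 ε⁻¹)) ∧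
      (CondAlpha α p → CondBeta α β p →
        ∃ (d₀ : ℕ) (B₀ : ℝ), 1 < B₀ ∧ ∀ d : ℕ, d₀ ≤ d → B₀ ≤ baseB d α β p) ∧
      (p ≤ 2 → CondAlpha α p) := by
  obtain ⟨K₂, hK₂, h⟩ := exists_approximating_architecture hα₁ hα₂
  exact ⟨K₂, hK₂, fun β p hβ hp => ⟨h β p hβ hp, fun _ hcond => exists_one_lt_le_baseB hα₁ hβ hcond,
    condAlpha_of_le_two hα₁ hα₂ hp⟩⟩
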